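/- **(A singularity $D_\mu$.)** Let $\nu\ge 2$, write $x=k_1$, $y=k_2$, $z=(k_3,\dots,k_\nu)$ for the coordinates of $\mathbb R^\nu$, and denote by subscripts the values of partial derivatives at the origin, e.g. $f_{x^ay^b}=\frac{\partial^{a+b}f(0)}{\partial x^a\partial y^b}$. Let $0$ be a critical point of a smooth function $f:\mathbb R^\nu\to\mathbb R$ such that the kernel of the second differential of $f$ at the origin is the coordinate plane $Ok_1k_2$ (so that $0$ has co-rank $2$). Suppose that $$f_{x^3}=f_{xy^2}=0,\qquad f_{x^2y}=1 .\tag{N}$$ (For a function $f$ satisfying the other hypotheses, (N) can be achieved by a linear change of the variables $k_1,k_2$, provided that the cubic part of the Taylor series at the origin of $f(k_1,k_2,0,\dots,0)$ does not vanish and is not a perfect cube, i.e. not the cube of a real linear form.) Type of singularity: for $\mu\ge4$ the germ of $f$ at $0$ is of type $D_\mu^{+}$ (resp. $D_\mu^-$) if in some neighbourhood of the origin $f=d+\tilde k_1^2\tilde k_2+\tilde k_2^{\mu-1}+Q(\tilde k_3,\dots,\tilde k_\nu)$ (resp. $f=d+\tilde k_1^2\tilde k_2-\tilde k_2^{\mu-1}+Q(\tilde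 k_3,\dots,\tilde k_\nu)$) after a regular smooth change of variables $k\to\tilde k$ leaving the origin fixed, with a constant $d$ and a nondegenerate quadratic form $Q$ in $\nu-2$ variables. Let $G=f_{z^2}^{-1}$ be the inverse of the matrix $f_{z^2}=\|\frac{\partial^2 f(0)}{\partial k_i\partial k_j}\|_{i,j=3}^{\nu}$. Then there are numbers $d_\mu=d_\mu(f)$, $\mu=4,5,\dots$, with the following properties. 1. $d_\mu=f_{y^{\mu-1}}+P_\mu$, where $P_\mu$ is a polynomial (depending only on $\nu$ and $\mu$, not on $f$) with rational coefficients and vanishing free term in the partial derivatives of $f$ at the origin of orders between $3$ and $\mu-2$, except those with respect to $k_2$ only, and in the components of $G$. For $\mu=4,\dots,8$ these numbers are $$d_4=a_{0,3},\qquad d_5=a_{0,4},\qquad d_6=a_{0,5}-\tfrac53a_{1,3}^2,\qquad d_7=a_{0,6}-5a_{1,3}a_{1,4}+5a_{1,3}^2a_{2,2},$$ $$d_8=a_{0,7}-7a_{1,3}a_{1,5}+\tfrac{35}{3}a_{1,3}^2a_{2,3}-\tfrac{35}{9}a_{1,3}^3a_{3,1}-\tfrac{35}{8}(a_{1,4}-2a_{1,3}a_{2,2})^2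 .$$ Here, for a monomial $l$ in $x,y$, let $f_{lz}$, $f_{lz^2}$, $f_{lz^3}$ be the vector, the symmetric matrix and the symmetric trilinear form of the derivatives $f_{lz_i}$, $f_{lz_iz_j}$, $f_{lz_iz_jz_k}$; let $\cdot$ be the standard scalar product of $\mathbb R^{\nu-2}$ and, for vectors $u,v$, write $f_{lz^2}(u,v)=u\cdot f_{lz^2}v$; put $$p=Gf_{y^2z},\quad q=Gf_{y^3z},\quad r=Gf_{y^4z},\quad s=Gf_{xyz},\quad t=Gf_{x^2z},\quad w=Gf_{yz^2}\,p,\quad h=Gf_{xy^2z}.$$ Then $$a_{0,3}=f_{y^3},\qquad a_{0,4}=f_{y^4}-3f_{y^2z}\cdot p,\qquad a_{0,5}=f_{y^5}-10f_{y^3z}\cdot p+15f_{yz^2}(p,p),$$ $$a_{0,6}=f_{y^6}-15f_{y^4z}\cdot p+60f_{yz^2}(p,q)-90f_{yz^2}(p,w)-10f_{y^3z}\cdot q+45f_{y^2z^2}(p,p)-15f_{z^3}(p,p,p),$$ $$\begin{aligned}a_{0,7}={}&f_{y^7}-21f_{y^5z}\cdot p-35f_{y^4z}\cdot q+105f_{y^3z^2}(p,p)+210f_{y^2z^2}(p,q)+105f_{yz^2}(p,r)+70f_{yz^2}(q,q)\\&-105f_{yz^3}(p,p,p)-105f_{z^3}(p,p,q)-630f_{y^2z^2}(w,p)-420f_{yz^2}(w,q)+630f_{yz^2}(w,w)+315f_{z^3}(p,p,w),\end{aligned}$$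 $$a_{1,3}=f_{xy^3}-3f_{xyz}\cdot p,\qquad a_{3,1}=f_{x^3y}-3f_{xyz}\cdot t,\qquad a_{2,2}=f_{x^2y^2}-2f_{xyz}\cdot s-f_{x^2z}\cdot p,$$ $$a_{1,4}=f_{xy^4}-6f_{xy^2z}\cdot p-4f_{y^3z}\cdot s+3f_{xz^2}(p,p)+12f_{yz^2}(p,s),$$ $$a_{2,3}=f_{x^2y^3}-f_{x^2z}\cdot q-3\bigl(f_{x^2yz}\cdot p-f_{yz^2}(t,p)-2f_{xz^2}(s,p)\bigr)-6\bigl(f_{xy^2z}\cdot s-f_{yz^2}(s,s)\bigr),$$ $$\begin{aligned}a_{1,5}={}&f_{xy^5}-10f_{y^3z}\cdot h-30f_{xz^2}(p,w)-60f_{yz^2}(s,w)-5f_{y^4z}\cdot s-10f_{xy^3z}\cdot p-15f_{z^3}(s,p,p)\\&+15f_{xyz^2}(p,p)+30f_{y^2z^2}(s,p)+10f_{xz^2}(p,q)+20f_{yz^2}(s,q)+30f_{yz^2}(p,h).\end{aligned}$$ 2. For every $\mu\ge4$, the germ of $f$ at the origin has a singularity of type $D_\mu^\pm$ (i.e. of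 type $D_\mu^+$ or $D_\mu^-$) if and only if $$d_4=\dots=d_{\mu-1}=0,\qquad d_\mu\ne0 .$$ Moreover, in this case $f$ reduces to the form $$f=d+\tilde k_1^2\tilde k_2+d_\mu\tilde k_2^{\mu-1}+Q(\tilde k_3,\dots,\tilde k_\nu)$$ in some neighbourhood of the origin by a regular smooth change of variables $k\to\tilde k$ leaving the origin fixed, where $d$ is a constant and $Q$ is a nondegenerate quadratic form in $\nu-2$ variables. In particular, $f\in D_\mu^+$ if $d_\mu>0$, and $f\in D_\mu^-$ if $d_\mu<0$. -/

import Mathlib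

open scoped ContDiff Topology

namespace DSing

noncomputable section

/- Conventions. The space ℝ^ν, ν = n + 2 ≥ 2, is `Fin (n + 2) → ℝ`. The coordinates are
x = k₁ (index `0`), y = k₂ (index `1`) and z = (k₃, …, k_ν) (indices `j.succ.succ`, `j : Fin n`). -/

/-- The iterated partial derivative `∂^m f / ∂k_{i₁} ⋯ ∂k_{i_m}` as a function of the point;
a word `[i₁, …, i_m]` in the indices names the derivative. -/
def partialDeriv {m : ℕ} (f : (Fin m → ℝ) → ℝ) : List (Fin m) → (Fin m → ℝ) → ℝ
  | [] => f
  | i :: l => fun k => fderiv ℝ (partialDeriv f l) k (Pi.single i 1)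

/-- The value of an iterated partial derivative at the origin. -/
def D {m : ℕ} (f : (Fin m → ℝ) → ℝ) (l : List (Fin m)) : ℝ := partialDeriv f l 0

variable {n : ℕ}

/-- The index of the `j`-th of the variables `z = (k₃, …, k_ν)`. -/
def zi (j : Fin n) : Fin (n + 2) := j.succ.succ

/-- The origin is a critical point of the smooth function `f`, and the kernel of the second
differential of `f` at the origin is the coordinate plane `O k₁ k₂`. -/
structure IsCorankTwo (f : (Fin (n + 2) → ℝ) → ℝ) : Prop where
  smooth : ContDiff ℝ ∞ f
  critical : fderiv ℝ f 0 = 0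
  kernel : ∀ v : Fin (n + 2) → ℝ,
    fderiv ℝ (fderiv ℝ f) 0 v = 0 ↔ ∀ j : Fin n, v (zi j) = 0

/-- The normalization `f_{x³} = f_{xy²} = 0`, `f_{x²y} = 1` at the origin. -/
structure IsCubicNormalized (f : (Fin (n + 2) → ℝ) → ℝ) : Prop where
  xxx : D f [0, 0, 0] = 0
  xyy : D f [0, 1, 1] = 0
  xxy : D f [0, 0, 1] = 1

/-- The cubic part of the Taylor series at the origin of `f(k₁, k₂, 0, …, 0)`. -/
def cubicPart (f : (Fin (n + 2) → ℝ) → ℝ) (s t : ℝ) : ℝ :=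
  D f [0, 0, 0] / 6 * s ^ 3 + D f [0, 0, 1] / 2 * s ^ 2 * t
    + D f [0, 1, 1] / 2 * s * t ^ 2 + D f [1, 1, 1] / 6 * t ^ 3

/-- The linear map `(k₁, k₂, k₃, …) ↦ (a k₁ + b k₂, c k₁ + e k₂, k₃, …)`. -/
def planeMap (a b c e : ℝ) (k : Fin (n + 2) → ℝ) : Fin (n + 2) → ℝ :=
  Fin.cons (a * k 0 + b * k 1) (Fin.cons (c * k 0 + e * k 1) fun j : Fin n => k (zi j))

/-! ### Normal forms and singularity types -/

/-- A (germ at the origin of a) regular smooth change of variables leaving the origin fixed. -/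
def IsRegularChange {m : ℕ} (φ : (Fin m → ℝ) → (Fin m → ℝ)) : Prop :=
  φ 0 = 0 ∧ (∃ U ∈ 𝓝 (0 : Fin m → ℝ), ContDiffOn ℝ ∞ φ U) ∧
    Function.Bijective (fderiv ℝ φ 0)

/-- By means of a regular change of variables `k̃ = φ k` leaving the origin fixed, `f` reduces, in
some neighbourhood of the origin, to the form `d + k̃₁² k̃₂ + c k̃₂^(μ-1) + Q(k̃₃, …, k̃_ν)`
with a constant `d` and a nondegenerate quadratic form `Q`. -/
def ReducesTo (μ : ℕ) (c : ℝ) (f : (Fin (n + 2) → ℝ) → ℝ) : Prop :=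
  ∃ φ : (Fin (n + 2) → ℝ) → (Fin (n + 2) → ℝ), IsRegularChange φ ∧
    ∃ (d : ℝ) (Q : QuadraticForm ℝ (Fin n → ℝ)), (QuadraticMap.polarBilin Q).Nondegenerate ∧
      ∀ᶠ k in 𝓝 (0 : Fin (n + 2) → ℝ),
        f k = d + φ k 0 ^ 2 * φ k 1 + c * φ k 1 ^ (μ - 1) + Q (fun j => φ k (zi j))

/-- The germ of `f` at the origin has a singularity of type `D_μ⁺` (normal form
`x² y + y^(μ-1)`), up to adding a constant, adding a nondegenerate quadratic form in the remaining
variables, and a smooth change of variables leaving the origin fixed. -/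
def IsDPlus (μ : ℕ) (f : (Fin (n + 2) → ℝ) → ℝ) : Prop := ReducesTo μ 1 f

/-- The germ of `f` at the origin has a singularity of type `D_μ⁻` (normal form
`x² y - y^(μ-1)`). -/
def IsDMinus (μ : ℕ) (f : (Fin (n + 2) → ℝ) → ℝ) : Prop := ReducesTo μ (-1) f

/-! ### The shape of the numbers `d_μ` -/

/-- The matrix `‖∂²f(0)/∂k_i∂k_j‖`, `i, j = 3, …, ν`. -/
def hessZ (f : (Fin (n + 2) → ℝ) → ℝ) : Matrix (Fin n) (Fin n) ℝ :=
  Matrix.of fun i j => D f [zi i, zi j]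

/-- Polynomial variables: one for every partial derivative (named by a word in the indices) and
one for every component of the inverse of the matrix `hessZ f`. -/
abbrev Var (n : ℕ) : Type := List (Fin (n + 2)) ⊕ (Fin n × Fin n)

/-- The value at `f` of a polynomial in the partial derivatives at the origin and the components
of the inverse matrix. -/
def evalAt (f : (Fin (n + 2) → ℝ) → ℝ) (P : MvPolynomial (Var n) ℚ) : ℝ :=
  MvPolynomial.aeval
    (Sum.elim (fun l => D f l) fun p => (hessZ f)⁻¹ p.1 p.2 : Var n → ℝ) P

/-- The variables allowed in the additional terms of `d_μ`: the partial derivatives of order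
between `3` and `μ - 2`, except those with respect to `k₂` only, and all components of the
inverse matrix. -/
def Allowed (μ : ℕ) : Var n → Prop
  | Sum.inl l => 3 ≤ l.length ∧ l.length ≤ μ - 2 ∧ ∃ i ∈ l, i ≠ 1
  | Sum.inr _ => True

/-- `∂^(μ-1) f(0) / ∂k₂^(μ-1)` plus additional terms given by the polynomial `P μ`. -/
def dNum (P : ℕ → MvPolynomial (Var n) ℚ) (f : (Fin (n + 2) → ℝ) → ℝ) (μ : ℕ) : ℝ :=
  D f (List.replicate (μ - 1) 1) + evalAt f (P μ)

/-! ### The numbers `a_{i,j}` of the table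

For a word `l` in the indices, `vec f l`, `mat f l`, `cub f l` are the vector, the matrix and the
cubic tensor of the derivatives `f_{l z_i}`, `f_{l z_i z_j}`, `f_{l z_i z_j z_k}` at the origin, and
`gvec f l` is the vector `f_{z²}⁻¹ f_{l z}`. -/

def vec (f : (Fin (n + 2) → ℝ) → ℝ) (l : List (Fin (n + 2))) : Fin n → ℝ :=
  fun i => D f (l ++ [zi i])

def mat (f : (Fin (n + 2) → ℝ) → ℝ) (l : List (Fin (n + 2))) : Matrix (Fin n) (Fin n) ℝ :=
  Matrix.of fun i j => D f (l ++ [zi i, zi j])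

def cub (f : (Fin (n + 2) → ℝ) → ℝ) (l : List (Fin (n + 2))) (u v w : Fin n → ℝ) : ℝ :=
  ∑ i, ∑ j, ∑ k, D f (l ++ [zi i, zi j, zi k]) * u i * v j * w k

def gvec (f : (Fin (n + 2) → ℝ) → ℝ) (l : List (Fin (n + 2))) : Fin n → ℝ :=
  (hessZ f)⁻¹.mulVec (vec f l)

/-- The bilinear expression `uᵀ f_{l z²} v`. -/
def bil (f : (Fin (n + 2) → ℝ) → ℝ) (l : List (Fin (n + 2))) (u v : Fin n → ℝ) : ℝ :=
  u ⬝ᵥ (mat f l).mulVec v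

/-- The vector `f_{z²}⁻¹ f_{yz²} f_{z²}⁻¹ f_{y²z}`. -/
def gMg (f : (Fin (n + 2) → ℝ) → ℝ) : Fin n → ℝ :=
  (hessZ f)⁻¹.mulVec ((mat f [1]).mulVec (gvec f [1, 1]))

def a03 (f : (Fin (n + 2) → ℝ) → ℝ) : ℝ := D f [1, 1, 1]

def a04 (f : (Fin (n + 2) → ℝ) → ℝ) : ℝ :=
  D f [1, 1, 1, 1] - 3 * vec f [1, 1] ⬝ᵥ gvec f [1, 1]

def a05 (f : (Fin (n + 2) → ℝ) → ℝ) : ℝ :=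
  D f [1, 1, 1, 1, 1] - 10 * vec f [1, 1, 1] ⬝ᵥ gvec f [1, 1]
    + 15 * bil f [1] (gvec f [1, 1]) (gvec f [1, 1])

def a06 (f : (Fin (n + 2) → ℝ) → ℝ) : ℝ :=
  D f [1, 1, 1, 1, 1, 1]
    - 15 * (vec f [1, 1, 1, 1] ⬝ᵥ gvec f [1, 1]
        - 4 * bil f [1] (gvec f [1, 1]) (gvec f [1, 1, 1])
        + 6 * bil f [1] (gvec f [1, 1]) (gMg f))
    - 10 * vec f [1, 1, 1] ⬝ᵥ gvec f [1, 1, 1]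
    + 45 * bil f [1, 1] (gvec f [1, 1]) (gvec f [1, 1])
    - 15 * cub f [] (gvec f [1, 1]) (gvec f [1, 1]) (gvec f [1, 1])

def a07 (f : (Fin (n + 2) → ℝ) → ℝ) : ℝ :=
  D f [1, 1, 1, 1, 1, 1, 1]
    - 21 * vec f [1, 1, 1, 1, 1] ⬝ᵥ gvec f [1, 1]
    - 35 * vec f [1, 1, 1, 1] ⬝ᵥ gvec f [1, 1, 1]
    + 105 * bil f [1, 1, 1] (gvec f [1, 1]) (gvec f [1, 1])
    + 210 * bil f [1, 1] (gvec f [1, 1]) (gvec f [1, 1, 1])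
    + 105 * bil f [1] (gvec f [1, 1]) (gvec f [1, 1, 1, 1])
    + 70 * bil f [1] (gvec f [1, 1, 1]) (gvec f [1, 1, 1])
    - 105 * cub f [1] (gvec f [1, 1]) (gvec f [1, 1]) (gvec f [1, 1])
    - 105 * cub f [] (gvec f [1, 1]) (gvec f [1, 1]) (gvec f [1, 1, 1])
    - 630 * bil f [1, 1] (gMg f) (gvec f [1, 1])
    - 420 * bil f [1] (gMg f) (gvec f [1, 1, 1])
    + 630 * bil f [1] (gMg f) (gMg f)
    + 315 * cub f [] (gvec f [1, 1]) (gvec f [1, 1]) (gMg f)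

def a13 (f : (Fin (n + 2) → ℝ) → ℝ) : ℝ :=
  D f [0, 1, 1, 1] - 3 * vec f [0, 1] ⬝ᵥ gvec f [1, 1]

def a31 (f : (Fin (n + 2) → ℝ) → ℝ) : ℝ :=
  D f [1, 0, 0, 0] - 3 * vec f [1, 0] ⬝ᵥ gvec f [0, 0]

def a22 (f : (Fin (n + 2) → ℝ) → ℝ) : ℝ :=
  D f [0, 0, 1, 1] - 2 * vec f [0, 1] ⬝ᵥ gvec f [0, 1] - vec f [0, 0] ⬝ᵥ gvec f [1, 1]

def a14 (f : (Fin (n + 2) → ℝ) → ℝ) : ℝ :=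
  D f [0, 1, 1, 1, 1] - 6 * vec f [0, 1, 1] ⬝ᵥ gvec f [1, 1]
    - 4 * vec f [1, 1, 1] ⬝ᵥ gvec f [0, 1]
    + 3 * bil f [0] (gvec f [1, 1]) (gvec f [1, 1])
    + 12 * bil f [1] (gvec f [1, 1]) (gvec f [0, 1])

def a23 (f : (Fin (n + 2) → ℝ) → ℝ) : ℝ :=
  D f [0, 0, 1, 1, 1] - vec f [0, 0] ⬝ᵥ gvec f [1, 1, 1]
    - 3 * (vec f [0, 0, 1] ⬝ᵥ gvec f [1, 1]
        - bil f [1] (gvec f [0, 0]) (gvec f [1, 1])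
        - 2 * bil f [0] (gvec f [0, 1]) (gvec f [1, 1]))
    - 6 * (vec f [0, 1, 1] ⬝ᵥ gvec f [0, 1] - bil f [1] (gvec f [0, 1]) (gvec f [0, 1]))

def a15 (f : (Fin (n + 2) → ℝ) → ℝ) : ℝ :=
  D f [0, 1, 1, 1, 1, 1] - 10 * vec f [1, 1, 1] ⬝ᵥ gvec f [0, 1, 1]
    - 30 * bil f [0] (gvec f [1, 1]) (gMg f)
    - 60 * bil f [1] (gvec f [0, 1]) (gMg f)
    - 5 * vec f [1, 1, 1, 1] ⬝ᵥ gvec f [0, 1]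
    - 10 * vec f [0, 1, 1, 1] ⬝ᵥ gvec f [1, 1]
    - 15 * cub f [] (gvec f [0, 1]) (gvec f [1, 1]) (gvec f [1, 1])
    + 15 * bil f [0, 1] (gvec f [1, 1]) (gvec f [1, 1])
    + 30 * bil f [1, 1] (gvec f [0, 1]) (gvec f [1, 1])
    + 10 * bil f [0] (gvec f [1, 1]) (gvec f [1, 1, 1])
    + 20 * bil f [1] (gvec f [0, 1]) (gvec f [1, 1, 1])
    + 30 * bil f [1] (gvec f [1, 1]) (gvec f [0, 1, 1])

/-- The table of the numbers `d_μ` for `μ = 4, 5, 6, 7, 8`. -/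
structure IsTable (f : (Fin (n + 2) → ℝ) → ℝ) (d : ℕ → ℝ) : Prop where
  d4 : d 4 = a03 f
  d5 : d 5 = a04 f
  d6 : d 6 = a05 f - 5 / 3 * a13 f ^ 2
  d7 : d 7 = a06 f - 5 * a13 f * a14 f + 5 * a13 f ^ 2 * a22 f
  d8 : d 8 = a07 f - 7 * a13 f * a15 f + 35 / 3 * a13 f ^ 2 * a23 f
    - 35 / 9 * a13 f ^ 3 * a31 f - 35 / 8 * (a14 f - 2 * a13 f * a22 f) ^ 2

end

end DSing

/-!
The numbers `d_μ` are the derivatives of order `μ - 1` at `0` of a function of one variable, the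
value of `f` along a *critical curve*: a smooth curve `γ`, parametrized by `y` and tangent to the
`y`-axis, on which all partial derivatives of `f` except `f_y` vanish (`IsCritCurve`).

*Existence of the curve and normal form.* Since the second differential is nondegenerate in `z`, the
equation `f_z = 0` defines the graph of a map `Z` of the `(x, y)`-plane
(`IsCorankTwo.exists_critical_graph`). On this graph the equation `f_x = 0` degenerates at the
origin; after the blow-up `x = y u` it becomes `u + … = 0` because of the normalization of the cubic
part, and has a solution `x = ξ(y)` (`IsCubicNormalized.exists_isCritCurve`). Put `φ = f ∘ γ`. By
Hadamard's lemma `f` on the graph is `φ(y) + (x - ξ(y))² B` with `B = y / 2 + …`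
(`IsCubicNormalized.exists_quadratic_factor`), and `f` differs from its restriction to the graph by
a nondegenerate quadratic form of new variables; this is the Morse lemma with parameters, proved by
means of square roots of operators (`exists_smooth_diagonalization`,
`IsCorankTwo.exists_splitting`).
If `φ - φ(0)` has at `0` a zero of order `m ≥ 3` with the leading coefficient `c`, then
`φ(y) - φ(0) + x² B = X² Y + c Yᵐ` in suitable coordinates (`exists_plane_normalForm`). Hence `f`
reduces to the normal form with `μ = m + 1` (`IsCubicNormalized.exists_isCritCurve_reducesTo`); the
coefficient can be multiplied by any positive number (`ReducesTo.of_mul_pos`), which turns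
`d_μ / (μ - 1)!` into `d_μ` or `±1`.

*Uniqueness of `μ`.* In the normal form the norm of the gradient is at least of the order
`‖k‖^(μ - 2)`, and this order is attained on the `y`-axis; both properties do not depend on the
coordinates (`ReducesTo.gradLower_and_gradUpper`). So `f` has at most one type, and if
`d_4 = … = d_μ = 0`, then the gradient on the critical curve is too small for the type `D_μ`
(`IsCritCurve.gradUpper`, `IsCritCurve.reducesTo_iff`).

*The form of `d_μ`.* By the chain rule the derivatives of the partial derivatives of `f` along `γ`
satisfy a recursion (`IsCritCurve.wordAlong_succ`) in which the derivatives of `γ` are found, one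
after another, from the equations `f_z = 0` by means of the inverse matrix of `f_{z²}` and from
`f_x = 0` by means of `f_{x²y} = 1`. The orders of the derivatives involved are counted along the
way (`isPolyFun_jet`, `isPolyFun_wordAlong_y`). For `μ ≤ 8` the formulas of Faà di Bruno, simplified
by the equations of the curve (`IsCritCurve.along_seven`), involve only the jets of `γ` of orders
`2` and `3`; expanded by multilinearity they give the table (`IsCritCurve.isTable`).

*The normalization of the cubic part.* A real binary cubic form has a real zero on the unit circle,
hence a linear factor. If the form is not a cube, it has a simple linear factor, and completing the
square in the other factor gives `x² y + const y³` (`exists_cubic_basis`).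
-/

namespace DSing

open Set Filter MeasureTheory

/-! ### Integrals with parameters, Hadamard's lemma, the inverse function theorem -/

section Smooth

variable {E G P W Y : Type} [NormedAddCommGroup E] [NormedSpace ℝ E] [NormedAddCommGroup G]
  [NormedSpace ℝ G] [NormedAddCommGroup P] [NormedSpace ℝ P] [NormedAddCommGroup W]
  [NormedSpace ℝ W] [NormedAddCommGroup Y] [NormedSpace ℝ Y]

theorem hasFDerivAt_integral_of_contDiff [FiniteDimensional ℝ E] {F : E × ℝ → G}
    (hF : ContDiff ℝ 1 F) (e : E) :
    HasFDerivAt (fun e => ∫ s in (0 : ℝ)..1, F (e, s))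
      (∫ s in (0 : ℝ)..1, (fderiv ℝ F (e, s)).comp (ContinuousLinearMap.inl ℝ E ℝ)) e := by
  have hc : Continuous fun q : E × ℝ =>
      (fderiv ℝ F q).comp (ContinuousLinearMap.inl ℝ E ℝ) := by
    have := hF.continuous_fderiv one_ne_zero
    fun_prop
  have : ProperSpace E := FiniteDimensional.proper ℝ E
  obtain ⟨C, hC⟩ := ((isCompact_closedBall e 1).prod (isCompact_Icc (a := (0 : ℝ)) (b := 1))
    ).exists_bound_of_continuousOn hc.continuousOn
  have hsec : ∀ x : E, Continuous fun s : ℝ => F (x, s) := fun x =>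
    hF.continuous.comp (by fun_prop)
  have hsec' : Continuous fun s : ℝ =>
      (fderiv ℝ F (e, s)).comp (ContinuousLinearMap.inl ℝ E ℝ) :=
    hc.comp (by fun_prop : Continuous fun s : ℝ => (e, s))
  refine intervalIntegral.hasFDerivAt_integral_of_dominated_of_fderiv_le
    (F' := fun x s => (fderiv ℝ F (x, s)).comp (ContinuousLinearMap.inl ℝ E ℝ))
    (bound := fun _ => C) (Metric.closedBall_mem_nhds e one_pos)
    (Eventually.of_forall fun x => (hsec x).aestronglyMeasurable)
    ((hsec e).intervalIntegrable _ _) hsec'.aestronglyMeasurable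
    (Eventually.of_forall fun s hs x hx => hC (x, s) ⟨hx, ?_⟩)
    (by simp) (Eventually.of_forall fun s _ x _ => ?_)
  · rw [uIoc_of_le zero_le_one] at hs
    exact ⟨hs.1.le, hs.2⟩
  · exact ((hF.differentiable one_ne_zero (x, s)).hasFDerivAt).comp x
      ((hasFDerivAt_id x).prodMk (hasFDerivAt_const s x) |>.congr_fderiv (by ext <;> simp))

theorem contDiff_integral_nat [FiniteDimensional ℝ E] (m : ℕ) :
    ∀ {G : Type} [NormedAddCommGroup G] [NormedSpace ℝ G] {F : E × ℝ → G},
      ContDiff ℝ ∞ F → ContDiff ℝ m (fun e => ∫ s in (0 : ℝ)..1, F (e, s)) := by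
  induction m with
  | zero =>
    intro G _ _ F hF
    have h1 : ContDiff ℝ 1 F := hF.of_le (by exact_mod_cast le_top)
    exact contDiff_zero.2 (continuous_iff_continuousAt.2 fun e =>
      (hasFDerivAt_integral_of_contDiff h1 e).continuousAt)
  | succ m ih =>
    intro G _ _ F hF
    have h1 : ContDiff ℝ 1 F := hF.of_le (by exact_mod_cast le_top)
    refine contDiff_succ_iff_hasFDerivAt.2 ⟨_, ?_, hasFDerivAt_integral_of_contDiff h1⟩
    exact ih (F := fun q => (fderiv ℝ F q).comp (ContinuousLinearMap.inl ℝ E ℝ))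
      ((hF.fderiv_right (by simp)).clm_comp contDiff_const)

/-- Integrals of smooth functions depend smoothly on parameters. -/
theorem contDiff_integral [FiniteDimensional ℝ E] {F : E × ℝ → G} (hF : ContDiff ℝ ∞ F) :
    ContDiff ℝ ∞ (fun e => ∫ s in (0 : ℝ)..1, F (e, s)) :=
  contDiff_infty.2 fun m => contDiff_integral_nat m hF

/-- Hadamard's lemma with parameters. -/
theorem exists_hadamard [FiniteDimensional ℝ P] [FiniteDimensional ℝ W] [CompleteSpace Y]
    {F : P × W → Y} (hF : ContDiff ℝ ∞ F) :
    ∃ A : P × W → W →L[ℝ] Y, ContDiff ℝ ∞ A ∧ (∀ p w, F (p, w) = F (p, 0) + A (p, w) w) ∧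
      ∀ p, A (p, 0) = (fderiv ℝ F (p, 0)).comp (ContinuousLinearMap.inr ℝ P W) := by
  let H : (P × W) × ℝ → W →L[ℝ] Y := fun q =>
    (fderiv ℝ F (q.1.1, q.2 • q.1.2)).comp (ContinuousLinearMap.inr ℝ P W)
  have hH : ContDiff ℝ ∞ H := by
    have h1 : ContDiff ℝ ∞ (fderiv ℝ F) := hF.fderiv_right (by simp)
    have h2 : ContDiff ℝ ∞ fun q : (P × W) × ℝ => fderiv ℝ F (q.1.1, q.2 • q.1.2) :=
      h1.comp (by fun_prop)
    exact h2.clm_comp contDiff_const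
  refine ⟨fun q => ∫ s in (0 : ℝ)..1, H (q, s), contDiff_integral hH, fun p w => ?_, fun p => ?_⟩
  · have hc : Continuous fun s : ℝ => H ((p, w), s) := hH.continuous.comp (by fun_prop)
    have hd : ∀ s : ℝ, HasDerivAt (fun s : ℝ => F (p, s • w)) (H ((p, w), s) w) s := by
      intro s
      have h1 : HasDerivAt (fun s : ℝ => (p, s • w)) ((0 : P), w) s := by
        simpa using (hasDerivAt_const s p).prodMk ((hasDerivAt_id s).smul_const w)
      have h2 := ((hF.differentiable (by simp)) (p, s • w)).hasFDerivAt
      simpa [H, Function.comp_def] using h2.comp_hasDerivAt s h1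
    have := intervalIntegral.integral_eq_sub_of_hasDerivAt (a := 0) (b := 1)
      (fun s _ => hd s) ((hc.clm_apply continuous_const).intervalIntegrable _ _)
    rw [ContinuousLinearMap.intervalIntegral_apply (hc.intervalIntegrable _ _), this]
    simp
  · simp [H]

/-- A germ at `a` of a function which is smooth near `a` has a globally smooth representative. -/
theorem exists_contDiff_eventuallyEq [FiniteDimensional ℝ E] {F : E → G} {a : E}
    (h : ∀ᶠ x in 𝓝 a, ContDiffAt ℝ ∞ F x) : ∃ F' : E → G, ContDiff ℝ ∞ F' ∧ F' =ᶠ[𝓝 a] F := by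
  obtain ⟨r, hr, hr'⟩ := Metric.eventually_nhds_iff_ball.1 h
  let b : ContDiffBump a := ⟨r / 4, r / 2, by positivity, by linarith⟩
  refine ⟨fun x => b x • F x, contDiff_iff_contDiffAt.2 fun x => ?_, ?_⟩
  · by_cases hx : x ∈ Metric.ball a r
    · exact b.contDiff.contDiffAt.smul (hr' x hx)
    · have hx' : x ∉ tsupport b := by
        rw [b.tsupport_eq]
        intro hx2
        apply hx
        rw [Metric.mem_closedBall] at hx2
        rw [Metric.mem_ball]
        change dist x a ≤ r / 2 at hx2
        linarith
      have : (fun x => b x • F x) =ᶠ[𝓝 x] fun _ => 0 := by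
        filter_upwards [(isClosed_tsupport b).isOpen_compl.mem_nhds hx'] with y hy
        rw [image_eq_zero_of_notMem_tsupport hy, zero_smul]
      exact contDiffAt_const.congr_of_eventuallyEq this
  · filter_upwards [b.eventuallyEq_one] with x hx
    simp [hx]

/-- The inverse function theorem, with a local inverse smooth on a neighbourhood. -/
theorem exists_smooth_localInverse [CompleteSpace E] {Φ : E → G} {a : E}
    (hΦ : ∀ᶠ x in 𝓝 a, ContDiffAt ℝ ∞ Φ x) (L : E ≃L[ℝ] G)
    (hL : HasFDerivAt Φ (L : E →L[ℝ] G) a) :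
    ∃ Ψ : G → E, (∀ᶠ y in 𝓝 (Φ a), ContDiffAt ℝ ∞ Ψ y) ∧ Ψ (Φ a) = a ∧
      (∀ᶠ y in 𝓝 (Φ a), Φ (Ψ y) = y) ∧ ∀ᶠ x in 𝓝 a, Ψ (Φ x) = x := by
  have h0 := hΦ.self_of_nhds
  let e := h0.toOpenPartialHomeomorph Φ hL (by simp)
  have hea : a ∈ e.source := h0.mem_toOpenPartialHomeomorph_source hL (by simp)
  have heb : Φ a ∈ e.target := h0.image_mem_toOpenPartialHomeomorph_target hL (by simp)
  have hinv : e.symm (Φ a) = a := e.left_inv hea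
  have hd : ∀ᶠ x in 𝓝 a, ContDiffAt ℝ ∞ Φ x ∧
      fderiv ℝ Φ x ∈ range ((↑) : (E ≃L[ℝ] G) → E →L[ℝ] G) := by
    refine hΦ.and ?_
    have hc : ContinuousAt (fderiv ℝ Φ) a :=
      (h0.fderiv_right (m := 0) (by simp)).continuousAt
    exact hc.eventually_mem (by rw [hL.fderiv]; exact L.nhds)
  have ht : Tendsto e.symm (𝓝 (Φ a)) (𝓝 a) := by
    have := e.continuousAt_symm heb
    rwa [ContinuousAt, hinv] at this
  refine ⟨e.symm, ?_, hinv, ?_, ?_⟩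
  · filter_upwards [ht.eventually hd, e.open_target.mem_nhds heb] with y hy hy2
    obtain ⟨L', hL'⟩ := hy.2
    refine e.contDiffAt_symm (f₀' := L') hy2 ?_ hy.1
    have := (hy.1.differentiableAt (by simp)).hasFDerivAt
    rwa [← hL'] at this
  · filter_upwards [e.open_target.mem_nhds heb] with y hy using e.right_inv hy
  · filter_upwards [e.open_source.mem_nhds hea] with x hx using e.left_inv hx

/-- The implicit function theorem, with a globally smooth representative of the solution. -/
theorem exists_smooth_implicit [FiniteDimensional ℝ P] [FiniteDimensional ℝ W]
    {F : P × W → Y} (hF : ContDiff ℝ ∞ F) {p : P} {w : W} (h0 : F (p, w) = 0) (L : W ≃L[ℝ] Y)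
    (hL : (fderiv ℝ F (p, w)).comp (ContinuousLinearMap.inr ℝ P W) = L) :
    ∃ h : P → W, ContDiff ℝ ∞ h ∧ h p = w ∧ ∀ᶠ q in 𝓝 p, F (q, h q) = 0 := by
  have : CompleteSpace P := FiniteDimensional.complete ℝ P
  have : CompleteSpace W := FiniteDimensional.complete ℝ W
  let A := (fderiv ℝ F (p, w)).comp (ContinuousLinearMap.inl ℝ P W)
  have hsplit : ∀ u v, fderiv ℝ F (p, w) (u, v) = A u + L v := by
    intro u v
    have : ((u, v) : P × W) = (u, 0) + (0, v) := by simp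
    have h2 : (L : W →L[ℝ] Y) v = fderiv ℝ F (p, w) (0, v) := by rw [← hL]; simp
    rw [this, map_add, ← h2]
    simp [A]
  let M : (P × W) ≃L[ℝ] (P × Y) := ContinuousLinearEquiv.equivOfInverse
    ((ContinuousLinearMap.fst ℝ P W).prod (fderiv ℝ F (p, w)))
    ((ContinuousLinearMap.fst ℝ P Y).prod ((L.symm : Y →L[ℝ] W).comp
      (ContinuousLinearMap.snd ℝ P Y - A.comp (ContinuousLinearMap.fst ℝ P Y))))
    (by rintro ⟨u, v⟩; simp [hsplit]) (by rintro ⟨u, v⟩; simp [hsplit])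
  have hΦ : ContDiff ℝ ∞ fun q : P × W => (q.1, F q) := contDiff_fst.prodMk hF
  have hM : HasFDerivAt (fun q : P × W => (q.1, F q)) (M : P × W →L[ℝ] P × Y) (p, w) :=
    hasFDerivAt_fst.prodMk (hF.differentiable (by simp) (p, w)).hasFDerivAt
  obtain ⟨Ψ, hΨ, hΨ0, hΨ1, -⟩ := exists_smooth_localInverse
    (Eventually.of_forall fun q => hΦ.contDiffAt) M hM
  simp only [h0] at hΨ hΨ0 hΨ1
  have hincl : ContDiff ℝ ∞ fun q : P => (q, (0 : Y)) := by fun_prop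
  have ht : Tendsto (fun q : P => (q, (0 : Y))) (𝓝 p) (𝓝 (p, 0)) :=
    hincl.continuous.continuousAt
  obtain ⟨h, hh, hh'⟩ := exists_contDiff_eventuallyEq (F := fun q : P => (Ψ (q, 0)).2) (a := p) (by
    filter_upwards [ht.eventually hΨ] with q hq
    exact contDiff_snd.contDiffAt.comp q (hq.comp q hincl.contDiffAt))
  refine ⟨h, hh, by simpa [hΨ0] using hh'.self_of_nhds, ?_⟩
  filter_upwards [hh', ht.eventually hΨ1] with q hq hq1
  have h1 : (Ψ (q, 0)).1 = q := congrArg Prod.fst hq1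
  have h2 : F (Ψ (q, 0)) = 0 := congrArg Prod.snd hq1
  rwa [hq, show (q, (Ψ (q, 0)).2) = Ψ (q, 0) from Prod.ext h1.symm rfl]

end Smooth

/-! ### Iterated directional derivatives -/

section Words

variable {V V' : Type} [NormedAddCommGroup V] [NormedSpace ℝ V] [NormedAddCommGroup V']
  [NormedSpace ℝ V']

/-- The iterated directional derivative of `f` along the vectors of a list, as a function of the
point; the head of the list is the last direction of differentiation. -/
noncomputable def dirD (f : V → ℝ) : List V → V → ℝ
  | [] => f
  | v :: l => fun k => fderiv ℝ (dirD f l) k v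

theorem contDiff_dirD {f : V → ℝ} (hf : ContDiff ℝ ∞ f) (l : List V) :
    ContDiff ℝ ∞ (dirD f l) := by
  induction l with
  | nil => exact hf
  | cons v l ih => exact (ih.fderiv_right (by simp)).clm_apply contDiff_const

theorem differentiable_dirD {f : V → ℝ} (hf : ContDiff ℝ ∞ f) (l : List V) :
    Differentiable ℝ (dirD f l) :=
  (contDiff_dirD hf l).differentiable (by simp)

theorem dirD_swap {f : V → ℝ} (hf : ContDiff ℝ ∞ f) (u v : V) (l : List V) :
    dirD f (u :: v :: l) = dirD f (v :: u :: l) := by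
  funext k
  have h1 : ContDiff ℝ ∞ (fderiv ℝ (dirD f l)) := (contDiff_dirD hf l).fderiv_right (by simp)
  have h2 : ∀ w : V, fderiv ℝ (fun k => fderiv ℝ (dirD f l) k w) k =
      (fderiv ℝ (fderiv ℝ (dirD f l)) k).flip w := by
    intro w
    have := (h1.differentiable (by simp) k).hasFDerivAt.clm_apply (hasFDerivAt_const w k)
    rw [this.fderiv]
    ext; simp
  have hs : IsSymmSndFDerivAt ℝ (dirD f l) k :=
    (contDiff_dirD hf l).contDiffAt.isSymmSndFDerivAt
      (by simpa using WithTop.coe_le_coe.2 (le_top (a := (2 : ℕ∞))))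
  change fderiv ℝ (fun k => fderiv ℝ (dirD f l) k v) k u =
    fderiv ℝ (fun k => fderiv ℝ (dirD f l) k u) k v
  rw [h2, h2]
  exact hs.eq u v

theorem dirD_perm {f : V → ℝ} (hf : ContDiff ℝ ∞ f) {l m : List V} (h : l.Perm m) :
    dirD f l = dirD f m := by
  induction h with
  | nil => rfl
  | cons v _ ih => simp only [dirD, ih]
  | swap u v l => exact dirD_swap hf _ _ _
  | trans _ _ h1 h2 => exact h1.trans h2

theorem dirD_comp_clm {f : V' → ℝ} (hf : ContDiff ℝ ∞ f) (A : V →L[ℝ] V') (l : List V) (k : V) :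
    dirD (f ∘ A) l k = dirD f (l.map A) (A k) := by
  induction l generalizing k with
  | nil => rfl
  | cons v l ih =>
    have : dirD (f ∘ A) l = dirD f (l.map A) ∘ A := funext ih
    simp only [dirD, List.map_cons, this]
    rw [fderiv_comp k (differentiable_dirD hf _ _) A.differentiableAt]
    simp

/-- The iterated directional derivative along the vectors of a multiset. For smooth functions the
order of the directions is irrelevant. -/
noncomputable def symD (f : V → ℝ) (s : Multiset V) : V → ℝ := dirD f s.toList

theorem symD_coe {f : V → ℝ} (hf : ContDiff ℝ ∞ f) (l : List V) :
    symD f (l : Multiset V) = dirD f l :=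
  dirD_perm hf (Multiset.coe_eq_coe.1 (Multiset.coe_toList _))

theorem symD_zero (f : V → ℝ) : symD f 0 = f := by simp [symD, dirD]

theorem symD_cons {f : V → ℝ} (hf : ContDiff ℝ ∞ f) (v : V) (s : Multiset V) (k : V) :
    symD f (v ::ₘ s) k = fderiv ℝ (symD f s) k v := by
  induction s using Quotient.inductionOn with
  | h l =>
    simp only [Multiset.quot_mk_to_coe, Multiset.cons_coe, symD_coe hf]
    rfl

theorem contDiff_symD {f : V → ℝ} (hf : ContDiff ℝ ∞ f) (s : Multiset V) :
    ContDiff ℝ ∞ (symD f s) := contDiff_dirD hf _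

theorem symD_cons_add {f : V → ℝ} (hf : ContDiff ℝ ∞ f) (u v : V) (s : Multiset V) (k : V) :
    symD f ((u + v) ::ₘ s) k = symD f (u ::ₘ s) k + symD f (v ::ₘ s) k := by
  simp only [symD_cons hf, map_add]

theorem symD_cons_smul {f : V → ℝ} (hf : ContDiff ℝ ∞ f) (a : ℝ) (v : V) (s : Multiset V)
    (k : V) : symD f ((a • v) ::ₘ s) k = a * symD f (v ::ₘ s) k := by
  simp only [symD_cons hf, map_smul, smul_eq_mul]

theorem symD_cons_sum {f : V → ℝ} (hf : ContDiff ℝ ∞ f) {ι : Type} (t : Finset ι) (a : ι → V)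
    (s : Multiset V) (k : V) :
    symD f ((∑ i ∈ t, a i) ::ₘ s) k = ∑ i ∈ t, symD f (a i ::ₘ s) k := by
  simp only [symD_cons hf, map_sum]

end Words

section Partial

variable {m : ℕ}

theorem partialDeriv_eq_dirD (f : (Fin m → ℝ) → ℝ) (l : List (Fin m)) :
    partialDeriv f l = dirD f (l.map fun i => Pi.single i 1) := by
  induction l with
  | nil => rfl
  | cons i l ih => simp only [partialDeriv, List.map_cons, dirD, ih]

theorem contDiff_partialDeriv {f : (Fin m → ℝ) → ℝ} (hf : ContDiff ℝ ∞ f) (l : List (Fin m)) :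
    ContDiff ℝ ∞ (partialDeriv f l) := by
  rw [partialDeriv_eq_dirD]; exact contDiff_dirD hf _

theorem D_eq_symD {f : (Fin m → ℝ) → ℝ} (hf : ContDiff ℝ ∞ f) (l : List (Fin m)) :
    D f l = symD f (l.map fun i => (Pi.single i 1 : Fin m → ℝ) : List _) 0 := by
  rw [symD_coe hf, D, partialDeriv_eq_dirD]

theorem D_perm {f : (Fin m → ℝ) → ℝ} (hf : ContDiff ℝ ∞ f) {l l' : List (Fin m)}
    (h : l.Perm l') : D f l = D f l' := by
  rw [D, D, partialDeriv_eq_dirD, partialDeriv_eq_dirD, dirD_perm hf (h.map _)]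

theorem fderiv_eq_sum_single {F : (Fin m → ℝ) → ℝ} (k v : Fin m → ℝ) :
    fderiv ℝ F k v = ∑ i, fderiv ℝ F k (Pi.single i 1) * v i := by
  conv_lhs => rw [pi_eq_sum_univ' v, map_sum]
  refine Finset.sum_congr rfl fun i _ => ?_
  rw [map_smul, smul_eq_mul, mul_comm]

/-- The derivatives of a function along a curve: Leibniz' rule applied to the chain rule. -/
theorem iteratedDeriv_succ_comp_curve {F : (Fin m → ℝ) → ℝ} (hF : ContDiff ℝ ∞ F)
    {γ : ℝ → Fin m → ℝ} (hγ : ContDiff ℝ ∞ γ) (k : ℕ) (t : ℝ) :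
    iteratedDeriv (k + 1) (fun t => F (γ t)) t =
      ∑ i, ∑ j ∈ Finset.range (k + 1), (k.choose j : ℝ) *
        iteratedDeriv (k - j) (fun t => partialDeriv F [i] (γ t)) t *
          iteratedDeriv (j + 1) (fun t => γ t i) t := by
  have hi : ∀ i, ContDiff ℝ ∞ fun t => γ t i := fun i => contDiff_pi.1 hγ i
  have hd : deriv (fun t => F (γ t)) =
      fun t => ∑ i, deriv (fun t => γ t i) t * partialDeriv F [i] (γ t) := by
    funext t
    have h1 : HasDerivAt γ (fun i => deriv (fun t => γ t i) t) t :=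
      hasDerivAt_pi.2 fun i => ((hi i).differentiable (by simp) t).hasDerivAt
    have h2 := ((hF.differentiable (by simp)) (γ t)).hasFDerivAt.comp_hasDerivAt t h1
    rw [show (fun t => F (γ t)) = F ∘ γ from rfl, h2.deriv, fderiv_eq_sum_single]
    simp [partialDeriv, mul_comm]
  have hp : ∀ i, ContDiff ℝ ∞ fun t => partialDeriv F [i] (γ t) := fun i =>
    (contDiff_partialDeriv hF _).comp hγ
  have hdi : ∀ i, ContDiff ℝ ∞ (deriv fun t => γ t i) := fun i =>
    (contDiff_infty_iff_deriv.1 (hi i)).2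
  rw [iteratedDeriv_succ', hd, iteratedDeriv_fun_sum fun i _ =>
    (contDiff_infty.1 ((hdi i).mul (hp i)) _).contDiffAt]
  refine Finset.sum_congr rfl fun i _ => ?_
  rw [iteratedDeriv_fun_mul (contDiff_infty.1 (hdi i) _).contDiffAt
    (contDiff_infty.1 (hp i) _).contDiffAt]
  refine Finset.sum_congr rfl fun j _ => ?_
  rw [iteratedDeriv_succ' (f := fun t => γ t i)]
  ring

/-- The vector of the `j`-th derivatives at `0` of the components of a curve. -/
noncomputable def jet (γ : ℝ → Fin m → ℝ) (j : ℕ) : Fin m → ℝ :=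
  fun i => iteratedDeriv j (fun t => γ t i) 0

theorem iteratedDeriv_succ_symD_curve {f : (Fin m → ℝ) → ℝ} (hf : ContDiff ℝ ∞ f)
    {γ : ℝ → Fin m → ℝ} (hγ : ContDiff ℝ ∞ γ) (s : Multiset (Fin m → ℝ)) (k : ℕ) :
    iteratedDeriv (k + 1) (fun t => symD f s (γ t)) 0 =
      ∑ j ∈ Finset.range (k + 1), (k.choose j : ℝ) *
        iteratedDeriv (k - j) (fun t => symD f (jet γ (j + 1) ::ₘ s) (γ t)) 0 := by
  rw [iteratedDeriv_succ_comp_curve (contDiff_symD hf s) hγ, Finset.sum_comm]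
  refine Finset.sum_congr rfl fun j _ => ?_
  have h : (fun t => symD f (jet γ (j + 1) ::ₘ s) (γ t)) =
      fun t => ∑ i, jet γ (j + 1) i * partialDeriv (symD f s) [i] (γ t) := by
    funext t
    rw [symD_cons hf, fderiv_eq_sum_single]
    simp [partialDeriv, mul_comm]
  have hp : ∀ i, ContDiff ℝ ∞ fun t => partialDeriv (symD f s) [i] (γ t) := fun i =>
    (contDiff_partialDeriv (contDiff_symD hf s) _).comp hγ
  rw [h, iteratedDeriv_fun_sum fun i _ =>
    (contDiff_infty.1 (contDiff_const.mul (hp i)) _).contDiffAt, Finset.mul_sum]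
  refine Finset.sum_congr rfl fun i _ => ?_
  rw [iteratedDeriv_const_mul_field]
  simp only [jet]
  ring

end Partial

/-! ### The coordinates and the second differential -/

variable {n : ℕ}

/-- The coordinate vector of the `i`-th variable. -/
noncomputable abbrev ev {m : ℕ} (i : Fin m) : Fin m → ℝ := Pi.single i 1

/-- The inclusion of the space of the variables `z` as the coordinate subspace `x = y = 0`. -/
noncomputable def incl (u : Fin n → ℝ) : Fin (n + 2) → ℝ := ∑ j, u j • ev (zi j)

theorem eq_zero_or_one_or_zi (i : Fin (n + 2)) : i = 0 ∨ i = 1 ∨ ∃ j, i = zi j := by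
  induction i using Fin.cases with
  | zero => exact Or.inl rfl
  | succ i =>
    induction i using Fin.cases with
    | zero => exact Or.inr (Or.inl rfl)
    | succ j => exact Or.inr (Or.inr ⟨j, rfl⟩)

theorem zi_ne_zero (j : Fin n) : zi j ≠ 0 := Fin.succ_ne_zero _

theorem zi_ne_one (j : Fin n) : zi j ≠ 1 := fun h => Fin.succ_ne_zero j (Fin.succ_injective _ h)

theorem zi_inj {i j : Fin n} : zi i = zi j ↔ i = j := by simp [zi]

theorem sum_univ_split {M : Type} [AddCommMonoid M] (a : Fin (n + 2) → M) :
    ∑ i, a i = a 0 + (a 1 + ∑ j, a (zi j)) := by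
  rw [Fin.sum_univ_succ, Fin.sum_univ_succ]; rfl

theorem incl_zi (u : Fin n → ℝ) (j : Fin n) : incl u (zi j) = u j := by
  simp [incl, Finset.sum_apply, Pi.single_apply, zi_inj]

theorem incl_zero (u : Fin n → ℝ) : incl u 0 = 0 := by
  simp [incl, Finset.sum_apply, (zi_ne_zero _).symm]

theorem incl_one (u : Fin n → ℝ) : incl u 1 = 0 := by
  simp [incl, Finset.sum_apply, (zi_ne_one _).symm]

theorem incl_add (u v : Fin n → ℝ) : incl (u + v) = incl u + incl v := by
  simp [incl, add_smul, Finset.sum_add_distrib]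

theorem incl_smul (a : ℝ) (u : Fin n → ℝ) : incl (a • u) = a • incl u := by
  simp [incl, mul_smul, Finset.smul_sum]

theorem eq_split (v : Fin (n + 2) → ℝ) :
    v = v 0 • ev 0 + (v 1 • ev 1 + incl fun j => v (zi j)) := by
  conv_lhs => rw [pi_eq_sum_univ' v, sum_univ_split]
  rfl

section Corank

variable {f : (Fin (n + 2) → ℝ) → ℝ}

theorem fderiv_fderiv_apply (hf : ContDiff ℝ ∞ f) (k u v : Fin (n + 2) → ℝ) :
    fderiv ℝ (fderiv ℝ f) k u v = symD f {u, v} k := by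
  have h1 : ContDiff ℝ ∞ (fderiv ℝ f) := hf.fderiv_right (by simp)
  have h := (h1.differentiable (by simp) k).hasFDerivAt.clm_apply (hasFDerivAt_const v k)
  have h2 : symD f {v} = fun k => fderiv ℝ f k v := by
    funext k
    rw [← Multiset.cons_zero v, symD_cons hf, symD_zero]
  rw [Multiset.insert_eq_cons, symD_cons hf, h2, h.fderiv]
  simp

theorem IsCorankTwo.symD_single (hf : IsCorankTwo f) (v : Fin (n + 2) → ℝ) :
    symD f {v} 0 = 0 := by
  rw [← Multiset.cons_zero v, symD_cons hf.smooth, symD_zero, hf.critical]; rfl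

theorem IsCorankTwo.symD_zero_left (hf : IsCorankTwo f) (v : Fin (n + 2) → ℝ) :
    symD f {ev 0, v} 0 = 0 := by
  rw [← fderiv_fderiv_apply hf.smooth, (hf.kernel _).2 fun j => by simp [zi_ne_zero]]
  rfl

theorem IsCorankTwo.symD_one_left (hf : IsCorankTwo f) (v : Fin (n + 2) → ℝ) :
    symD f {ev 1, v} 0 = 0 := by
  rw [← fderiv_fderiv_apply hf.smooth, (hf.kernel _).2 fun j => by simp [zi_ne_one]]
  rfl

theorem symD_pair_incl (hf : ContDiff ℝ ∞ f) (u v : Fin n → ℝ) (k : Fin (n + 2) → ℝ)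
    (s : Multiset (Fin (n + 2) → ℝ)) :
    symD f (incl u ::ₘ incl v ::ₘ s) k =
      ∑ i, ∑ j, u i * v j * symD f (ev (zi i) ::ₘ ev (zi j) ::ₘ s) k := by
  rw [incl, symD_cons_sum hf]
  refine Finset.sum_congr rfl fun i _ => ?_
  rw [symD_cons_smul hf, Multiset.cons_swap, incl, symD_cons_sum hf, Finset.mul_sum]
  refine Finset.sum_congr rfl fun j _ => ?_
  rw [symD_cons_smul hf, Multiset.cons_swap]
  ring

theorem coe_append_eq (l m : List (Fin (n + 2))) :
    (((l ++ m).map ev : List (Fin (n + 2) → ℝ)) : Multiset (Fin (n + 2) → ℝ)) =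
      ((m.map ev : List (Fin (n + 2) → ℝ)) : Multiset (Fin (n + 2) → ℝ)) +
        ((l.map ev : List (Fin (n + 2) → ℝ)) : Multiset (Fin (n + 2) → ℝ)) := by
  rw [List.map_append, ← Multiset.coe_add]
  exact add_comm _ _

/-- The scalar product with the vector `f_{l z}` as a directional derivative. -/
theorem vec_dotProduct (hf : ContDiff ℝ ∞ f) (l : List (Fin (n + 2))) (u : Fin n → ℝ) :
    vec f l ⬝ᵥ u = symD f (incl u ::ₘ ((l.map ev : List _) : Multiset _)) 0 := by
  rw [incl, symD_cons_sum hf, dotProduct]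
  refine Finset.sum_congr rfl fun i _ => ?_
  rw [symD_cons_smul hf, vec, D_eq_symD hf, coe_append_eq]
  simp only [List.map_cons, List.map_nil, Multiset.coe_singleton, Multiset.singleton_add]
  ring

theorem bil_eq (hf : ContDiff ℝ ∞ f) (l : List (Fin (n + 2))) (u v : Fin n → ℝ) :
    bil f l u v = symD f (incl u ::ₘ incl v ::ₘ ((l.map ev : List _) : Multiset _)) 0 := by
  rw [symD_pair_incl hf, bil, dotProduct]
  refine Finset.sum_congr rfl fun i _ => ?_
  rw [Matrix.mulVec, dotProduct, Finset.mul_sum]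
  refine Finset.sum_congr rfl fun j _ => ?_
  rw [mat, Matrix.of_apply, D_eq_symD hf, coe_append_eq]
  simp only [List.map_cons, List.map_nil, ← Multiset.cons_coe, Multiset.coe_nil,
    Multiset.cons_add, zero_add]
  ring

theorem cub_eq (hf : ContDiff ℝ ∞ f) (l : List (Fin (n + 2))) (u v w : Fin n → ℝ) :
    cub f l u v w =
      symD f (incl u ::ₘ incl v ::ₘ incl w ::ₘ ((l.map ev : List _) : Multiset _)) 0 := by
  rw [symD_pair_incl hf, cub]
  refine Finset.sum_congr rfl fun i _ => Finset.sum_congr rfl fun j _ => ?_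
  rw [Multiset.cons_swap, Multiset.cons_swap _ (incl w), Multiset.cons_swap, incl,
    symD_cons_sum hf, Finset.mul_sum]
  refine Finset.sum_congr rfl fun k _ => ?_
  rw [symD_cons_smul hf, D_eq_symD hf, coe_append_eq]
  simp only [List.map_cons, List.map_nil, ← Multiset.cons_coe, Multiset.coe_nil,
    Multiset.cons_add, zero_add]
  rw [Multiset.cons_swap (ev (zi i)), Multiset.cons_swap (ev (zi i)),
    Multiset.cons_swap (ev (zi j)) (ev (zi k))]
  ring

theorem D_eq {m : ℕ} {f : (Fin m → ℝ) → ℝ} (hf : ContDiff ℝ ∞ f) (l : List (Fin m)) :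
    D f l = symD f ((l.map ev : List _) : Multiset _) 0 := D_eq_symD hf l

theorem hessZ_eq_mat (f : (Fin (n + 2) → ℝ) → ℝ) : hessZ f = mat f [] := rfl

theorem hess_dotProduct (hf : ContDiff ℝ ∞ f) (u v : Fin n → ℝ) :
    u ⬝ᵥ (hessZ f).mulVec v = symD f {incl u, incl v} 0 := by
  have := bil_eq hf [] u v
  simpa [bil, hessZ_eq_mat] using this

theorem IsCorankTwo.hessZ_symm (hf : IsCorankTwo f) : (hessZ f).transpose = hessZ f := by
  ext i j
  simp only [hessZ, Matrix.transpose_apply, Matrix.of_apply]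
  exact D_perm hf.smooth (List.Perm.swap _ _ _)

/-- The second differential is nondegenerate on the space of the variables `z`. -/
theorem IsCorankTwo.eq_zero_of_hess (hf : IsCorankTwo f) {u : Fin n → ℝ}
    (h : ∀ v, symD f {incl u, incl v} 0 = 0) : u = 0 := by
  have h0 : fderiv ℝ (fderiv ℝ f) 0 (incl u) = 0 := by
    ext1 v
    rw [fderiv_fderiv_apply hf.smooth, Multiset.pair_comm, eq_split v, Multiset.insert_eq_cons,
      symD_cons_add hf.smooth, symD_cons_add hf.smooth, symD_cons_smul hf.smooth,
      symD_cons_smul hf.smooth, ← Multiset.insert_eq_cons, ← Multiset.insert_eq_cons,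
      ← Multiset.insert_eq_cons, hf.symD_zero_left, hf.symD_one_left, Multiset.pair_comm, h]
    simp
  funext j
  rw [← incl_zi u j, (hf.kernel _).1 h0 j]
  rfl

theorem IsCorankTwo.isUnit_det (hf : IsCorankTwo f) : IsUnit (hessZ f).det := by
  rw [isUnit_iff_ne_zero]
  intro h
  obtain ⟨v, hv, hv'⟩ := Matrix.exists_mulVec_eq_zero_iff.2 h
  refine hv (hf.eq_zero_of_hess fun w => ?_)
  rw [Multiset.pair_comm, ← hess_dotProduct hf.smooth, hv', dotProduct_zero]

/-- The vector `f_{z²}⁻¹ c` represents the linear form `c` with respect to the second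
differential. -/
theorem IsCorankTwo.symD_inv (hf : IsCorankTwo f) (c u : Fin n → ℝ) :
    symD f {incl ((hessZ f)⁻¹.mulVec c), incl u} 0 = c ⬝ᵥ u := by
  rw [Multiset.pair_comm, ← hess_dotProduct hf.smooth, Matrix.mulVec_mulVec,
    Matrix.mul_nonsing_inv _ hf.isUnit_det, Matrix.one_mulVec, dotProduct_comm]

theorem IsCorankTwo.symD_gvec (hf : IsCorankTwo f) (l : List (Fin (n + 2))) (u : Fin n → ℝ) :
    symD f {incl (gvec f l), incl u} 0 =
      symD f (incl u ::ₘ ((l.map ev : List _) : Multiset _)) 0 := by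
  rw [gvec, hf.symD_inv, vec_dotProduct hf.smooth]

theorem IsCorankTwo.symD_gMg (hf : IsCorankTwo f) (u : Fin n → ℝ) :
    symD f {incl (gMg f), incl u} 0 = symD f {ev 1, incl (gvec f [1, 1]), incl u} 0 := by
  have h := bil_eq hf.smooth [1] u (gvec f [1, 1])
  rw [gMg, hf.symD_inv, dotProduct_comm]
  rw [bil] at h
  rw [h]
  congr 1
  simp only [List.map_cons, List.map_nil, Multiset.coe_singleton, Multiset.insert_eq_cons]
  rw [Multiset.cons_swap, ← Multiset.cons_zero (ev 1), Multiset.cons_swap (incl u),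
    Multiset.cons_swap _ (ev 1)]
  rfl

end Corank

/-! ### Derivatives along curves and critical curves -/

variable {n : ℕ}

section Bell

variable {m : ℕ} {f : (Fin m → ℝ) → ℝ} {γ : ℝ → Fin m → ℝ}

/-- The `k`-th derivative at `0` of `symD f s` along the curve `γ`. -/
noncomputable def along (f : (Fin m → ℝ) → ℝ) (γ : ℝ → Fin m → ℝ) (k : ℕ)
    (s : Multiset (Fin m → ℝ)) : ℝ :=
  iteratedDeriv k (fun t => symD f s (γ t)) 0

theorem along_zero (h0 : γ 0 = 0) (s : Multiset (Fin m → ℝ)) :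
    along f γ 0 s = symD f s 0 := by simp [along, h0]

theorem along_succ (hf : ContDiff ℝ ∞ f) (hγ : ContDiff ℝ ∞ γ) (k : ℕ)
    (s : Multiset (Fin m → ℝ)) :
    along f γ (k + 1) s = ∑ j ∈ Finset.range (k + 1), (k.choose j : ℝ) *
      along f γ (k - j) (jet γ (j + 1) ::ₘ s) :=
  iteratedDeriv_succ_symD_curve hf hγ s k

variable (hf : ContDiff ℝ ∞ f) (hγ : ContDiff ℝ ∞ γ) (h0 : γ 0 = 0) (s : Multiset (Fin m → ℝ))
include hf hγ h0

theorem along_one : along f γ 1 s = symD f (jet γ 1 ::ₘ s) 0 := by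
  rw [along_succ hf hγ]; simp [along_zero h0]

theorem along_two : along f γ 2 s =
    symD f (jet γ 1 ::ₘ jet γ 1 ::ₘ s) 0 + symD f (jet γ 2 ::ₘ s) 0 := by
  rw [along_succ hf hγ]
  simp [Finset.sum_range_succ, along_zero h0, along_one hf hγ h0]

/-- The formulas of Faà di Bruno: the coefficient of a term counts the partitions of a set into
blocks of the given sizes. -/
theorem along_three : along f γ 3 s =
    symD f (jet γ 1 ::ₘ jet γ 1 ::ₘ jet γ 1 ::ₘ s) 0
    + 3 * symD f (jet γ 1 ::ₘ jet γ 2 ::ₘ s) 0 + symD f (jet γ 3 ::ₘ s) 0 := by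
  rw [along_succ hf hγ]
  simp only [Finset.sum_range_succ, Finset.range_zero, Finset.sum_empty, Nat.reduceSub,
    along_zero h0, along_one hf hγ h0, along_two hf hγ h0]
  simp [Nat.choose]
  rw [Multiset.cons_swap (jet γ 2)]
  ring

theorem along_four : along f γ 4 s =
    symD f (jet γ 1 ::ₘ jet γ 1 ::ₘ jet γ 1 ::ₘ jet γ 1 ::ₘ s) 0
    + 6 * symD f (jet γ 1 ::ₘ jet γ 1 ::ₘ jet γ 2 ::ₘ s) 0
    + 3 * symD f (jet γ 2 ::ₘ jet γ 2 ::ₘ s) 0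
    + 4 * symD f (jet γ 1 ::ₘ jet γ 3 ::ₘ s) 0 + symD f (jet γ 4 ::ₘ s) 0 := by
  rw [along_succ hf hγ]
  simp only [Finset.sum_range_succ, Finset.range_zero, Finset.sum_empty, Nat.reduceSub,
    along_zero h0, along_one hf hγ h0, along_two hf hγ h0, along_three hf hγ h0]
  simp [Nat.choose]
  generalize jet γ 1 = a
  generalize jet γ 2 = b
  generalize jet γ 3 = c
  simp only [Multiset.cons_swap]
  ring

theorem along_five : along f γ 5 s =
    symD f (jet γ 1 ::ₘ jet γ 1 ::ₘ jet γ 1 ::ₘ jet γ 1 ::ₘ jet γ 1 ::ₘ s) 0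
    + 10 * symD f (jet γ 2 ::ₘ jet γ 1 ::ₘ jet γ 1 ::ₘ jet γ 1 ::ₘ s) 0
    + 15 * symD f (jet γ 2 ::ₘ jet γ 2 ::ₘ jet γ 1 ::ₘ s) 0
    + 10 * symD f (jet γ 1 ::ₘ jet γ 1 ::ₘ jet γ 3 ::ₘ s) 0
    + 10 * symD f (jet γ 2 ::ₘ jet γ 3 ::ₘ s) 0
    + 5 * symD f (jet γ 1 ::ₘ jet γ 4 ::ₘ s) 0 + symD f (jet γ 5 ::ₘ s) 0 := by
  rw [along_succ hf hγ]
  simp only [Finset.sum_range_succ, Finset.range_zero, Finset.sum_empty, Nat.reduceSub,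
    along_zero h0, along_one hf hγ h0, along_two hf hγ h0, along_three hf hγ h0,
    along_four hf hγ h0]
  simp [Nat.choose]
  generalize jet γ 1 = a
  generalize jet γ 2 = b
  generalize jet γ 3 = c
  generalize jet γ 4 = d
  simp only [Multiset.cons_swap]
  ring

theorem along_six : along f γ 6 s =
    symD f (jet γ 1 ::ₘ jet γ 1 ::ₘ jet γ 1 ::ₘ jet γ 1 ::ₘ jet γ 1 ::ₘ jet γ 1 ::ₘ s) 0
    + 15 * symD f (jet γ 2 ::ₘ jet γ 1 ::ₘ jet γ 1 ::ₘ jet γ 1 ::ₘ jet γ 1 ::ₘ s) 0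
    + 45 * symD f (jet γ 2 ::ₘ jet γ 2 ::ₘ jet γ 1 ::ₘ jet γ 1 ::ₘ s) 0
    + 15 * symD f (jet γ 2 ::ₘ jet γ 2 ::ₘ jet γ 2 ::ₘ s) 0
    + 20 * symD f (jet γ 1 ::ₘ jet γ 1 ::ₘ jet γ 1 ::ₘ jet γ 3 ::ₘ s) 0
    + 60 * symD f (jet γ 1 ::ₘ jet γ 2 ::ₘ jet γ 3 ::ₘ s) 0
    + 10 * symD f (jet γ 3 ::ₘ jet γ 3 ::ₘ s) 0
    + 15 * symD f (jet γ 1 ::ₘ jet γ 1 ::ₘ jet γ 4 ::ₘ s) 0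
    + 15 * symD f (jet γ 2 ::ₘ jet γ 4 ::ₘ s) 0
    + 6 * symD f (jet γ 1 ::ₘ jet γ 5 ::ₘ s) 0 + symD f (jet γ 6 ::ₘ s) 0 := by
  rw [along_succ hf hγ]
  simp only [Finset.sum_range_succ, Finset.range_zero, Finset.sum_empty, Nat.reduceSub,
    along_zero h0, along_one hf hγ h0, along_two hf hγ h0, along_three hf hγ h0,
    along_four hf hγ h0, along_five hf hγ h0]
  simp [Nat.choose]
  generalize jet γ 1 = a
  generalize jet γ 2 = b
  generalize jet γ 3 = c
  generalize jet γ 4 = d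
  generalize jet γ 5 = e
  simp only [Multiset.cons_swap]
  ring

theorem along_seven : along f γ 7 s =
    symD f (jet γ 1 ::ₘ jet γ 1 ::ₘ jet γ 1 ::ₘ jet γ 1 ::ₘ jet γ 1 ::ₘ jet γ 1 ::ₘ jet γ 1 ::ₘ s) 0
    + 21 * symD f (jet γ 2 ::ₘ jet γ 1 ::ₘ jet γ 1 ::ₘ jet γ 1 ::ₘ jet γ 1 ::ₘ jet γ 1 ::ₘ s) 0
    + 105 * symD f (jet γ 2 ::ₘ jet γ 2 ::ₘ jet γ 1 ::ₘ jet γ 1 ::ₘ jet γ 1 ::ₘ s) 0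
    + 105 * symD f (jet γ 2 ::ₘ jet γ 2 ::ₘ jet γ 2 ::ₘ jet γ 1 ::ₘ s) 0
    + 35 * symD f (jet γ 3 ::ₘ jet γ 1 ::ₘ jet γ 1 ::ₘ jet γ 1 ::ₘ jet γ 1 ::ₘ s) 0
    + 210 * symD f (jet γ 2 ::ₘ jet γ 3 ::ₘ jet γ 1 ::ₘ jet γ 1 ::ₘ s) 0
    + 105 * symD f (jet γ 2 ::ₘ jet γ 2 ::ₘ jet γ 3 ::ₘ s) 0
    + 70 * symD f (jet γ 3 ::ₘ jet γ 3 ::ₘ jet γ 1 ::ₘ s) 0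
    + 35 * symD f (jet γ 1 ::ₘ jet γ 1 ::ₘ jet γ 1 ::ₘ jet γ 4 ::ₘ s) 0
    + 105 * symD f (jet γ 1 ::ₘ jet γ 2 ::ₘ jet γ 4 ::ₘ s) 0
    + 35 * symD f (jet γ 3 ::ₘ jet γ 4 ::ₘ s) 0
    + 21 * symD f (jet γ 1 ::ₘ jet γ 1 ::ₘ jet γ 5 ::ₘ s) 0
    + 21 * symD f (jet γ 2 ::ₘ jet γ 5 ::ₘ s) 0
    + 7 * symD f (jet γ 1 ::ₘ jet γ 6 ::ₘ s) 0 + symD f (jet γ 7 ::ₘ s) 0 := by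
  rw [along_succ hf hγ]
  simp only [Finset.sum_range_succ, Finset.range_zero, Finset.sum_empty, Nat.reduceSub,
    along_zero h0, along_one hf hγ h0, along_two hf hγ h0, along_three hf hγ h0,
    along_four hf hγ h0, along_five hf hγ h0, along_six hf hγ h0]
  simp [Nat.choose]
  generalize jet γ 1 = a
  generalize jet γ 2 = b
  generalize jet γ 3 = c
  generalize jet γ 4 = d
  generalize jet γ 5 = e
  generalize jet γ 6 = g
  simp only [Multiset.cons_swap]
  ring

end Bell

/-- A smooth curve through the origin, parametrized by `y` and tangent there to the `y`-axis, on
which all partial derivatives of `f` except the one with respect to `y` vanish near the origin. -/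
structure IsCritCurve (f : (Fin (n + 2) → ℝ) → ℝ) (γ : ℝ → Fin (n + 2) → ℝ) : Prop where
  smooth : ContDiff ℝ ∞ γ
  zero : γ 0 = 0
  apply_one : ∀ t, γ t 1 = t
  tangent : jet γ 1 = ev 1
  crit : ∀ᶠ t in 𝓝 (0 : ℝ), ∀ v : Fin (n + 2) → ℝ, v 1 = 0 → fderiv ℝ f (γ t) v = 0

section Crit

variable {f : (Fin (n + 2) → ℝ) → ℝ} {γ : ℝ → Fin (n + 2) → ℝ}

theorem IsCritCurve.jet_apply_one (hγ : IsCritCurve f γ) (j : ℕ) : jet γ (j + 2) 1 = 0 := by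
  have h : (fun t => γ t 1) = fun t => t := funext hγ.apply_one
  rw [jet, h, iteratedDeriv_fun_id_zero, if_neg (by omega)]

theorem IsCritCurve.jet_eq (hγ : IsCritCurve f γ) (j : ℕ) :
    jet γ (j + 2) = jet γ (j + 2) 0 • ev 0 + incl fun i => jet γ (j + 2) (zi i) := by
  conv_lhs => rw [eq_split (jet γ (j + 2)), hγ.jet_apply_one j, zero_smul, zero_add]

/-- The derivatives along a critical curve of the derivative of `f` in a direction `v` with `y`
component zero all vanish. -/
theorem IsCritCurve.along_eq_zero (hf : ContDiff ℝ ∞ f) (hγ : IsCritCurve f γ) (k : ℕ)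
    {v : Fin (n + 2) → ℝ} (hv : v 1 = 0) : along f γ k (v ::ₘ 0) = 0 := by
  have h : (fun t => symD f (v ::ₘ 0) (γ t)) =ᶠ[𝓝 0] fun _ => 0 := by
    filter_upwards [hγ.crit] with t ht
    rw [symD_cons hf, symD_zero, ht v hv]
  rw [along, h.iteratedDeriv_eq, iteratedDeriv_const]
  simp

end Crit

/-! ### The first derivatives of the critical value -/

variable {n : ℕ}

section Table

variable {f : (Fin (n + 2) → ℝ) → ℝ} {γ : ℝ → Fin (n + 2) → ℝ}

/-- The derivatives of the critical value of orders `3` to `7`. In the formulas of Faà di Bruno the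
terms with the highest jets of the curve are removed by means of the equations
`IsCritCurve.along_eq_zero` in the directions of these jets, so that only the `2`-jet and the
`3`-jet remain. -/
theorem IsCritCurve.along_three (hf : IsCorankTwo f) (hγ : IsCritCurve f γ) :
    along f γ 3 0 = symD f (ev 1 ::ₘ ev 1 ::ₘ ev 1 ::ₘ 0) 0 := by
  rw [DSing.along_three hf.smooth hγ.smooth hγ.zero, hγ.tangent]
  have h1 := hf.symD_one_left (jet γ 2)
  have h2 := hf.symD_single (jet γ 3)
  rw [Multiset.insert_eq_cons, ← Multiset.cons_zero] at h1
  rw [← Multiset.cons_zero] at h2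
  rw [h1, h2]
  ring

theorem IsCritCurve.along_four (hf : IsCorankTwo f) (hγ : IsCritCurve f γ) :
    along f γ 4 0 = symD f (ev 1 ::ₘ ev 1 ::ₘ ev 1 ::ₘ ev 1 ::ₘ 0) 0
      + 3 * symD f (jet γ 2 ::ₘ ev 1 ::ₘ ev 1 ::ₘ 0) 0 := by
  have h2 := hγ.along_eq_zero hf.smooth 2 (hγ.jet_apply_one 0)
  have h1 := hγ.along_eq_zero hf.smooth 1 (hγ.jet_apply_one 1)
  have h0 := hγ.along_eq_zero hf.smooth 0 (hγ.jet_apply_one 2)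
  simp only [DSing.along_four hf.smooth hγ.smooth hγ.zero, along_one hf.smooth hγ.smooth hγ.zero,
    along_two hf.smooth hγ.smooth hγ.zero, along_zero hγ.zero, hγ.tangent,
    Nat.reduceAdd] at h0 h1 h2 ⊢
  generalize jet γ 2 = b at *
  generalize jet γ 3 = c at *
  generalize jet γ 4 = d at *
  generalize (ev 1 : Fin (n + 2) → ℝ) = e at *
  simp only [Multiset.cons_swap] at h0 h1 h2 ⊢
  linear_combination 3 * h2 + 4 * h1 + h0

theorem IsCritCurve.along_five (hf : IsCorankTwo f) (hγ : IsCritCurve f γ) :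
    along f γ 5 0 = symD f (ev 1 ::ₘ ev 1 ::ₘ ev 1 ::ₘ ev 1 ::ₘ ev 1 ::ₘ 0) 0
      + 10 * symD f (jet γ 2 ::ₘ ev 1 ::ₘ ev 1 ::ₘ ev 1 ::ₘ 0) 0
      + 15 * symD f (jet γ 2 ::ₘ jet γ 2 ::ₘ ev 1 ::ₘ 0) 0 := by
  have h2 := hγ.along_eq_zero hf.smooth 2 (hγ.jet_apply_one 1)
  have h1 := hγ.along_eq_zero hf.smooth 1 (hγ.jet_apply_one 2)
  have h0 := hγ.along_eq_zero hf.smooth 0 (hγ.jet_apply_one 3)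
  simp only [DSing.along_five hf.smooth hγ.smooth hγ.zero, along_one hf.smooth hγ.smooth hγ.zero,
    along_two hf.smooth hγ.smooth hγ.zero, along_zero hγ.zero, hγ.tangent,
    Nat.reduceAdd] at h0 h1 h2 ⊢
  generalize jet γ 2 = b at *
  generalize jet γ 3 = c at *
  generalize jet γ 4 = d at *
  generalize jet γ 5 = d' at *
  generalize (ev 1 : Fin (n + 2) → ℝ) = e at *
  simp only [Multiset.cons_swap] at h0 h1 h2 ⊢
  linear_combination 10 * h2 + 5 * h1 + h0

theorem IsCritCurve.along_six (hf : IsCorankTwo f) (hγ : IsCritCurve f γ) :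
    along f γ 6 0 = symD f (ev 1 ::ₘ ev 1 ::ₘ ev 1 ::ₘ ev 1 ::ₘ ev 1 ::ₘ ev 1 ::ₘ 0) 0
      + 15 * symD f (jet γ 2 ::ₘ ev 1 ::ₘ ev 1 ::ₘ ev 1 ::ₘ ev 1 ::ₘ 0) 0
      + 45 * symD f (jet γ 2 ::ₘ jet γ 2 ::ₘ ev 1 ::ₘ ev 1 ::ₘ 0) 0
      + 15 * symD f (jet γ 2 ::ₘ jet γ 2 ::ₘ jet γ 2 ::ₘ 0) 0
      + 10 * symD f (jet γ 3 ::ₘ ev 1 ::ₘ ev 1 ::ₘ ev 1 ::ₘ 0) 0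
      + 30 * symD f (jet γ 2 ::ₘ jet γ 3 ::ₘ ev 1 ::ₘ 0) 0 := by
  have h3 := hγ.along_eq_zero hf.smooth 3 (hγ.jet_apply_one 1)
  have h2 := hγ.along_eq_zero hf.smooth 2 (hγ.jet_apply_one 2)
  have h1 := hγ.along_eq_zero hf.smooth 1 (hγ.jet_apply_one 3)
  have h0 := hγ.along_eq_zero hf.smooth 0 (hγ.jet_apply_one 4)
  simp only [DSing.along_six hf.smooth hγ.smooth hγ.zero, along_one hf.smooth hγ.smooth hγ.zero,
    DSing.along_three hf.smooth hγ.smooth hγ.zero,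
    along_two hf.smooth hγ.smooth hγ.zero, along_zero hγ.zero, hγ.tangent,
    Nat.reduceAdd] at h0 h1 h2 h3 ⊢
  generalize jet γ 2 = b at *
  generalize jet γ 3 = c at *
  generalize jet γ 4 = d at *
  generalize jet γ 5 = d' at *
  generalize jet γ 6 = d'' at *
  generalize (ev 1 : Fin (n + 2) → ℝ) = e at *
  simp only [Multiset.cons_swap] at h0 h1 h2 h3 ⊢
  linear_combination 10 * h3 + 15 * h2 + 6 * h1 + h0

theorem IsCritCurve.along_seven (hf : IsCorankTwo f) (hγ : IsCritCurve f γ) :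
    along f γ 7 0 =
      symD f (ev 1 ::ₘ ev 1 ::ₘ ev 1 ::ₘ ev 1 ::ₘ ev 1 ::ₘ ev 1 ::ₘ ev 1 ::ₘ 0) 0
      + 21 * symD f (jet γ 2 ::ₘ ev 1 ::ₘ ev 1 ::ₘ ev 1 ::ₘ ev 1 ::ₘ ev 1 ::ₘ 0) 0
      + 105 * symD f (jet γ 2 ::ₘ jet γ 2 ::ₘ ev 1 ::ₘ ev 1 ::ₘ ev 1 ::ₘ 0) 0
      + 105 * symD f (jet γ 2 ::ₘ jet γ 2 ::ₘ jet γ 2 ::ₘ ev 1 ::ₘ 0) 0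
      + 35 * symD f (jet γ 3 ::ₘ ev 1 ::ₘ ev 1 ::ₘ ev 1 ::ₘ ev 1 ::ₘ 0) 0
      + 210 * symD f (jet γ 2 ::ₘ jet γ 3 ::ₘ ev 1 ::ₘ ev 1 ::ₘ 0) 0
      + 105 * symD f (jet γ 2 ::ₘ jet γ 2 ::ₘ jet γ 3 ::ₘ 0) 0
      + 70 * symD f (jet γ 3 ::ₘ jet γ 3 ::ₘ ev 1 ::ₘ 0) 0 := by
  have h3 := hγ.along_eq_zero hf.smooth 3 (hγ.jet_apply_one 2)
  have h2 := hγ.along_eq_zero hf.smooth 2 (hγ.jet_apply_one 3)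
  have h1 := hγ.along_eq_zero hf.smooth 1 (hγ.jet_apply_one 4)
  have h0 := hγ.along_eq_zero hf.smooth 0 (hγ.jet_apply_one 5)
  simp only [DSing.along_seven hf.smooth hγ.smooth hγ.zero, along_one hf.smooth hγ.smooth hγ.zero,
    DSing.along_three hf.smooth hγ.smooth hγ.zero,
    along_two hf.smooth hγ.smooth hγ.zero, along_zero hγ.zero, hγ.tangent,
    Nat.reduceAdd] at h0 h1 h2 h3 ⊢
  generalize jet γ 2 = b at *
  generalize jet γ 3 = c at *
  generalize jet γ 4 = d at *
  generalize jet γ 5 = d' at *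
  generalize jet γ 6 = d'' at *
  generalize jet γ 7 = d3 at *
  generalize (ev 1 : Fin (n + 2) → ℝ) = e at *
  simp only [Multiset.cons_swap] at h0 h1 h2 h3 ⊢
  linear_combination 35 * h3 + 21 * h2 + 7 * h1 + h0

/-- The `2`-jet of a critical curve. -/
theorem IsCritCurve.jet_two (hf : IsCorankTwo f) (hγ : IsCritCurve f γ) :
    jet γ 2 = jet γ 2 0 • ev 0 + (-1 : ℝ) • incl (gvec f [1, 1]) := by
  have h : jet γ 2 = jet γ 2 0 • ev 0 + incl fun i => jet γ 2 (zi i) := hγ.jet_eq 0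
  set u : Fin n → ℝ := fun i => jet γ 2 (zi i)
  have hu : u + gvec f [1, 1] = 0 := by
    refine hf.eq_zero_of_hess fun v => ?_
    have h2 := hγ.along_eq_zero hf.smooth 2 (incl_one v)
    rw [along_two hf.smooth hγ.smooth hγ.zero, hγ.tangent, h, symD_cons_add hf.smooth,
      symD_cons_smul hf.smooth] at h2
    have h3 := hf.symD_gvec [1, 1] v
    have h4 := hf.symD_zero_left (incl v)
    rw [Multiset.insert_eq_cons, ← Multiset.cons_zero] at h3 h4 ⊢
    rw [incl_add, symD_cons_add hf.smooth, h3]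
    simp only [List.map_cons, List.map_nil, ← Multiset.cons_coe, Multiset.coe_nil]
    rw [h4] at h2
    rw [Multiset.cons_swap (incl v), Multiset.cons_swap (incl v)]
    linear_combination h2
  conv_lhs => rw [h, eq_neg_of_add_eq_zero_left hu]
  rw [← incl_smul, neg_one_smul]

/-- The `z`-part of the `3`-jet of a critical curve. -/
theorem IsCritCurve.jet_three (hf : IsCorankTwo f) (hγ : IsCritCurve f γ) :
    jet γ 3 = jet γ 3 0 • ev 0 + ((-1 : ℝ) • incl (gvec f [1, 1, 1]) + ((3 : ℝ) • incl (gMg f)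
      + (-3 * jet γ 2 0) • incl (gvec f [0, 1]))) := by
  have h : jet γ 3 = jet γ 3 0 • ev 0 + incl fun i => jet γ 3 (zi i) := hγ.jet_eq 1
  have hj2 := hγ.jet_two hf
  set u : Fin n → ℝ := fun i => jet γ 3 (zi i)
  set a : ℝ := jet γ 2 0
  have hu : u + (gvec f [1, 1, 1] + ((-3 : ℝ) • gMg f + (3 * a) • gvec f [0, 1])) = 0 := by
    refine hf.eq_zero_of_hess fun v => ?_
    have h2 := hγ.along_eq_zero hf.smooth 3 (incl_one v)
    rw [DSing.along_three hf.smooth hγ.smooth hγ.zero, hγ.tangent, h, hj2,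
      Multiset.cons_swap (ev 1) (_ + _), symD_cons_add hf.smooth,
      symD_cons_smul hf.smooth, symD_cons_add hf.smooth, symD_cons_smul hf.smooth,
      symD_cons_smul hf.smooth] at h2
    have h3 := hf.symD_gvec [1, 1, 1] v
    have h4 := hf.symD_zero_left (incl v)
    have h5 := hf.symD_gvec [0, 1] v
    have h6 := hf.symD_gMg v
    simp only [Multiset.insert_eq_cons, ← Multiset.cons_zero, List.map_cons, List.map_nil,
      ← Multiset.cons_coe, Multiset.coe_nil] at h3 h4 h5 h6 ⊢
    simp only [incl_add, incl_smul, symD_cons_add hf.smooth, symD_cons_smul hf.smooth, h3, h5, h6]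
    rw [h4] at h2
    generalize incl (gvec f [1, 1]) = P at *
    generalize incl v = V at *
    generalize (ev 1 : Fin (n + 2) → ℝ) = e at *
    generalize (ev 0 : Fin (n + 2) → ℝ) = x at *
    simp only [Multiset.cons_swap] at h2 ⊢
    linear_combination h2
  conv_lhs => rw [h, eq_neg_of_add_eq_zero_left hu, ← neg_one_smul ℝ]
  rw [incl_smul, incl_add, incl_add, incl_smul, incl_smul]
  module

end Table

/-! ### The table -/

variable {n : ℕ}

section Table

variable {f : (Fin (n + 2) → ℝ) → ℝ} {γ : ℝ → Fin (n + 2) → ℝ}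

/-- The derivatives of the critical value function are the numbers of the table. Both sides are
expanded by multilinearity into derivatives of `f` in the directions `ev 0`, `ev 1` and the
vectors `gvec f l`, `gMg f`; the defining equations of these vectors make the expansions agree. -/
theorem IsCritCurve.isTable (hf : IsCorankTwo f) (hN : IsCubicNormalized f)
    (hγ : IsCritCurve f γ) : IsTable f fun μ => along f γ (μ - 1) 0 := by
  have hsm := hf.smooth
  have e3 := hγ.along_eq_zero hsm 3 (v := ev 0) (by simp)
  have e4 := hγ.along_eq_zero hsm 4 (v := ev 0) (by simp)
  rw [DSing.along_three hsm hγ.smooth hγ.zero, hγ.tangent] at e3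
  rw [DSing.along_four hsm hγ.smooth hγ.zero, hγ.tangent] at e4
  have t4 := hγ.along_four hf
  have t5 := hγ.along_five hf
  have t6 := hγ.along_six hf
  have t7 := hγ.along_seven hf
  have t3 := hγ.along_three hf
  have n1 := hN.xxx
  have n2 := hN.xyy
  have n3 := hN.xxy
  have k1 : ∀ v, symD f (ev 0 ::ₘ v ::ₘ 0) 0 = 0 := hf.symD_zero_left
  have v2 : ∀ s, symD f (jet γ 2 ::ₘ s) 0 = jet γ 2 0 * symD f (ev 0 ::ₘ s) 0
      - symD f (incl (gvec f [1, 1]) ::ₘ s) 0 := fun s => by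
    conv_lhs => rw [hγ.jet_two hf, symD_cons_add hsm, symD_cons_smul hsm, symD_cons_smul hsm]
    ring
  have v3 : ∀ s, symD f (jet γ 3 ::ₘ s) 0 = jet γ 3 0 * symD f (ev 0 ::ₘ s) 0
      - symD f (incl (gvec f [1, 1, 1]) ::ₘ s) 0 + 3 * symD f (incl (gMg f) ::ₘ s) 0
      - 3 * jet γ 2 0 * symD f (incl (gvec f [0, 1]) ::ₘ s) 0 := fun s => by
    conv_lhs => rw [hγ.jet_three hf, symD_cons_add hsm, symD_cons_smul hsm, symD_cons_add hsm,
      symD_cons_add hsm, symD_cons_smul hsm, symD_cons_smul hsm, symD_cons_smul hsm]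
    ring
  have kj : ∀ j, symD f (jet γ j ::ₘ ev 0 ::ₘ 0) 0 = 0 := fun j => by
    rw [Multiset.cons_swap]; exact k1 _
  rw [kj] at e3 e4
  -- the equations defining the vectors of the table, in pairs with equal left-hand sides
  have gP : ∀ u, _ := hf.symD_gvec [1, 1]
  have gQ : ∀ u, _ := hf.symD_gvec [1, 1, 1]
  have gR : ∀ u, _ := hf.symD_gvec [1, 1, 1, 1]
  have gS : ∀ u, _ := hf.symD_gvec [0, 1]
  have gT : ∀ u, _ := hf.symD_gvec [0, 0]
  have gH : ∀ u, _ := hf.symD_gvec [0, 1, 1]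
  have gW : ∀ u, _ := hf.symD_gMg
  have qs := (gQ (gvec f [0, 1])).symm
  have sq := gS (gvec f [1, 1, 1])
  have qw := (gQ (gMg f)).symm
  have wq := gW (gvec f [1, 1, 1])
  have qh := (gQ (gvec f [0, 1, 1])).symm
  have hq := gH (gvec f [1, 1, 1])
  have ws := (gW (gvec f [0, 1])).symm
  have sw := gS (gMg f)
  have wt := (gW (gvec f [0, 0])).symm
  have tw := gT (gMg f)
  have wr := (gW (gvec f [1, 1, 1, 1])).symm
  have rw := gR (gMg f)
  have wh := (gW (gvec f [0, 1, 1])).symm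
  have hw := gH (gMg f)
  have st := (gS (gvec f [0, 0])).symm
  have ts := gT (gvec f [0, 1])
  clear gP gQ gR gS gT gH gW
  -- the same expansions with the jet in the second or third place
  have v2' : ∀ c s, symD f (c ::ₘ jet γ 2 ::ₘ s) 0 = jet γ 2 0 * symD f (c ::ₘ ev 0 ::ₘ s) 0
      - symD f (c ::ₘ incl (gvec f [1, 1]) ::ₘ s) 0 := fun c s => by
    simp only [Multiset.cons_swap c _ s, v2]
  have v2'' : ∀ c d s, symD f (c ::ₘ d ::ₘ jet γ 2 ::ₘ s) 0 =
      jet γ 2 0 * symD f (c ::ₘ d ::ₘ ev 0 ::ₘ s) 0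
      - symD f (c ::ₘ d ::ₘ incl (gvec f [1, 1]) ::ₘ s) 0 := fun c d s => by
    simp only [Multiset.cons_swap d _ s, v2']
  have v3' : ∀ c s, symD f (c ::ₘ jet γ 3 ::ₘ s) 0 = jet γ 3 0 * symD f (c ::ₘ ev 0 ::ₘ s) 0
      - symD f (c ::ₘ incl (gvec f [1, 1, 1]) ::ₘ s) 0 + 3 * symD f (c ::ₘ incl (gMg f) ::ₘ s) 0
      - 3 * jet γ 2 0 * symD f (c ::ₘ incl (gvec f [0, 1]) ::ₘ s) 0 := fun c s => by
    simp only [Multiset.cons_swap c _ s, v3]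
  have v3'' : ∀ c d s, symD f (c ::ₘ d ::ₘ jet γ 3 ::ₘ s) 0 =
      jet γ 3 0 * symD f (c ::ₘ d ::ₘ ev 0 ::ₘ s) 0
      - symD f (c ::ₘ d ::ₘ incl (gvec f [1, 1, 1]) ::ₘ s) 0
      + 3 * symD f (c ::ₘ d ::ₘ incl (gMg f) ::ₘ s) 0
      - 3 * jet γ 2 0 * symD f (c ::ₘ d ::ₘ incl (gvec f [0, 1]) ::ₘ s) 0 := fun c d s => by
    simp only [Multiset.cons_swap d _ s, v3']
  simp only [v2, v2', v2'', v3, v3', v3''] at e3 e4 t4 t5 t6 t7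
  clear v2 v2' v2'' v3 v3' v3'' kj
  suffices h : along f γ 3 0 = a03 f ∧ along f γ 4 0 = a04 f ∧
      along f γ 5 0 = a05 f - 5 / 3 * a13 f ^ 2 ∧
      along f γ 6 0 = a06 f - 5 * a13 f * a14 f + 5 * a13 f ^ 2 * a22 f ∧
      along f γ 7 0 = a07 f - 7 * a13 f * a15 f + 35 / 3 * a13 f ^ 2 * a23 f
        - 35 / 9 * a13 f ^ 3 * a31 f - 35 / 8 * (a14 f - 2 * a13 f * a22 f) ^ 2 from
    ⟨h.1, h.2.1, h.2.2.1, h.2.2.2.1, h.2.2.2.2⟩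
  simp only [a03, a04, a05, a06, a07, a13, a14, a15, a22, a23, a31, mul_assoc,
    vec_dotProduct hsm, bil_eq hsm, cub_eq hsm, D_eq hsm]
  simp only [D_eq hsm, List.map_cons, List.map_nil, ← Multiset.cons_coe, Multiset.coe_nil,
    Multiset.insert_eq_cons, ← Multiset.cons_zero] at *
  generalize jet γ 2 0 = a at *
  generalize jet γ 3 0 = b at *
  generalize incl (gvec f [1, 1]) = P at *
  generalize incl (gvec f [1, 1, 1]) = Q at *
  generalize incl (gvec f [1, 1, 1, 1]) = R at *
  generalize incl (gvec f [0, 1]) = S at *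
  generalize incl (gvec f [0, 0]) = T at *
  generalize incl (gvec f [0, 1, 1]) = H at *
  generalize incl (gMg f) = W at *
  generalize (ev 1 : Fin (n + 2) → ℝ) = e at *
  generalize (ev 0 : Fin (n + 2) → ℝ) = x at *
  simp only [Multiset.cons_swap]
    at qs qw qh ws wt wr wh st sq wq hq sw tw rw hw ts n1 n2 n3 e3 e4 t3 t4 t5 t6 t7 ⊢
  have rqs := qs.trans sq
  have rqw := qw.trans wq
  have rqh := qh.trans hq
  have rws := ws.trans sw
  have rwt := wt.trans tw
  have rwr := wr.trans rw
  have rwh := wh.trans hw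
  have rst := st.trans ts
  simp only [t3, t4, t5, t6, t7, n1, n2, n3, rqs, rqw, rqh, rws, rwt, rwr, rwh, rst] at e3 e4 ⊢
  -- the equations `e3`, `e4` express `f_{xy³}`, `f_{xy⁴}` by the `x`-components `a`, `b` of the
  -- jets
  have c3 : symD f (e ::ₘ e ::ₘ e ::ₘ x ::ₘ 0) 0 = 3 * symD f (P ::ₘ e ::ₘ x ::ₘ 0) 0 - 3 * a := by
    linear_combination e3
  generalize symD f (e ::ₘ e ::ₘ e ::ₘ x ::ₘ 0) 0 = c at *
  generalize symD f (e ::ₘ e ::ₘ e ::ₘ e ::ₘ x ::ₘ 0) 0 = d at *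
  have c4 : d = -(6 * (a * symD f (e ::ₘ e ::ₘ x ::ₘ x ::ₘ 0) 0
        - symD f (P ::ₘ e ::ₘ e ::ₘ x ::ₘ 0) 0)
      + 3 * (symD f (P ::ₘ P ::ₘ x ::ₘ 0) 0 - 2 * a * symD f (P ::ₘ x ::ₘ x ::ₘ 0) 0)
      + 4 * (b - symD f (Q ::ₘ e ::ₘ x ::ₘ 0) 0 + 3 * symD f (W ::ₘ e ::ₘ x ::ₘ 0) 0
        - 3 * a * symD f (S ::ₘ e ::ₘ x ::ₘ 0) 0)) := by
    linear_combination e4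
  subst c3
  refine ⟨trivial, ?_, ?_, ?_, ?_⟩
  · ring
  · ring
  · rw [c4]
    ring
  · rw [c4]
    ring

end Table

/-! ### Polynomial dependence on the derivatives of `f` -/

variable {n : ℕ}

/-- A number depending on `f` which, for normalized `f`, is a polynomial without free term in the
components of the matrix inverse to `hessZ f` and in the derivatives of `f` of orders between `3`
and `L`, except those with respect to `y` only. -/
def IsPolyFun (L : ℕ) (F : ((Fin (n + 2) → ℝ) → ℝ) → ℝ) : Prop :=
  ∃ P ∈ MvPolynomial.supported ℚ {v : Var n | Allowed (L + 2) v},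
    MvPolynomial.constantCoeff P = 0 ∧
      ∀ f, IsCorankTwo f → IsCubicNormalized f → F f = evalAt f P

namespace IsPolyFun

variable {L : ℕ} {F F' : ((Fin (n + 2) → ℝ) → ℝ) → ℝ}

theorem congr (h : IsPolyFun L F)
    (h' : ∀ f, IsCorankTwo f → IsCubicNormalized f → F' f = F f) : IsPolyFun L F' := by
  obtain ⟨P, h1, h2, h3⟩ := h
  exact ⟨P, h1, h2, fun f hf hN => (h' f hf hN).trans (h3 f hf hN)⟩

theorem zero (h : ∀ f, IsCorankTwo f → IsCubicNormalized f → F f = 0) : IsPolyFun L F :=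
  ⟨0, zero_mem _, map_zero _, fun f hf hN => by rw [h f hf hN, evalAt, map_zero]⟩

theorem add (h : IsPolyFun L F) (h' : IsPolyFun L F') : IsPolyFun L fun f => F f + F' f := by
  obtain ⟨P, h1, h2, h3⟩ := h
  obtain ⟨P', h1', h2', h3'⟩ := h'
  exact ⟨P + P', add_mem h1 h1', by rw [map_add, h2, h2', add_zero], fun f hf hN => by
    dsimp only
    rw [h3 f hf hN, h3' f hf hN, evalAt, evalAt, evalAt, map_add]⟩

theorem mul (h : IsPolyFun L F) (h' : IsPolyFun L F') : IsPolyFun L fun f => F f * F' f := by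
  obtain ⟨P, h1, h2, h3⟩ := h
  obtain ⟨P', h1', h2', h3'⟩ := h'
  exact ⟨P * P', mul_mem h1 h1', by rw [map_mul, h2, zero_mul], fun f hf hN => by
    dsimp only
    rw [h3 f hf hN, h3' f hf hN, evalAt, evalAt, evalAt, map_mul]⟩

theorem const_mul (q : ℚ) (h : IsPolyFun L F) : IsPolyFun L fun f => (q : ℝ) * F f := by
  obtain ⟨P, h1, h2, h3⟩ := h
  refine ⟨MvPolynomial.C q * P, mul_mem ((MvPolynomial.supported ℚ _).algebraMap_mem q) h1,
    by rw [map_mul, h2, mul_zero], fun f hf hN => ?_⟩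
  dsimp only
  rw [h3 f hf hN, evalAt, evalAt, map_mul, MvPolynomial.aeval_C]
  rfl

theorem natCast_mul (q : ℕ) (h : IsPolyFun L F) : IsPolyFun L fun f => (q : ℝ) * F f :=
  (h.const_mul q).congr fun f _ _ => by simp

theorem neg (h : IsPolyFun L F) : IsPolyFun L fun f => -F f :=
  (h.const_mul (-1)).congr fun f _ _ => by simp

theorem sum {ι : Type} (s : Finset ι) {F : ι → ((Fin (n + 2) → ℝ) → ℝ) → ℝ}
    (h : ∀ i ∈ s, IsPolyFun L (F i)) : IsPolyFun L fun f => ∑ i ∈ s, F i f := by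
  classical
  induction s using Finset.induction_on with
  | empty => exact zero fun f _ _ => by simp
  | insert i s hi ih =>
    refine ((h i (Finset.mem_insert_self _ _)).add
      (ih fun j hj => h j (Finset.mem_insert_of_mem hj))).congr fun f _ _ => ?_
    rw [Finset.sum_insert hi]

theorem mono {L' : ℕ} (hL : L ≤ L') (h : IsPolyFun L F) : IsPolyFun L' F := by
  obtain ⟨P, h1, h2⟩ := h
  refine ⟨P, MvPolynomial.supported_mono ?_ h1, h2⟩
  rintro (l | p) hv
  · exact ⟨hv.1, hv.2.1.trans (by omega), hv.2.2⟩
  · trivial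

theorem var {v : Var n} (hv : Allowed (L + 2) v)
    (h : ∀ f, IsCorankTwo f → IsCubicNormalized f → F f =
      Sum.elim (fun l => D f l) (fun p => (hessZ f)⁻¹ p.1 p.2) v) : IsPolyFun L F :=
  ⟨MvPolynomial.X v, MvPolynomial.X_mem_supported.2 hv, MvPolynomial.constantCoeff_X ℚ v,
    fun f hf hN => by rw [h f hf hN, evalAt, MvPolynomial.aeval_X]⟩

end IsPolyFun

section Recursion

/-- The `k`-th derivative at `0` of the partial derivative of `f` named by `w` along `γ`. -/
noncomputable def wordAlong (f : (Fin (n + 2) → ℝ) → ℝ) (γ : ℝ → Fin (n + 2) → ℝ)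
    (w : List (Fin (n + 2))) (k : ℕ) : ℝ :=
  iteratedDeriv k (fun t => partialDeriv f w (γ t)) 0

variable {f : (Fin (n + 2) → ℝ) → ℝ} {γ : ℝ → Fin (n + 2) → ℝ}

theorem IsCritCurve.wordAlong_zero (hγ : IsCritCurve f γ) (w : List (Fin (n + 2))) :
    wordAlong f γ w 0 = D f w := by simp [wordAlong, hγ.zero, D]

theorem IsCritCurve.wordAlong_succ (hf : ContDiff ℝ ∞ f) (hγ : IsCritCurve f γ)
    (w : List (Fin (n + 2))) (k : ℕ) :
    wordAlong f γ w (k + 1) = wordAlong f γ (1 :: w) k +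
      ∑ j ∈ Finset.range k, (k.choose (j + 1) : ℝ) *
        (wordAlong f γ (0 :: w) (k - (j + 1)) * jet γ (j + 2) 0 +
          ∑ a, wordAlong f γ (zi a :: w) (k - (j + 1)) * jet γ (j + 2) (zi a)) := by
  have h := iteratedDeriv_succ_comp_curve (contDiff_partialDeriv hf w) hγ.smooth k 0
  have h' : wordAlong f γ w (k + 1) = ∑ i, ∑ j ∈ Finset.range (k + 1), (k.choose j : ℝ) *
      wordAlong f γ (i :: w) (k - j) * jet γ (j + 1) i := h
  rw [h', sum_univ_split]
  simp only [Finset.sum_range_succ' _ k]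
  simp only [zero_add, hγ.tangent, hγ.jet_apply_one]
  simp [zi_ne_one, mul_add, Finset.sum_add_distrib, Finset.mul_sum, mul_assoc]
  rw [Finset.sum_comm]
  ring

/-- The words of length one other than `[1]` name derivatives vanishing along the curve. -/
theorem IsCritCurve.wordAlong_singleton (hγ : IsCritCurve f γ) {i : Fin (n + 2)} (hi : i ≠ 1)
    (k : ℕ) : wordAlong f γ [i] k = 0 := by
  have h : (fun t => partialDeriv f [i] (γ t)) =ᶠ[𝓝 0] fun _ => 0 := by
    filter_upwards [hγ.crit] with t ht
    exact ht _ (by simp [hi.symm])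
  rw [wordAlong, h.iteratedDeriv_eq, iteratedDeriv_const]
  simp

theorem IsCorankTwo.D_zero_right (hf : IsCorankTwo f) (i : Fin (n + 2)) : D f [i, 0] = 0 := by
  rw [D_perm hf.smooth (List.Perm.swap _ _ _), D_eq hf.smooth]
  exact hf.symD_zero_left _

theorem IsCorankTwo.D_one_right (hf : IsCorankTwo f) (i : Fin (n + 2)) : D f [i, 1] = 0 := by
  rw [D_perm hf.smooth (List.Perm.swap _ _ _), D_eq hf.smooth]
  exact hf.symD_one_left _

theorem IsCorankTwo.D_zero_left (hf : IsCorankTwo f) (i : Fin (n + 2)) : D f [0, i] = 0 := by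
  rw [D_perm hf.smooth (List.Perm.swap _ _ _), hf.D_zero_right]

theorem IsCubicNormalized.D_yxx (hf : IsCorankTwo f) (hN : IsCubicNormalized f) :
    D f [1, 0, 0] = 1 := by
  rw [← hN.xxy]
  exact D_perm hf.smooth (List.perm_append_comm (l₁ := [1]) (l₂ := [0, 0]))

theorem IsCubicNormalized.D_xyx (hf : IsCorankTwo f) (hN : IsCubicNormalized f) :
    D f [0, 1, 0] = 1 := by
  rw [← hN.xxy]
  exact D_perm hf.smooth ((List.Perm.swap _ _ _).cons _)

theorem IsCubicNormalized.D_yxy (hf : IsCorankTwo f) (hN : IsCubicNormalized f) :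
    D f [1, 0, 1] = 0 := by
  rw [← hN.xyy]
  exact D_perm hf.smooth (List.Perm.swap _ _ _)

end Recursion

section Poly

variable {Γ : ((Fin (n + 2) → ℝ) → ℝ) → ℝ → Fin (n + 2) → ℝ}
  (hΓ : ∀ f, IsCorankTwo f → IsCubicNormalized f → IsCritCurve f (Γ f))
include hΓ

/-- A family of terms as in the recursion for `wordAlong` is polynomial if its factors are. -/
theorem isPolyFun_wordAlong_succ {L k : ℕ} {w : List (Fin (n + 2))}
    {F : ((Fin (n + 2) → ℝ) → ℝ) → ℝ}
    (h1 : IsPolyFun L fun f => wordAlong f (Γ f) (1 :: w) k - F f)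
    (h2 : ∀ j < k, IsPolyFun L fun f =>
      wordAlong f (Γ f) (0 :: w) (k - (j + 1)) * jet (Γ f) (j + 2) 0)
    (h3 : ∀ j < k, ∀ a, IsPolyFun L fun f =>
      wordAlong f (Γ f) (zi a :: w) (k - (j + 1)) * jet (Γ f) (j + 2) (zi a)) :
    IsPolyFun L fun f => wordAlong f (Γ f) w (k + 1) - F f := by
  refine (h1.add (IsPolyFun.sum (Finset.range k) fun j hj =>
    ((h2 j (Finset.mem_range.1 hj)).add (IsPolyFun.sum Finset.univ fun a _ =>
      h3 j (Finset.mem_range.1 hj) a)).natCast_mul (k.choose (j + 1)))).congr fun f hf hN => ?_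
  rw [(hΓ f hf hN).wordAlong_succ hf.smooth]
  ring

/-- A derivative along the critical curve of a partial derivative of order at least `3`, not with
respect to `y` only, is polynomial as soon as the jets of the curve that enter it are. -/
theorem isPolyFun_wordAlong {L : ℕ}
    (hg : ∀ k, 2 ≤ k → k + 3 ≤ L → IsPolyFun L (fun f => jet (Γ f) k 0) ∧
      ∀ a, IsPolyFun L fun f => jet (Γ f) k (zi a)) (m : ℕ) :
    ∀ w : List (Fin (n + 2)), 3 ≤ w.length → (∃ i ∈ w, i ≠ 1) → w.length + m ≤ L →
      IsPolyFun L fun f => wordAlong f (Γ f) w m := by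
  induction m using Nat.strong_induction_on with
  | _ m ih =>
    intro w hw hw1 hL
    cases m with
    | zero =>
      exact IsPolyFun.var (v := Sum.inl w) ⟨hw, by omega, hw1⟩ fun f hf hN =>
        (hΓ f hf hN).wordAlong_zero w
    | succ m =>
      have key : ∀ i, ∀ j ≤ m, IsPolyFun L fun f => wordAlong f (Γ f) (i :: w) (m - j) := by
        intro i j hj
        refine ih _ (by omega) _ (by simp; omega) ?_ (by simp; omega)
        obtain ⟨i', hi', hi1⟩ := hw1
        exact ⟨i', List.mem_cons_of_mem _ hi', hi1⟩
      refine (isPolyFun_wordAlong_succ hΓ (F := fun _ => 0)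
        ((key 1 0 (by omega)).congr fun f _ _ => by simp)
        (fun j hj => (key 0 (j + 1) (by omega)).mul (hg (j + 2) (by omega) (by omega)).1)
        (fun j hj a => (key (zi a) (j + 1) (by omega)).mul
          ((hg (j + 2) (by omega) (by omega)).2 a))).congr fun f _ _ => by simp

/-- The same for a partial derivative of the second order, differentiated at least once along the
curve: its derivative contains only partial derivatives of order at least `3`, and jets of the curve
of orders up to `m + 1`. -/
theorem isPolyFun_wordAlong_pair {L m : ℕ} (hm : m + 3 ≤ L)
    (hg : ∀ k, 2 ≤ k → k ≤ m + 1 → IsPolyFun L (fun f => jet (Γ f) k 0) ∧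
      ∀ a, IsPolyFun L fun f => jet (Γ f) k (zi a))
    (hg' : ∀ k, 2 ≤ k → k + 3 ≤ L → IsPolyFun L (fun f => jet (Γ f) k 0) ∧
      ∀ a, IsPolyFun L fun f => jet (Γ f) k (zi a))
    {i l : Fin (n + 2)} (h : i ≠ 1 ∨ l ≠ 1) :
    IsPolyFun L fun f => wordAlong f (Γ f) [i, l] (m + 1) := by
  have key : ∀ i', ∀ j ≤ m, IsPolyFun L fun f => wordAlong f (Γ f) [i', i, l] (m - j) := by
    intro i' j hj
    refine isPolyFun_wordAlong hΓ hg' _ _ (by simp) ?_ (by simp; omega)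
    rcases h with h | h
    · exact ⟨i, by simp, h⟩
    · exact ⟨l, by simp, h⟩
  exact (isPolyFun_wordAlong_succ hΓ (F := fun _ => 0)
    ((key 1 0 (by omega)).congr fun f _ _ => by simp)
    (fun j hj => (key 0 (j + 1) (by omega)).mul (hg (j + 2) (by omega) (by omega)).1)
    (fun j hj a => (key (zi a) (j + 1) (by omega)).mul
      ((hg (j + 2) (by omega) (by omega)).2 a))).congr fun f _ _ => by simp

end Poly

/-! ### The derivatives of the critical curve and of the critical value as polynomials -/

variable {n : ℕ}

section Poly

variable {Γ : ((Fin (n + 2) → ℝ) → ℝ) → ℝ → Fin (n + 2) → ℝ}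
  (hΓ : ∀ f, IsCorankTwo f → IsCubicNormalized f → IsCritCurve f (Γ f))
include hΓ

/-- The next derivative of the `x`-component of the critical curve is found from the equation
`f_x = 0`, in which its coefficient is a positive multiple of `f_{x²y} = 1`. -/
theorem isPolyFun_jet_x {k : ℕ}
    (hg : ∀ j, 2 ≤ j → j + 3 ≤ k + 4 → IsPolyFun (k + 4) (fun f => jet (Γ f) j 0) ∧
      ∀ a, IsPolyFun (k + 4) fun f => jet (Γ f) j (zi a))
    (hz : ∀ a, IsPolyFun (k + 4) fun f => jet (Γ f) (k + 2) (zi a)) :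
    IsPolyFun (k + 4) fun f => jet (Γ f) (k + 2) 0 := by
  have w3 : ∀ i : Fin (n + 2), ∀ m ≤ k + 1,
      IsPolyFun (k + 4) fun f => wordAlong f (Γ f) [i, 1, 0] m := fun i m hm =>
    isPolyFun_wordAlong hΓ hg m _ (by simp) ⟨0, by simp⟩ (by simp; omega)
  have w2 : ∀ i : Fin (n + 2), ∀ m ≤ k,
      IsPolyFun (k + 4) fun f => wordAlong f (Γ f) [i, 0] (m + 1) := fun i m hm =>
    isPolyFun_wordAlong_pair hΓ (by omega) (fun j h1 h2 => hg j h1 (by omega)) hg (by simp)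
  have s1 := IsPolyFun.sum (Finset.range k) fun j hj =>
    (((w3 0 (k + 1 - (j + 1)) (by omega)).mul
      (hg (j + 2) (by omega) (by have := Finset.mem_range.1 hj; omega)).1).add
    (IsPolyFun.sum Finset.univ fun a _ => (w3 (zi a) (k + 1 - (j + 1)) (by omega)).mul
      ((hg (j + 2) (by omega) (by have := Finset.mem_range.1 hj; omega)).2 a))).natCast_mul
        ((k + 1).choose (j + 1))
  have w2' : ∀ i : Fin (n + 2), ∀ j ∈ Finset.range k,
      IsPolyFun (k + 4) fun f => wordAlong f (Γ f) [i, 0] (k + 1 + 1 - (j + 1)) := by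
    intro i j hj
    have := Finset.mem_range.1 hj
    rw [show k + 1 + 1 - (j + 1) = k - j + 1 by omega]
    exact w2 i _ (by omega)
  have s2 := IsPolyFun.sum (Finset.range k) fun j hj =>
    (((w2' 0 j hj).mul
      (hg (j + 2) (by omega) (by have := Finset.mem_range.1 hj; omega)).1).add
    (IsPolyFun.sum Finset.univ fun a _ => (w2' (zi a) j hj).mul
      ((hg (j + 2) (by omega) (by have := Finset.mem_range.1 hj; omega)).2 a))).natCast_mul
        ((k + 1 + 1).choose (j + 1))
  have s3 := IsPolyFun.sum Finset.univ fun a _ => (w3 (zi a) 0 (by omega)).mul (hz a)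
  have s4 := (IsPolyFun.sum Finset.univ fun a _ => (w2 (zi a) 0 (by omega)).mul
    (hz a)).natCast_mul (k + 2)
  refine (((((w3 1 (k + 1) le_rfl).add s1).add s2).add (s3.add s4)).const_mul
    (-1 / (k + 3 : ℚ))).congr fun f hf hN => ?_
  have hγ := hΓ f hf hN
  have e1 := hγ.wordAlong_singleton (i := 0) (by simp) (k + 3)
  have e3 : wordAlong f (Γ f) [0, 0] 1 = 1 := by
    rw [hγ.wordAlong_succ hf.smooth]
    simp [hγ.wordAlong_zero, hN.D_yxx hf]
  rw [hγ.wordAlong_succ hf.smooth, hγ.wordAlong_succ hf.smooth, Finset.sum_range_succ,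
    Finset.sum_range_succ, Finset.sum_range_succ] at e1
  simp only [Nat.sub_self, hγ.wordAlong_zero, hf.D_zero_right, hN.D_xyx hf, e3,
    show k + 2 - (k + 1) = 1 by omega, show k + 2 = k + 1 + 1 from rfl, Nat.choose_self,
    Nat.choose_succ_self_right] at e1 ⊢
  have h0 : (k : ℝ) + 3 ≠ 0 := by positivity
  simp only [zero_mul, Finset.sum_const_zero, add_zero, mul_zero, zero_add] at e1 ⊢
  generalize (∑ j ∈ Finset.range k, _ : ℝ) = S1 at *
  generalize (∑ j ∈ Finset.range k, _ : ℝ) = S2 at *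
  simp only [Nat.cast_add, Nat.cast_one, Rat.cast_div, Rat.cast_neg, Rat.cast_one,
    Rat.cast_add, Rat.cast_natCast, Rat.cast_ofNat] at e1 ⊢
  field_simp
  linear_combination e1

/-- The next derivatives of the `z`-components of the critical curve are found from the equation
`f_z = 0` by means of the matrix inverse to `f_{z²}`. -/
theorem isPolyFun_jet_z {k : ℕ}
    (hg : ∀ j, 2 ≤ j → j ≤ k + 1 → IsPolyFun (k + 3) (fun f => jet (Γ f) j 0) ∧
      ∀ a, IsPolyFun (k + 3) fun f => jet (Γ f) j (zi a)) (a : Fin n) :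
    IsPolyFun (k + 3) fun f => jet (Γ f) (k + 2) (zi a) := by
  have w2 : ∀ i b, ∀ m ≤ k, IsPolyFun (k + 3) fun f => wordAlong f (Γ f) [i, zi b] (m + 1) :=
    fun i b m hm => isPolyFun_wordAlong_pair hΓ (by omega) (fun j h1 h2 => hg j h1 (by omega))
      (fun j h1 h2 => hg j h1 (by omega)) (Or.inr (zi_ne_one b))
  have s1 := fun b => IsPolyFun.sum (Finset.range k) fun j hj =>
    (((w2 0 b (k - (j + 1)) (by omega)).mul
      (hg (j + 2) (by omega) (by have := Finset.mem_range.1 hj; omega)).1).add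
    (IsPolyFun.sum Finset.univ fun a _ => (w2 (zi a) b (k - (j + 1)) (by omega)).mul
      ((hg (j + 2) (by omega) (by have := Finset.mem_range.1 hj; omega)).2 a))).natCast_mul
        ((k + 1).choose (j + 1))
  have hG : ∀ b, IsPolyFun (k + 3) fun f => (hessZ f)⁻¹ a b := fun b =>
    IsPolyFun.var (v := Sum.inr (a, b)) trivial fun f _ _ => rfl
  refine ((IsPolyFun.sum Finset.univ fun b _ =>
    (hG b).mul ((w2 1 b k le_rfl).add (s1 b))).neg).congr fun f hf hN => ?_
  have hγ := hΓ f hf hN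
  have key : ∀ b, (hessZ f).mulVec (fun a => jet (Γ f) (k + 2) (zi a)) b =
      -(wordAlong f (Γ f) [1, zi b] (k + 1) + ∑ j ∈ Finset.range k,
        ((k + 1).choose (j + 1) : ℝ) * (wordAlong f (Γ f) [0, zi b] (k - (j + 1) + 1) *
          jet (Γ f) (j + 2) 0 + ∑ a, wordAlong f (Γ f) [zi a, zi b] (k - (j + 1) + 1) *
            jet (Γ f) (j + 2) (zi a))) := by
    intro b
    have e1 := hγ.wordAlong_singleton (zi_ne_one b) (k + 2)
    have e2 : ∀ j ∈ Finset.range k, k + 1 - (j + 1) = k - (j + 1) + 1 := fun j hj => by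
      have := Finset.mem_range.1 hj
      omega
    rw [hγ.wordAlong_succ hf.smooth, Finset.sum_range_succ] at e1
    simp only [Nat.sub_self, hγ.wordAlong_zero, hf.D_zero_left, Nat.choose_self] at e1
    rw [Finset.sum_congr rfl fun j hj => by rw [e2 j hj]] at e1
    have e3 : (hessZ f).mulVec (fun a => jet (Γ f) (k + 2) (zi a)) b =
        ∑ a, D f [zi a, zi b] * jet (Γ f) (k + 2) (zi a) := by
      rw [← hf.hessZ_symm]
      rfl
    rw [e3]
    push_cast at e1 ⊢
    linear_combination e1
  have h := congrFun (Matrix.mulVec_mulVec (fun a => jet (Γ f) (k + 2) (zi a)) (hessZ f)⁻¹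
    (hessZ f)) a
  rw [Matrix.nonsing_inv_mul _ hf.isUnit_det, Matrix.one_mulVec] at h
  rw [← h, Matrix.mulVec, dotProduct, ← Finset.sum_neg_distrib]
  refine Finset.sum_congr rfl fun b _ => ?_
  rw [key b, mul_neg]

/-- The derivatives of the critical curve at the origin are polynomials in the derivatives of
`f`, with a bound on the orders. -/
theorem isPolyFun_jet (L : ℕ) : ∀ k, 2 ≤ k →
    (k + 2 ≤ L → IsPolyFun L fun f => jet (Γ f) k 0) ∧
      (k + 1 ≤ L → ∀ a, IsPolyFun L fun f => jet (Γ f) k (zi a)) := by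
  induction L with
  | zero => exact fun k _ => ⟨fun h => by omega, fun h => by omega⟩
  | succ L ih =>
    have hx : ∀ k, 2 ≤ k → k + 2 ≤ L + 1 → IsPolyFun (L + 1) fun f => jet (Γ f) k 0 := by
      intro k hk hL
      rcases Nat.lt_or_ge (k + 2) (L + 1) with h | h
      · exact ((ih k hk).1 (by omega)).mono (by omega)
      · obtain ⟨k, rfl⟩ := Nat.exists_eq_add_of_le' hk
        obtain rfl : L = k + 3 := by omega
        exact isPolyFun_jet_x hΓ
          (fun j h1 h2 => ⟨((ih j h1).1 (by omega)).mono (by omega),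
            fun a => ((ih j h1).2 (by omega) a).mono (by omega)⟩)
          (fun a => ((ih _ hk).2 (by omega) a).mono (by omega))
    refine fun k hk => ⟨hx k hk, fun hL a => ?_⟩
    rcases Nat.lt_or_ge (k + 1) (L + 1) with h | h
    · exact ((ih k hk).2 (by omega) a).mono (by omega)
    · obtain ⟨k, rfl⟩ := Nat.exists_eq_add_of_le' hk
      obtain rfl : L = k + 2 := by omega
      exact isPolyFun_jet_z hΓ (fun j h1 h2 => ⟨hx j h1 (by omega),
        fun a => ((ih j h1).2 (by omega) a).mono (by omega)⟩) a

/-- The derivatives along the critical curve of the pure derivatives with respect to `y`, up to the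
pure derivative of the highest order. -/
theorem isPolyFun_wordAlong_pure {L : ℕ} (m : ℕ) : ∀ a, a + 3 + m ≤ L + 1 →
    IsPolyFun L fun f => wordAlong f (Γ f) (List.replicate (a + 3) 1) m -
      D f (List.replicate (a + 3 + m) 1) := by
  induction m with
  | zero =>
    refine fun a _ => IsPolyFun.zero fun f hf hN => ?_
    rw [(hΓ f hf hN).wordAlong_zero, add_zero, sub_self]
  | succ m ih =>
    intro a hL
    have key : ∀ i : Fin (n + 2), i ≠ 1 → ∀ j < m, IsPolyFun L fun f =>
        wordAlong f (Γ f) (i :: List.replicate (a + 3) 1) (m - (j + 1)) := fun i hi j hj =>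
      isPolyFun_wordAlong hΓ (fun k h1 h2 => ⟨(isPolyFun_jet hΓ L k h1).1 (by omega),
        (isPolyFun_jet hΓ L k h1).2 (by omega)⟩) _ _ (by simp)
        ⟨i, by simp, hi⟩ (by simp; omega)
    exact isPolyFun_wordAlong_succ hΓ (F := fun f => D f (List.replicate (a + 3 + (m + 1)) 1))
      ((ih (a + 1) (by omega)).congr fun f _ _ => by
        rw [show a + 1 + 3 + m = a + 3 + (m + 1) by omega]; rfl)
      (fun j hj => (key 0 (by simp) j hj).mul
        ((isPolyFun_jet hΓ L (j + 2) (by omega)).1 (by omega)))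
      (fun j hj b => (key (zi b) (zi_ne_one b) j hj).mul
        ((isPolyFun_jet hΓ L (j + 2) (by omega)).2 (by omega) b))

/-- The derivatives of `f_y` along the critical curve. The derivatives of highest order other
than the pure one enter multiplied by `f_{xy} = 0`, `f_{yz} = 0` or `f_{xy²} = 0`. -/
theorem isPolyFun_wordAlong_y (L : ℕ) :
    IsPolyFun (L + 2) fun f => wordAlong f (Γ f) [1] (L + 2) -
      D f (List.replicate (L + 3) 1) := by
  have hJ := fun k h => isPolyFun_jet hΓ (L + 2) k h
  have w3 : ∀ i : Fin (n + 2), i ≠ 1 → ∀ m, m + 3 ≤ L + 2 →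
      IsPolyFun (L + 2) fun f => wordAlong f (Γ f) [i, 1, 1] m := fun i hi m hm =>
    isPolyFun_wordAlong hΓ (fun k h1 h2 => ⟨(hJ k h1).1 (by omega), (hJ k h1).2 (by omega)⟩)
      _ _ (by simp) ⟨i, by simp, hi⟩ (by simp; omega)
  have w2 : ∀ i : Fin (n + 2), i ≠ 1 → ∀ m, m + 3 ≤ L + 2 →
      IsPolyFun (L + 2) fun f => wordAlong f (Γ f) [i, 1] (m + 1) := fun i hi m hm =>
    isPolyFun_wordAlong_pair hΓ hm
      (fun k h1 h2 => ⟨(hJ k h1).1 (by omega), (hJ k h1).2 (by omega)⟩)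
      (fun k h1 h2 => ⟨(hJ k h1).1 (by omega), (hJ k h1).2 (by omega)⟩) (Or.inl hi)
  have h2 : IsPolyFun (L + 2) fun f => wordAlong f (Γ f) [1, 1] (L + 1) -
      D f (List.replicate (L + 3) 1) := by
    refine isPolyFun_wordAlong_succ hΓ (F := fun f => D f (List.replicate (L + 3) 1)) ?_
      (fun j hj => ?_) (fun j hj a => ?_)
    · refine (isPolyFun_wordAlong_pure hΓ L 0 (by omega)).congr fun f _ _ => ?_
      rw [show 0 + 3 + L = L + 3 by omega]
      rfl
    · rcases Nat.lt_or_ge (j + 1) L with h | h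
      · exact (w3 0 (by simp) _ (by omega)).mul ((hJ (j + 2) (by omega)).1 (by omega))
      · refine IsPolyFun.zero fun f hf hN => ?_
        rw [Nat.sub_eq_zero_of_le h, (hΓ f hf hN).wordAlong_zero, hN.xyy, zero_mul]
    · exact (w3 (zi a) (zi_ne_one a) _ (by omega)).mul ((hJ (j + 2) (by omega)).2 (by omega) a)
  refine isPolyFun_wordAlong_succ hΓ h2 (fun j hj => ?_) (fun j hj a => ?_)
  · rcases Nat.lt_or_ge (j + 1) L with h | h
    · obtain ⟨m, hm⟩ : ∃ m, L + 1 - (j + 1) = m + 1 := ⟨L - (j + 1), by omega⟩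
      rw [hm]
      exact (w2 0 (by simp) m (by omega)).mul ((hJ (j + 2) (by omega)).1 (by omega))
    · refine IsPolyFun.zero fun f hf hN => ?_
      rcases Nat.lt_or_ge j L with h' | h'
      · rw [show L + 1 - (j + 1) = 0 + 1 by omega, (hΓ f hf hN).wordAlong_succ hf.smooth]
        simp [(hΓ f hf hN).wordAlong_zero, hN.D_yxy hf]
      · rw [show L + 1 - (j + 1) = 0 by omega, (hΓ f hf hN).wordAlong_zero, hf.D_one_right,
          zero_mul]
  · rcases Nat.lt_or_ge j L with h | h
    · obtain ⟨m, hm⟩ : ∃ m, L + 1 - (j + 1) = m + 1 := ⟨L - (j + 1), by omega⟩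
      rw [hm]
      exact (w2 (zi a) (zi_ne_one a) m (by omega)).mul ((hJ (j + 2) (by omega)).2 (by omega) a)
    · refine IsPolyFun.zero fun f hf hN => ?_
      rw [show L + 1 - (j + 1) = 0 by omega, (hΓ f hf hN).wordAlong_zero, hf.D_one_right,
        zero_mul]

end Poly

section CriticalValue

variable {f : (Fin (n + 2) → ℝ) → ℝ} {γ : ℝ → Fin (n + 2) → ℝ}

/-- Along a critical curve the derivative of the critical value is `f_y`. -/
theorem IsCritCurve.along_succ (hf : ContDiff ℝ ∞ f) (hγ : IsCritCurve f γ) (k : ℕ) :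
    along f γ (k + 1) 0 = wordAlong f γ [1] k := by
  have h : deriv (fun t => f (γ t)) =ᶠ[𝓝 0] fun t => partialDeriv f [1] (γ t) := by
    filter_upwards [hγ.crit] with t ht
    have h1 : HasDerivAt γ (deriv γ t) t := (hγ.smooth.differentiable (by simp) t).hasDerivAt
    have h2 := ((hf.differentiable (by simp)) (γ t)).hasFDerivAt.comp_hasDerivAt t h1
    have h3 : deriv γ t 1 = 1 := by
      have h4 := (hasDerivAt_pi.1 h1) 1
      rw [show (fun t => γ t 1) = fun t => t from funext hγ.apply_one] at h4
      exact h4.unique (hasDerivAt_id t)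
    rw [show (fun t => f (γ t)) = f ∘ γ from rfl, h2.deriv]
    have h5 : deriv γ t = (deriv γ t - ev 1) + ev 1 := by simp
    rw [h5, map_add, ht _ (by simp [h3]), zero_add]
    rfl
  rw [along, symD_zero, iteratedDeriv_succ', h.iteratedDeriv_eq, wordAlong]

end CriticalValue

/-! ### Divisibility and the Morse lemma with parameters -/

section OneVariable

theorem iteratedDeriv_pow_mul {h : ℝ → ℝ} (hh : ContDiff ℝ ∞ h) (k j : ℕ) :
    iteratedDeriv (k + j) (fun t => t ^ k * h t) 0 =
      ((k + j).choose k : ℝ) * k.factorial * iteratedDeriv j h 0 := by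
  have hp : ContDiff ℝ ∞ fun t : ℝ => t ^ k := contDiff_id.pow k
  rw [iteratedDeriv_fun_mul (contDiff_infty.1 hp _).contDiffAt (contDiff_infty.1 hh _).contDiffAt,
    Finset.sum_eq_single k]
  · rw [iteratedDeriv_fun_pow_zero, if_pos rfl, Nat.add_sub_cancel_left]
  · intro i _ hi
    rw [iteratedDeriv_fun_pow_zero, if_neg hi]
    simp
  · intro h
    exact absurd (Finset.mem_range.2 (by omega)) h

theorem exists_hadamard_one {W Y : Type} [NormedAddCommGroup W] [NormedSpace ℝ W]
    [FiniteDimensional ℝ W] [NormedAddCommGroup Y] [NormedSpace ℝ Y] [CompleteSpace Y]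
    {F : W → Y} (hF : ContDiff ℝ ∞ F) :
    ∃ A : W → W →L[ℝ] Y, ContDiff ℝ ∞ A ∧ (∀ w, F w = F 0 + A w w) ∧ A 0 = fderiv ℝ F 0 := by
  obtain ⟨A, hA, h1, h2⟩ := exists_hadamard (P := ℝ) (F := fun q : ℝ × W => F q.2)
    (hF.comp contDiff_snd)
  refine ⟨fun w => A (0, w), hA.comp (by fun_prop), fun w => h1 0 w, (h2 0).trans ?_⟩
  have h3 : HasFDerivAt (fun q : ℝ × W => F q.2)
      ((fderiv ℝ F 0).comp (ContinuousLinearMap.snd ℝ ℝ W)) ((0 : ℝ), (0 : W)) :=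
    HasFDerivAt.comp (g := F) (f := Prod.snd) _ (hF.differentiable (by simp) _).hasFDerivAt
      hasFDerivAt_snd
  rw [h3.fderiv]
  ext; simp

/-- Hadamard's lemma for a real parameter and a real variable. -/
theorem exists_hadamard_real {P : Type} [NormedAddCommGroup P] [NormedSpace ℝ P]
    [FiniteDimensional ℝ P] {F : P × ℝ → ℝ} (hF : ContDiff ℝ ∞ F) :
    ∃ A : P × ℝ → ℝ, ContDiff ℝ ∞ A ∧ (∀ p s, F (p, s) = F (p, 0) + s * A (p, s)) ∧
      ∀ p, A (p, 0) = deriv (fun s => F (p, s)) 0 := by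
  obtain ⟨A, hA, h1, h2⟩ := exists_hadamard hF
  refine ⟨fun q => A q 1, hA.clm_apply contDiff_const, fun p s => ?_, fun p => ?_⟩
  · rw [h1 p s]
    congr 1
    conv_lhs => rw [show s = s • (1 : ℝ) by simp, map_smul]
    simp
  · have h3 : HasDerivAt (fun s : ℝ => (p, s)) ((0 : P), (1 : ℝ)) 0 :=
      (hasDerivAt_const _ _).prodMk (hasDerivAt_id _)
    have h4 := (hF.differentiable (by simp) (p, (0 : ℝ))).hasFDerivAt.comp_hasDerivAt _ h3
    rw [show (fun s => F (p, s)) = F ∘ fun s : ℝ => (p, s) from rfl, h4.deriv]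
    change A (p, 0) 1 = _
    rw [h2]
    simp

/-- A smooth function vanishing at `0` with its first `m - 1` derivatives is divisible by `tᵐ`. -/
theorem exists_eq_pow_mul (m : ℕ) : ∀ {φ : ℝ → ℝ}, ContDiff ℝ ∞ φ →
    (∀ j < m, iteratedDeriv j φ 0 = 0) →
    ∃ ψ : ℝ → ℝ, ContDiff ℝ ∞ ψ ∧ (∀ t, φ t = t ^ m * ψ t) ∧
      iteratedDeriv m φ 0 = m.factorial * ψ 0 := by
  induction m with
  | zero => exact fun {φ} h _ => ⟨φ, h, fun t => by simp, by simp⟩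
  | succ m ih =>
    intro φ hφ h0
    obtain ⟨ψ, hψ, h1, -⟩ := ih hφ fun j hj => h0 j (by omega)
    obtain ⟨A, hA, h2, -⟩ := exists_hadamard_one hψ
    have h3 : ψ 0 = 0 := by
      have := h0 m (by omega)
      rw [show φ = fun t => t ^ m * ψ t from funext h1] at this
      have h4 := iteratedDeriv_pow_mul hψ m 0
      simp only [add_zero, Nat.choose_self, iteratedDeriv_zero, Nat.cast_one, one_mul] at h4
      rw [h4] at this
      exact (mul_eq_zero.1 this).resolve_left (by positivity)
    have hA' : ContDiff ℝ ∞ fun t => A t 1 := hA.clm_apply contDiff_const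
    have h5 : ∀ t, φ t = t ^ (m + 1) * A t 1 := fun t => by
      rw [h1 t, h2 t, h3, zero_add, pow_succ, mul_assoc]
      conv_lhs => rw [show A t t = A t (t • (1 : ℝ)) by simp, map_smul, smul_eq_mul]
    refine ⟨fun t => A t 1, hA', h5, ?_⟩
    rw [show φ = fun t => t ^ (m + 1) * A t 1 from funext h5]
    have h4 := iteratedDeriv_pow_mul hA' (m + 1) 0
    simpa using h4

end OneVariable

section Morse

variable {W : Type} [NormedAddCommGroup W] [NormedSpace ℝ W] [FiniteDimensional ℝ W]

/-- The operators near the identity have smooth square roots, unique near the identity. -/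
theorem exists_smooth_sqrt : ∃ R : (W →L[ℝ] W) → (W →L[ℝ] W),
    (∀ᶠ a in 𝓝 1, ContDiffAt ℝ ∞ R a) ∧ R 1 = 1 ∧ (∀ᶠ a in 𝓝 1, R a * R a = a) ∧
      ∀ᶠ s in 𝓝 1, R (s * s) = s := by
  have : CompleteSpace W := FiniteDimensional.complete ℝ W
  have hsq : ContDiff ℝ ∞ fun s : W →L[ℝ] W => s * s := contDiff_id.mul contDiff_id
  let M : (W →L[ℝ] W) ≃L[ℝ] (W →L[ℝ] W) := ContinuousLinearEquiv.equivOfInverse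
    ((2 : ℝ) • ContinuousLinearMap.id ℝ (W →L[ℝ] W))
    ((2 : ℝ)⁻¹ • ContinuousLinearMap.id ℝ (W →L[ℝ] W))
    (fun s => inv_smul_smul₀ (two_ne_zero (α := ℝ)) s)
    (fun s => smul_inv_smul₀ (two_ne_zero (α := ℝ)) s)
  have hM : HasFDerivAt (fun s : W →L[ℝ] W => s * s)
      (M : (W →L[ℝ] W) →L[ℝ] (W →L[ℝ] W)) 1 := by
    have h := (hasFDerivAt_id (𝕜 := ℝ) (1 : W →L[ℝ] W)).mul' (hasFDerivAt_id (𝕜 := ℝ) 1)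
    refine h.congr_fderiv (ContinuousLinearMap.ext fun s => ?_)
    change (1 : W →L[ℝ] W) * s + s * 1 = (2 : ℝ) • s
    rw [one_mul, mul_one, two_smul]
  obtain ⟨R, h1, h2, h3, h4⟩ :=
    exists_smooth_localInverse (Eventually.of_forall fun s => hsq.contDiffAt) M hM
  simp only [mul_one] at h1 h2 h3
  exact ⟨R, h1, h2, h3, h4⟩

/-- A nondegenerate bilinear form as an isomorphism onto the dual space. -/
noncomputable def dualEquiv {T : W →L[ℝ] W →L[ℝ] ℝ} (hT : ∀ u, T u = 0 → u = 0) :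
    W ≃L[ℝ] (W →L[ℝ] ℝ) :=
  LinearEquiv.toContinuousLinearEquiv
    (LinearEquiv.ofInjectiveOfFinrankEq (T : W →ₗ[ℝ] (W →L[ℝ] ℝ))
      ((injective_iff_map_eq_zero _).2 hT) (by
        rw [← (LinearMap.toContinuousLinearMap (𝕜 := ℝ) (E := W) (F' := ℝ)).finrank_eq]
        exact (Subspace.dual_finrank_eq (K := ℝ) (V := W)).symm))

/-- The Morse lemma with parameters, for families of quadratic forms: a smooth family of symmetric
bilinear forms is near a nondegenerate member obtained from this member by a smooth family of linear
substitutions. They are the square roots of `(H p₀)⁻¹ H p`, which are self-adjoint with respect to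
`H p₀` because square roots near the identity are unique. -/
theorem exists_smooth_diagonalization {P : Type} [NormedAddCommGroup P] [NormedSpace ℝ P]
    [FiniteDimensional ℝ P] {H : P → W →L[ℝ] W →L[ℝ] ℝ} (hH : ContDiff ℝ ∞ H)
    (hsymm : ∀ p u v, H p u v = H p v u) (p₀ : P) (hinj : ∀ u, H p₀ u = 0 → u = 0) :
    ∃ S : P → W →L[ℝ] W, ContDiff ℝ ∞ S ∧ S p₀ = 1 ∧
      ∀ᶠ p in 𝓝 p₀, ∀ w, H p w w = H p₀ (S p w) (S p w) := by
  have : CompleteSpace W := FiniteDimensional.complete ℝ W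
  let J := dualEquiv hinj
  have hJ : ∀ u, J u = H p₀ u := fun u => rfl
  obtain ⟨R, hR1, hR2, hR3, hR4⟩ := exists_smooth_sqrt (W := W)
  let A : P → W →L[ℝ] W := fun p => (J.symm : (W →L[ℝ] ℝ) →L[ℝ] W).comp (H p)
  have hA : ContDiff ℝ ∞ A := contDiff_const.clm_comp hH
  have hA0 : A p₀ = 1 := by
    ext1 w
    simp only [A, ContinuousLinearMap.comp_apply, ← hJ, ContinuousLinearEquiv.coe_coe,
      ContinuousLinearEquiv.symm_apply_apply, one_apply_eq_self]
  have hJA : ∀ p u, J (A p u) = H p u := fun p u => by simp [A]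
  let adj : (W →L[ℝ] W) → (W →L[ℝ] W) := fun s => (J.symm : (W →L[ℝ] ℝ) →L[ℝ] W).comp
    (((ContinuousLinearMap.compL ℝ W W ℝ).flip s).comp (J : W →L[ℝ] (W →L[ℝ] ℝ)))
  have hadj : ∀ s u v, J (adj s u) v = J u (s v) := fun s u v => by simp [adj]
  have hadj_unique : ∀ s s' : W →L[ℝ] W, (∀ u v, J (s' u) v = J u (s v)) → s' = adj s := by
    intro s s' h
    ext1 u
    apply J.injective
    ext1 v
    rw [h, hadj]
  have hadj_cont : Continuous adj := by
    have h := (ContinuousLinearMap.compL ℝ W W ℝ).flip.continuous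
    exact continuous_const.clm_comp (h.clm_comp continuous_const)
  have hadj_one : adj 1 = 1 := (hadj_unique 1 1 fun u v => rfl).symm
  have htA : Tendsto A (𝓝 p₀) (𝓝 1) := by
    have := hA.continuous.continuousAt (x := p₀)
    rwa [ContinuousAt, hA0] at this
  have htS : Tendsto (fun p => R (A p)) (𝓝 p₀) (𝓝 1) := by
    have h := hR1.self_of_nhds.continuousAt
    rw [ContinuousAt, hR2] at h
    exact h.comp htA
  have htadj : Tendsto (fun p => adj (R (A p))) (𝓝 p₀) (𝓝 1) := by
    have h := hadj_cont.continuousAt (x := 1)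
    rw [ContinuousAt, hadj_one] at h
    exact h.comp htS
  obtain ⟨S, hS, hS'⟩ := exists_contDiff_eventuallyEq (F := fun p => R (A p)) (a := p₀)
    ((htA.eventually hR1).mono fun p hp => hp.comp p hA.contDiffAt)
  refine ⟨S, hS, by rw [hS'.self_of_nhds]; simp [hA0, hR2], ?_⟩
  filter_upwards [hS', htA.eventually hR3, htadj.eventually hR4] with p hp h3 h4 w
  have hadjA : A p = adj (A p) := hadj_unique _ _ fun u v => by
    rw [hJA, hJ, hsymm p₀, ← hJ, hJA, hsymm]
  have hmul : ∀ s : W →L[ℝ] W, adj s * adj s = adj (s * s) := fun s =>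
    hadj_unique _ _ fun u v => by
      rw [mul_apply_eq_comp, mul_apply_eq_comp, hadj, hadj]
  have hself : adj (R (A p)) = R (A p) := by
    rw [hmul, h3, ← hadjA] at h4
    exact h4.symm
  have key : J (R (A p) (R (A p) w)) w = J (R (A p) w) (R (A p) w) := by
    conv_lhs => rw [← hself]
    rw [hadj, hself]
  rw [hp, ← hJ, ← key, ← hJA]
  conv_lhs => rw [← h3]
  rfl

end Morse

/-! ### Second-order Hadamard lemma and divisibility with parameters -/

section Hadamard

variable {P W : Type} [NormedAddCommGroup P] [NormedSpace ℝ P] [FiniteDimensional ℝ P]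
  [NormedAddCommGroup W] [NormedSpace ℝ W] [FiniteDimensional ℝ W]

/-- Hadamard's lemma to the second order, with parameters. -/
theorem exists_hadamard_two {F : P × W → ℝ} (hF : ContDiff ℝ ∞ F) :
    ∃ H : P × W → W →L[ℝ] W →L[ℝ] ℝ, ContDiff ℝ ∞ H ∧ (∀ q u v, H q u v = H q v u) ∧
      (∀ p w, F (p, w) = F (p, 0) + fderiv ℝ F (p, 0) (0, w) + H (p, w) w w) ∧
      ∀ p w, 2 * H (p, 0) w w = iteratedDeriv 2 (fun t : ℝ => F (p, t • w)) 0 := by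
  obtain ⟨A, hA, h1, h2⟩ := exists_hadamard hF
  obtain ⟨B, hB, h3, -⟩ := exists_hadamard hA
  have hflip : ContDiff ℝ ∞ fun q => (B q).flip :=
    contDiff_clm_apply_iff.2 fun u => contDiff_clm_apply_iff.2 fun v =>
      (hB.clm_apply contDiff_const).clm_apply contDiff_const
  have h4 : ∀ q u v, ((1 / 2 : ℝ) • (B q + (B q).flip)) u v = (B q u v + B q v u) / 2 := by
    intro q u v
    change (1 / 2 : ℝ) • (B q u v + B q v u) = _
    rw [smul_eq_mul]; ring
  have h5 : ∀ p w, F (p, w) = F (p, 0) + fderiv ℝ F (p, 0) (0, w) +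
      ((1 / 2 : ℝ) • (B (p, w) + (B (p, w)).flip)) w w := by
    intro p w
    rw [h4, h1, h3, h2, add_apply]
    simp [add_assoc]
  have hH : ContDiff ℝ ∞ fun q => (1 / 2 : ℝ) • (B q + (B q).flip) := (hB.add hflip).const_smul _
  refine ⟨fun q => (1 / 2 : ℝ) • (B q + (B q).flip), hH,
    fun q u v => by rw [h4, h4, add_comm], h5, fun p w => ?_⟩
  set H := fun q => (1 / 2 : ℝ) • (B q + (B q).flip)
  have hh : ContDiff ℝ ∞ fun t : ℝ => H (p, t • w) w w :=
    ((hH.comp (by fun_prop)).clm_apply contDiff_const).clm_apply contDiff_const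
  have h6 : (fun t : ℝ => F (p, t • w)) = fun t => F (p, 0) + t ^ 1 * fderiv ℝ F (p, 0) (0, w) +
      t ^ 2 * H (p, t • w) w w := by
    funext t
    rw [h5 p (t • w)]
    have : ((0 : P), t • w) = t • ((0 : P), w) := by simp
    rw [this, map_smul, map_smul (H _), smul_apply, map_smul]
    simp only [smul_eq_mul]; ring
  have h7 := iteratedDeriv_pow_mul hh 2 0
  have h8 := iteratedDeriv_pow_mul (contDiff_const (c := fderiv ℝ F (p, 0) (0, w))) 1 1
  have h9 : ContDiff ℝ ∞ fun t : ℝ => t ^ 2 * H (p, t • w) w w := (contDiff_id.pow 2).mul hh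
  rw [h6, iteratedDeriv_fun_add (by fun_prop) (contDiff_infty.1 h9 2).contDiffAt,
    iteratedDeriv_fun_add (by fun_prop) (by fun_prop)]
  simp only [Nat.reduceAdd, iteratedDeriv_const] at h7 h8 ⊢
  rw [h7, h8]
  norm_num

/-- A smooth function of a parameter and of a real variable vanishing for the value `0` of the
latter together with its first `m - 1` derivatives is divisible by the `m`-th power of the
variable. -/
theorem exists_eq_pow_mul_param (m : ℕ) {F : P × ℝ → ℝ} (hF : ContDiff ℝ ∞ F)
    (h0 : ∀ p, ∀ j < m, iteratedDeriv j (fun t => F (p, t)) 0 = 0) :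
    ∃ K : P × ℝ → ℝ, ContDiff ℝ ∞ K ∧ (∀ p t, F (p, t) = t ^ m * K (p, t)) ∧
      ∀ p, iteratedDeriv m (fun t => F (p, t)) 0 = m.factorial * K (p, 0) := by
  induction m with
  | zero => exact ⟨F, hF, fun p t => by simp, fun p => by simp⟩
  | succ m ih =>
    obtain ⟨K, hK, h1, h2⟩ := ih fun p j hj => h0 p j (by omega)
    obtain ⟨A, hA, h3, -⟩ := exists_hadamard_real hK
    have h4 : ∀ p, K (p, 0) = 0 := fun p => by
      have := h2 p
      rw [h0 p m (by omega)] at this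
      exact (mul_eq_zero.1 this.symm).resolve_left (by positivity)
    have h5 : ∀ p t, F (p, t) = t ^ (m + 1) * A (p, t) := fun p t => by
      rw [h1, h3, h4]; ring
    refine ⟨A, hA, h5, fun p => ?_⟩
    have h6 := iteratedDeriv_pow_mul (h := fun t => A (p, t)) (hA.comp (by fun_prop)) (m + 1) 0
    rw [show (fun t => F (p, t)) = fun t => t ^ (m + 1) * A (p, t) from funext (h5 p)]
    simpa using h6

end Hadamard

/-! ### The graph of the critical points with respect to `z` -/

variable {n : ℕ}

/-- The inclusion of the space of the variables `z` as a continuous linear map. -/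
noncomputable def inclL : (Fin n → ℝ) →L[ℝ] (Fin (n + 2) → ℝ) :=
  LinearMap.toContinuousLinearMap
    { toFun := incl, map_add' := incl_add, map_smul' := incl_smul }

theorem inclL_apply (u : Fin n → ℝ) : inclL u = incl u := rfl

/-- The point `(x, y, z)` of `ℝ^ν`, as a linear function of the pair `((x, y), z)`. -/
noncomputable def glue : ((ℝ × ℝ) × (Fin n → ℝ)) →L[ℝ] (Fin (n + 2) → ℝ) :=
  ((ContinuousLinearMap.fst ℝ ℝ ℝ).smulRight (ev 0) +
    (ContinuousLinearMap.snd ℝ ℝ ℝ).smulRight (ev 1)).coprod inclL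

theorem glue_apply (x y : ℝ) (z : Fin n → ℝ) :
    glue ((x, y), z) = x • ev 0 + y • ev 1 + incl z := by
  simp [glue, inclL_apply]

theorem glue_zero (q : (ℝ × ℝ) × (Fin n → ℝ)) : glue q 0 = q.1.1 := by
  obtain ⟨⟨x, y⟩, z⟩ := q
  simp [glue_apply, incl_zero]

theorem glue_one (q : (ℝ × ℝ) × (Fin n → ℝ)) : glue q 1 = q.1.2 := by
  obtain ⟨⟨x, y⟩, z⟩ := q
  simp [glue_apply, incl_one]

theorem glue_zi (q : (ℝ × ℝ) × (Fin n → ℝ)) (j : Fin n) : glue q (zi j) = q.2 j := by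
  obtain ⟨⟨x, y⟩, z⟩ := q
  simp [glue_apply, incl_zi, zi_ne_zero, zi_ne_one]

theorem glue_coords (k : Fin (n + 2) → ℝ) : glue ((k 0, k 1), fun j => k (zi j)) = k := by
  rw [glue_apply, add_assoc, ← eq_split]

variable {f : (Fin (n + 2) → ℝ) → ℝ}

theorem IsCorankTwo.symD_pair_glue (hf : IsCorankTwo f) (x y : ℝ) (z : Fin n → ℝ)
    (v : Fin (n + 2) → ℝ) : symD f {glue ((x, y), z), v} 0 = symD f {incl z, v} 0 := by
  rw [glue_apply, Multiset.insert_eq_cons, symD_cons_add hf.smooth, symD_cons_add hf.smooth,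
    symD_cons_smul hf.smooth, symD_cons_smul hf.smooth, ← Multiset.insert_eq_cons,
    ← Multiset.insert_eq_cons, hf.symD_zero_left, hf.symD_one_left]
  simp

/-- The critical points of `f` with respect to the variables `z` form near the origin the graph of
a smooth map of the `(x, y)`-plane, tangent to this plane at the origin. -/
theorem IsCorankTwo.exists_critical_graph (hf : IsCorankTwo f) :
    ∃ Z : ℝ × ℝ → Fin n → ℝ, ContDiff ℝ ∞ Z ∧ Z 0 = 0 ∧ fderiv ℝ Z 0 = 0 ∧
      ∀ᶠ p in 𝓝 0, ∀ u, fderiv ℝ f (glue (p, Z p)) (incl u) = 0 := by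
  have hf' : ContDiff ℝ ∞ (fderiv ℝ f) := hf.smooth.fderiv_right (by simp)
  let F : (ℝ × ℝ) × (Fin n → ℝ) → (Fin n → ℝ) →L[ℝ] ℝ := fun q => (fderiv ℝ f (glue q)).comp inclL
  have hF : ContDiff ℝ ∞ F := (hf'.comp glue.contDiff).clm_comp contDiff_const
  have h0 : F (0, 0) = 0 := by
    simp only [F]
    rw [show ((0 : ℝ × ℝ), (0 : Fin n → ℝ)) = 0 from rfl, map_zero, hf.critical]
    rfl
  have hd : ∀ v w u, fderiv ℝ F (0, 0) (v, w) u = symD f {incl w, incl u} 0 := by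
    intro v w u
    have h1 : HasFDerivAt (fun q => fderiv ℝ f (glue q))
        ((fderiv ℝ (fderiv ℝ f) 0).comp glue) ((0 : ℝ × ℝ), (0 : Fin n → ℝ)) := by
      have := (hf'.differentiable (by simp) (glue ((0 : ℝ × ℝ), (0 : Fin n → ℝ)))).hasFDerivAt.comp
        _ glue.hasFDerivAt
      rwa [show ((0 : ℝ × ℝ), (0 : Fin n → ℝ)) = 0 from rfl, map_zero] at this
    have h2 := h1.clm_comp (hasFDerivAt_const inclL _)
    rw [h2.fderiv]
    simp only [ContinuousLinearMap.comp_zero, zero_add]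
    change fderiv ℝ (fderiv ℝ f) 0 (glue (v, w)) (incl u) = _
    rw [fderiv_fderiv_apply hf.smooth]
    exact hf.symD_pair_glue _ _ _ _
  let T := (fderiv ℝ F (0, 0)).comp (ContinuousLinearMap.inr ℝ (ℝ × ℝ) (Fin n → ℝ))
  have hT : ∀ w u, T w u = symD f {incl w, incl u} 0 := fun w u => hd 0 w u
  have hTinj : ∀ w, T w = 0 → w = 0 := fun w hw => hf.eq_zero_of_hess fun u => by
    rw [← hT, hw]; rfl
  obtain ⟨Z, hZ, hZ0, hZ1⟩ := exists_smooth_implicit hF h0 (dualEquiv hTinj) (by ext1 w; rfl)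
  refine ⟨Z, hZ, hZ0, ?_, hZ1.mono fun p hp u =>
    congrArg (fun A : (Fin n → ℝ) →L[ℝ] ℝ => A u) hp⟩
  refine ContinuousLinearMap.ext fun v => ?_
  apply hf.eq_zero_of_hess
  intro u
  have h3 : HasFDerivAt (fun p => (p, Z p)) ((ContinuousLinearMap.id ℝ (ℝ × ℝ)).prod
      (fderiv ℝ Z 0)) 0 :=
    (hasFDerivAt_id _).prodMk (hZ.differentiable (by simp) 0).hasFDerivAt
  have h4 : HasFDerivAt F (fderiv ℝ F (0, 0)) (0, Z 0) := by
    rw [hZ0]; exact (hF.differentiable (by simp) _).hasFDerivAt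
  have h5 := h4.comp (0 : ℝ × ℝ) h3
  have h6 := h5.unique ((hasFDerivAt_const (0 : (Fin n → ℝ) →L[ℝ] ℝ) _).congr_of_eventuallyEq hZ1)
  have h7 := congrArg (fun A : (ℝ × ℝ) →L[ℝ] (Fin n → ℝ) →L[ℝ] ℝ => A v u) h6
  exact (hd v _ u).symm.trans h7

/-! ### Existence of a critical curve -/

variable {n : ℕ} {f : (Fin (n + 2) → ℝ) → ℝ}

theorem jet_one_eq {m : ℕ} {γ : ℝ → Fin m → ℝ} {v : Fin m → ℝ} (h : HasDerivAt γ v 0) :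
    jet γ 1 = v := by
  funext i
  rw [jet, iteratedDeriv_one]
  exact (hasDerivAt_pi.1 h i).deriv

/-- The third differential of `f` at the origin on the vectors of the `(x, y)`-plane. -/
theorem symD_plane (hf : ContDiff ℝ ∞ f) (a c a' c' a'' c'' : ℝ) :
    symD f ((a • ev 0 + c • ev 1) ::ₘ (a' • ev 0 + c' • ev 1) ::ₘ
        (a'' • ev 0 + c'' • ev 1) ::ₘ 0) 0 =
      D f [0, 0, 0] * (a * a' * a'') +
        D f [0, 0, 1] * (a * a' * c'' + a * c' * a'' + c * a' * a'') +
        D f [0, 1, 1] * (a * c' * c'' + c * a' * c'' + c * c' * a'') +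
        D f [1, 1, 1] * (c * c' * c'') := by
  have e : ∀ a c s, symD f ((a • ev 0 + c • ev 1) ::ₘ s) 0 =
      a * symD f (ev 0 ::ₘ s) 0 + c * symD f (ev 1 ::ₘ s) 0 := fun a c s => by
    rw [symD_cons_add hf, symD_cons_smul hf, symD_cons_smul hf]
  have hc : ∀ u v w : Fin (n + 2) → ℝ, u ::ₘ v ::ₘ w ::ₘ 0 = w ::ₘ u ::ₘ v ::ₘ 0 := fun u v w => by
    rw [Multiset.cons_swap v w, Multiset.cons_swap u w]
  have d : ∀ i j k : Fin (n + 2), symD f (ev i ::ₘ ev j ::ₘ ev k ::ₘ 0) 0 = D f [i, j, k] :=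
    fun i j k => by rw [D_eq hf]; rfl
  have e3 : ∀ i j : Fin (n + 2), symD f (ev i ::ₘ ev j ::ₘ (a'' • ev 0 + c'' • ev 1) ::ₘ 0) 0 =
      a'' * D f [0, i, j] + c'' * D f [1, i, j] := fun i j => by
    rw [hc, e, d, d]
  have s1 : ∀ i j k : Fin (n + 2), D f [i, j, k] = D f [j, i, k] := fun i j k =>
    D_perm hf (List.Perm.swap _ _ _)
  have s2 : ∀ i j k : Fin (n + 2), D f [i, j, k] = D f [i, k, j] := fun i j k =>
    D_perm hf ((List.Perm.swap _ _ _).cons _)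
  rw [e, Multiset.cons_swap (ev 0), Multiset.cons_swap (ev 1), e, e, e3, e3, e3, e3, s1 1 0 0,
    s1 1 0 1, s2 0 1 0, s2 1 1 0, s1 1 0 1]
  ring

/-- The derivatives of `f` along a curve tangent to the kernel of the second differential. -/
theorem IsCubicNormalized.iteratedDeriv_curve (hN : IsCubicNormalized f) (hf : IsCorankTwo f)
    {γ : ℝ → Fin (n + 2) → ℝ} (hγ : ContDiff ℝ ∞ γ) (h0 : γ 0 = 0) {a b : ℝ}
    (h1 : jet γ 1 = a • ev 0 + b • ev 1) :
    iteratedDeriv 1 (fun t => f (γ t)) 0 = 0 ∧ iteratedDeriv 2 (fun t => f (γ t)) 0 = 0 ∧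
      iteratedDeriv 3 (fun t => f (γ t)) 0 = 3 * a ^ 2 * b + D f [1, 1, 1] * b ^ 3 := by
  have e : ∀ s, symD f ((a • ev 0 + b • ev 1) ::ₘ s) 0 =
      a * symD f (ev 0 ::ₘ s) 0 + b * symD f (ev 1 ::ₘ s) 0 := fun s => by
    rw [symD_cons_add hf.smooth, symD_cons_smul hf.smooth, symD_cons_smul hf.smooth]
  have e1 : ∀ v, symD f (v ::ₘ 0) 0 = 0 := fun v => hf.symD_single v
  have e2 : ∀ v, symD f (jet γ 1 ::ₘ v ::ₘ 0) 0 = 0 := fun v => by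
    have h2 := hf.symD_zero_left v
    have h3 := hf.symD_one_left v
    simp only [Multiset.insert_eq_cons, ← Multiset.cons_zero] at h2 h3
    rw [h1, e, h2, h3]
    simp
  have hs : ∀ k, iteratedDeriv k (fun t => f (γ t)) 0 = along f γ k 0 := fun k => by
    rw [along, symD_zero]
  refine ⟨?_, ?_, ?_⟩
  · rw [hs, along_one hf.smooth hγ h0, e1]
  · rw [hs, along_two hf.smooth hγ h0, e1, e2, add_zero]
  · rw [hs, along_three hf.smooth hγ h0, e1, e2, h1]
    rw [symD_plane hf.smooth, hN.xxx, hN.xxy, hN.xyy]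
    ring

/-- The lift of a point of the `(x, y)`-plane to the graph of `Z`. -/
noncomputable def lift (Z : ℝ × ℝ → Fin n → ℝ) (p : ℝ × ℝ) : Fin (n + 2) → ℝ := glue (p, Z p)

variable {Z : ℝ × ℝ → Fin n → ℝ}

theorem contDiff_lift (hZ : ContDiff ℝ ∞ Z) : ContDiff ℝ ∞ (lift Z) :=
  glue.contDiff.comp (contDiff_id.prodMk hZ)

theorem lift_zero (hZ0 : Z 0 = 0) : lift Z (0, 0) = 0 := by
  rw [lift, show Z (0, 0) = 0 from hZ0]; exact map_zero _

theorem hasFDerivAt_lift (hZ : ContDiff ℝ ∞ Z) (p : ℝ × ℝ) :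
    HasFDerivAt (lift Z)
      (glue.comp ((ContinuousLinearMap.id ℝ (ℝ × ℝ)).prod (fderiv ℝ Z p))) p :=
  glue.hasFDerivAt.comp p
    ((hasFDerivAt_id _).prodMk (hZ.differentiable (by simp) p).hasFDerivAt)

theorem jet_lift (hZ : ContDiff ℝ ∞ Z) (hZ1 : fderiv ℝ Z 0 = 0) {p : ℝ → ℝ × ℝ} {a b : ℝ}
    (hp0 : p 0 = 0) (hp : HasDerivAt p (a, b) 0) :
    jet (fun t => lift Z (p t)) 1 = a • ev 0 + b • ev 1 := by
  have h := hasFDerivAt_lift hZ (p 0)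
  have h1 := jet_one_eq (h.comp_hasDerivAt 0 hp)
  rw [hp0] at h1
  refine h1.trans ?_
  change glue ((a, b), fderiv ℝ Z 0 (a, b)) = _
  rw [hZ1, glue_apply]
  simp [incl]

/-- On the graph of the `z`-critical points the differential of `f` is determined by the
differential of the restriction of `f` to this graph. -/
theorem fderiv_comp_lift (hf : ContDiff ℝ ∞ f) (hZ : ContDiff ℝ ∞ Z) {p : ℝ × ℝ}
    (hp : ∀ u, fderiv ℝ f (lift Z p) (incl u) = 0) (x y : ℝ) :
    fderiv ℝ (fun p => f (lift Z p)) p (x, y) =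
      x * fderiv ℝ f (lift Z p) (ev 0) + y * fderiv ℝ f (lift Z p) (ev 1) := by
  have h := (hf.differentiable (by simp) (lift Z p)).hasFDerivAt.comp p (hasFDerivAt_lift hZ p)
  rw [show (fun p => f (lift Z p)) = f ∘ lift Z from rfl, h.fderiv]
  change fderiv ℝ f (lift Z p) (glue ((x, y), fderiv ℝ Z p (x, y))) = _
  rw [glue_apply, map_add, map_add, map_smul, map_smul, hp]
  simp

/-- The critical curve: after the blow-up `x = y u`, the function `f - f(0)` restricted to the graph
of the `z`-critical points is divisible by `y³`, and the quotient `u² / 2 + const` on the line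
`y = 0` has a nondegenerate critical point with respect to `u`. -/
theorem IsCubicNormalized.exists_isCritCurve (hN : IsCubicNormalized f) (hf : IsCorankTwo f)
    (hZ : ContDiff ℝ ∞ Z) (hZ0 : Z 0 = 0) (hZ1 : fderiv ℝ Z 0 = 0)
    (hZc : ∀ᶠ p in 𝓝 0, ∀ u, fderiv ℝ f (lift Z p) (incl u) = 0) :
    ∃ ξ : ℝ → ℝ, ContDiff ℝ ∞ ξ ∧ HasDerivAt ξ 0 0 ∧ ξ 0 = 0 ∧
      IsCritCurve f fun y => lift Z (ξ y, y) := by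
  have hl := contDiff_lift hZ
  have hl0 := lift_zero hZ0
  have hg : ContDiff ℝ ∞ fun p => f (lift Z p) := hf.smooth.comp hl
  -- the restriction of `f - f(0)` in the coordinates `(u, y)` of the blow-up
  let F : ℝ × ℝ → ℝ := fun q => -f 0 + f (lift Z (q.2 * q.1, q.2))
  have hF : ContDiff ℝ ∞ F := contDiff_const.add (hg.comp (by fun_prop))
  have hcurve : ∀ u : ℝ, iteratedDeriv 1 (fun t => f (lift Z (t * u, t))) 0 = 0 ∧
      iteratedDeriv 2 (fun t => f (lift Z (t * u, t))) 0 = 0 ∧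
      iteratedDeriv 3 (fun t => f (lift Z (t * u, t))) 0 =
        3 * u ^ 2 * 1 + D f [1, 1, 1] * 1 ^ 3 := fun u =>
    hN.iteratedDeriv_curve hf (γ := fun t => lift Z (t * u, t)) (hl.comp (by fun_prop))
      (by simpa using hl0)
      (jet_lift hZ hZ1 (by simp) ((hasDerivAt_mul_const u).prodMk (hasDerivAt_id _)))
  have hFd : ∀ u j, 0 < j → iteratedDeriv j (fun t => F (u, t)) 0 =
      iteratedDeriv j (fun t => f (lift Z (t * u, t))) 0 := fun u j hj =>
    iteratedDeriv_const_add hj _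
  obtain ⟨K, hK, hK1, hK2⟩ := exists_eq_pow_mul_param 3 hF fun u j hj => by
    interval_cases j
    · simp only [iteratedDeriv_zero, F, zero_mul]
      rw [hl0, neg_add_cancel]
    · rw [hFd u 1 one_pos, (hcurve u).1]
    · rw [hFd u 2 two_pos, (hcurve u).2.1]
  have hK0 : ∀ u, K (u, 0) = u ^ 2 / 2 + D f [1, 1, 1] / 6 := fun u => by
    have := hK2 u
    rw [hFd u 3 three_pos, (hcurve u).2.2] at this
    norm_num [Nat.factorial] at this
    linarith
  have hKd : ContDiff ℝ ∞ (fderiv ℝ K) := hK.fderiv_right (by simp)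
  -- the equation `∂K/∂u = 0` is solved for `u`
  let E : ℝ × ℝ → ℝ := fun q => fderiv ℝ K (q.2, q.1) (1, 0)
  have hE : ContDiff ℝ ∞ E := (hKd.comp (by fun_prop)).clm_apply contDiff_const
  have hKu : ∀ u y, HasDerivAt (fun u => K (u, y)) (E (y, u)) u := fun u y =>
    (hK.differentiable (by simp) (u, y)).hasFDerivAt.comp_hasDerivAt u
      ((hasDerivAt_id u).prodMk (hasDerivAt_const u y))
  have hE0 : ∀ u, E (0, u) = u := fun u => by
    have h1 := hKu u 0
    simp only [hK0] at h1
    have h2 := ((hasDerivAt_pow 2 u).div_const 2).add_const (D f [1, 1, 1] / 6)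
    have := h1.unique h2
    rw [this]; simp
  obtain ⟨u, hu, hu0, hu1⟩ := exists_smooth_implicit hE (hE0 0) (ContinuousLinearEquiv.refl ℝ ℝ) (by
    have h1 : HasDerivAt (fun u : ℝ => E (0, u)) (fderiv ℝ E (0, 0) (0, 1)) 0 :=
      (hE.differentiable (by simp) (0, 0)).hasFDerivAt.comp_hasDerivAt 0
        ((hasDerivAt_const _ _).prodMk (hasDerivAt_id _))
    simp only [hE0] at h1
    ext
    simpa using h1.unique (hasDerivAt_id _))
  have hξ : ContDiff ℝ ∞ fun y => y * u y := contDiff_id.mul hu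
  have hξd : HasDerivAt (fun y => y * u y) 0 0 := by
    have := (hasDerivAt_id (0 : ℝ)).mul (hu.differentiable (by simp) 0).hasDerivAt
    simp only [hu0, id, mul_zero, zero_mul, add_zero] at this
    exact this
  have hp0 : (fun y => ((y * u y, y) : ℝ × ℝ)) 0 = 0 := by simp
  refine ⟨fun y => y * u y, hξ, hξd, by simp, ⟨hl.comp (by fun_prop), ?_, fun t => ?_, ?_, ?_⟩⟩
  · simpa using hl0
  · exact glue_one _
  · have := jet_lift hZ hZ1 (p := fun y => (y * u y, y)) hp0 (hξd.prodMk (hasDerivAt_id _))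
    simpa using this
  · have hpt : Tendsto (fun y : ℝ => (y * u y, y)) (𝓝 0) (𝓝 0) := by
      have : Continuous fun y : ℝ => (y * u y, y) := by fun_prop
      simpa only [hp0] using this.tendsto 0
    filter_upwards [hu1, hpt.eventually hZc] with y hy1 hy2 v hv
    -- `y³ ∂K/∂u = y f_x`, which gives `f_x = 0` for `y ≠ 0`
    have h0 : fderiv ℝ f (lift Z (y * u y, y)) (ev 0) = 0 := by
      rcases eq_or_ne y 0 with rfl | hy
      · rw [zero_mul, hl0, hf.critical]; rfl
      · have h1 : HasDerivAt (fun u => F (u, y)) (fderiv ℝ (fun p => f (lift Z p)) (y * u y, y)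
            (y, 0)) (u y) := by
          have h2 : HasDerivAt (fun u : ℝ => (y * u, y)) (y, (0 : ℝ)) (u y) := by
            have := ((hasDerivAt_id (u y)).const_mul y).prodMk (hasDerivAt_const (u y) y)
            simpa using this
          exact ((hg.differentiable (by simp) (y * u y, y)).hasFDerivAt.comp_hasDerivAt
            (f := fun u => (y * u, y)) (u y) h2).const_add _
        have h3 := (hKu (u y) y).const_mul (y ^ 3)
        simp only [hK1] at h1
        have h4 := h1.unique h3
        rw [hy1, fderiv_comp_lift hf.smooth hZ hy2] at h4
        have : y * fderiv ℝ f (lift Z (y * u y, y)) (ev 0) = 0 := by linarith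
        exact (mul_eq_zero.1 this).resolve_left hy
    rw [eq_split v, hv, map_add, map_add, map_smul, map_smul, h0, hy2]
    simp

/-! ### The splitting lemma -/

variable {n : ℕ} {f : (Fin (n + 2) → ℝ) → ℝ} {Z : ℝ × ℝ → Fin n → ℝ}

/-- On the graph of the `z`-critical points `f` differs from its value on the critical curve by
the square of the distance `x` to the curve times a function `y / 2 + …`. -/
theorem IsCubicNormalized.exists_quadratic_factor (hN : IsCubicNormalized f)
    (hf : IsCorankTwo f) (hZ : ContDiff ℝ ∞ Z) (hZ0 : Z 0 = 0) (hZ1 : fderiv ℝ Z 0 = 0)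
    {ξ : ℝ → ℝ} (hξ : ContDiff ℝ ∞ ξ) (hξ1 : HasDerivAt ξ 0 0) (hξ0 : ξ 0 = 0)
    (hZc : ∀ᶠ p in 𝓝 0, ∀ u, fderiv ℝ f (lift Z p) (incl u) = 0)
    (hγ : IsCritCurve f fun y => lift Z (ξ y, y)) :
    ∃ B : ℝ × ℝ → ℝ, ContDiff ℝ ∞ B ∧ B 0 = 0 ∧
      HasFDerivAt B ((1 / 2 : ℝ) • ContinuousLinearMap.fst ℝ ℝ ℝ) 0 ∧
      ∀ᶠ y in 𝓝 (0 : ℝ), ∀ x, f (lift Z (ξ y + x, y)) = f (lift Z (ξ y, y)) + x ^ 2 * B (y, x) := by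
  have hl := contDiff_lift hZ
  have hl0 := lift_zero hZ0
  have hg : ContDiff ℝ ∞ fun p => f (lift Z p) := hf.smooth.comp hl
  let F : ℝ × ℝ → ℝ := fun q => f (lift Z (ξ q.1 + q.2, q.1))
  have hF : ContDiff ℝ ∞ F := hg.comp (by fun_prop)
  obtain ⟨H, hH, -, hH1, -⟩ := exists_hadamard_two hF
  have hB : ContDiff ℝ ∞ fun q => H q 1 1 := (hH.clm_apply contDiff_const).clm_apply contDiff_const
  have hpt : Tendsto (fun y : ℝ => (ξ y, y)) (𝓝 0) (𝓝 0) := by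
    have h : Continuous fun y : ℝ => (ξ y, y) := by fun_prop
    have := h.tendsto 0
    rwa [hξ0] at this
  have hsplit : ∀ᶠ y in 𝓝 (0 : ℝ), ∀ x,
      f (lift Z (ξ y + x, y)) = f (lift Z (ξ y, y)) + x ^ 2 * H (y, x) 1 1 := by
    filter_upwards [hγ.crit, hpt.eventually hZc] with y hy1 hy2 x
    have h1 : HasDerivAt (fun x : ℝ => F (y, x)) (fderiv ℝ F (y, 0) (0, 1)) 0 :=
      (hF.differentiable (by simp) (y, 0)).hasFDerivAt.comp_hasDerivAt (0 : ℝ)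
        ((hasDerivAt_const _ _).prodMk (hasDerivAt_id _))
    have h2 : HasDerivAt (fun x : ℝ => F (y, x))
        (fderiv ℝ (fun p => f (lift Z p)) (ξ y, y) (1, 0)) 0 := by
      have h3 : HasDerivAt (fun x : ℝ => (ξ y + x, y)) (1, (0 : ℝ)) 0 :=
        ((hasDerivAt_id (0 : ℝ)).const_add (ξ y)).prodMk (hasDerivAt_const _ _)
      have h4 : HasFDerivAt (fun p => f (lift Z p)) (fderiv ℝ (fun p => f (lift Z p)) (ξ y, y))
          (ξ y + 0, y) := by
        rw [add_zero]; exact (hg.differentiable (by simp) _).hasFDerivAt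
      exact h4.comp_hasDerivAt (f := fun x => (ξ y + x, y)) (0 : ℝ) h3
    have h5 : fderiv ℝ F (y, 0) (0, 1) = 0 := by
      rw [h1.unique h2, fderiv_comp_lift hf.smooth hZ hy2, hy1 _ (by simp)]
      simp
    have h6 := hH1 y x
    have h7 : ((0 : ℝ), x) = x • ((0 : ℝ), (1 : ℝ)) := by simp
    have h8 : H (y, x) x x = x ^ 2 * H (y, x) 1 1 := by
      have h9 : ∀ A : ℝ →L[ℝ] ℝ →L[ℝ] ℝ, A x x = x ^ 2 * A 1 1 := fun A => by
        have : x = x • (1 : ℝ) := by simp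
        conv_lhs => rw [this, map_smul, map_smul, smul_apply]
        simp only [smul_eq_mul]
        ring
      exact h9 _
    rw [h7, map_smul, h5, h8] at h6
    simpa [F] using h6
  -- the Taylor coefficients of the factor are found from the derivatives of `f` along the
  -- curves `t ↦ (ξ (b t) + t, b t)`
  have key : ∀ b : ℝ, H (0, 0) 1 1 = 0 ∧ fderiv ℝ (fun q => H q 1 1) 0 (b, 1) = b / 2 := by
    intro b
    have hξb : HasDerivAt (fun t => ξ (t * b)) 0 0 := by
      have h1 : HasDerivAt ξ 0 (0 * b) := by rwa [zero_mul]
      have := h1.comp (0 : ℝ) (hasDerivAt_mul_const b)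
      rwa [zero_mul] at this
    have c1 := hN.iteratedDeriv_curve hf (γ := fun t => lift Z (ξ (t * b) + t, t * b))
      (hl.comp (by fun_prop)) (by simpa [hξ0] using hl0)
      (jet_lift hZ hZ1 (p := fun t => (ξ (t * b) + t, t * b)) (by simp [hξ0])
        ((hξb.add (hasDerivAt_id _)).prodMk (hasDerivAt_mul_const b)))
    have c2 := hN.iteratedDeriv_curve hf (γ := fun t => lift Z (ξ (t * b), t * b))
      (hl.comp (by fun_prop)) (by simpa [hξ0] using hl0)
      (jet_lift hZ hZ1 (p := fun t => (ξ (t * b), t * b)) (by simp [hξ0])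
        (hξb.prodMk (hasDerivAt_mul_const b)))
    have hh : ContDiff ℝ ∞ fun t : ℝ => H (t * b, t) 1 1 := hB.comp (f := fun t : ℝ => (t * b, t))
      (by fun_prop)
    have hc : ContDiff ℝ ∞ fun t : ℝ => f (lift Z (ξ (t * b), t * b)) :=
      hg.comp (f := fun t : ℝ => (ξ (t * b), t * b)) (by fun_prop)
    have ht : Tendsto (fun t : ℝ => t * b) (𝓝 0) (𝓝 0) := by
      have h : Continuous fun t : ℝ => t * b := by fun_prop
      simpa using h.tendsto 0
    have he : (fun t => f (lift Z (ξ (t * b) + t, t * b))) =ᶠ[𝓝 0]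
        fun t => f (lift Z (ξ (t * b), t * b)) + t ^ 2 * H (t * b, t) 1 1 := by
      filter_upwards [ht.eventually hsplit] with t h
      exact h t
    have hp : ContDiff ℝ ∞ fun t : ℝ => t ^ 2 * H (t * b, t) 1 1 := (contDiff_id.pow 2).mul hh
    have e : ∀ j, iteratedDeriv j (fun t => f (lift Z (ξ (t * b) + t, t * b))) 0 =
        iteratedDeriv j (fun t => f (lift Z (ξ (t * b), t * b))) 0 +
          iteratedDeriv j (fun t => t ^ 2 * H (t * b, t) 1 1) 0 := fun j => by
      rw [he.iteratedDeriv_eq, iteratedDeriv_fun_add (contDiff_infty.1 hc j).contDiffAt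
        (contDiff_infty.1 hp j).contDiffAt]
    have e2 := e 2
    have e3 := e 3
    have p0 := iteratedDeriv_pow_mul hh 2 0
    have p1 := iteratedDeriv_pow_mul hh 2 1
    rw [c1.2.1, c2.2.1, p0] at e2
    rw [c1.2.2, c2.2.2, p1] at e3
    have hd : HasDerivAt (fun t : ℝ => H (t * b, t) 1 1)
        (fderiv ℝ (fun q => H q 1 1) 0 (b, 1)) 0 := by
      have h1 : HasFDerivAt (fun q => H q 1 1) (fderiv ℝ (fun q => H q 1 1) 0) (0 * b, 0) := by
        rw [zero_mul]; exact (hB.differentiable (by simp) _).hasFDerivAt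
      exact h1.comp_hasDerivAt (f := fun t : ℝ => (t * b, t)) (0 : ℝ)
        ((hasDerivAt_mul_const b).prodMk (hasDerivAt_id _))
    rw [iteratedDeriv_one, hd.deriv] at e3
    norm_num [Nat.choose, Nat.factorial] at e2 e3
    exact ⟨e2, by linarith⟩
  refine ⟨fun q => H q 1 1, hB, (key 0).1, ?_, hsplit⟩
  refine (hB.differentiable (by simp) 0).hasFDerivAt.congr_fderiv ?_
  have k0 := (key 0).2
  have k1 := (key 1).2
  have k2 : fderiv ℝ (fun q => H q 1 1) 0 (1, 1) = fderiv ℝ (fun q => H q 1 1) 0 (1, 0) +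
      fderiv ℝ (fun q => H q 1 1) 0 (0, 1) := by
    rw [← map_add]; simp
  ext
  · change fderiv ℝ (fun q => H q 1 1) 0 (1, 0) = (1 / 2 : ℝ) • (1 : ℝ)
    rw [smul_eq_mul]; linarith
  · change fderiv ℝ (fun q => H q 1 1) 0 (0, 1) = (1 / 2 : ℝ) • (0 : ℝ)
    rw [smul_eq_mul]; linarith

/-- The splitting lemma: near the origin `f` is the sum of its restriction to the graph of the
`z`-critical points and of a nondegenerate quadratic form of new variables replacing `z`. -/
theorem IsCorankTwo.exists_splitting (hf : IsCorankTwo f) (hZ : ContDiff ℝ ∞ Z) (hZ0 : Z 0 = 0)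
    (hZc : ∀ᶠ p in 𝓝 0, ∀ u, fderiv ℝ f (lift Z p) (incl u) = 0) :
    ∃ (T : (Fin n → ℝ) →L[ℝ] (Fin n → ℝ) →L[ℝ] ℝ)
      (S : (ℝ × ℝ) × (Fin n → ℝ) → (Fin n → ℝ) →L[ℝ] (Fin n → ℝ)),
      (∀ u v, T u v = T v u) ∧ (∀ u, T u = 0 → u = 0) ∧ ContDiff ℝ ∞ S ∧ S 0 = 1 ∧
      ∀ᶠ q in 𝓝 (0 : (ℝ × ℝ) × (Fin n → ℝ)),
        f (glue (q.1, Z q.1 + q.2)) = f (lift Z q.1) + T (S q q.2) (S q q.2) := by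
  let F : (ℝ × ℝ) × (Fin n → ℝ) → ℝ := fun q => f (glue (q.1, Z q.1 + q.2))
  have hF : ContDiff ℝ ∞ F := hf.smooth.comp (glue.contDiff.comp (by fun_prop))
  obtain ⟨H, hH, hHs, hH1, hH2⟩ := exists_hadamard_two hF
  have hsplit : ∀ᶠ p in 𝓝 (0 : ℝ × ℝ), ∀ w, F (p, w) = f (lift Z p) + H (p, w) w w := by
    filter_upwards [hZc] with p hp w
    have h1 : HasFDerivAt (fun w : Fin n → ℝ => F (p, w))
        ((fderiv ℝ F (p, 0)).comp (ContinuousLinearMap.inr ℝ _ _)) 0 :=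
      (hF.differentiable (by simp) (p, 0)).hasFDerivAt.comp (0 : Fin n → ℝ)
        (hasFDerivAt_prodMk_right _ _)
    have h2 : HasFDerivAt (fun w : Fin n → ℝ => F (p, w))
        ((fderiv ℝ f (lift Z p)).comp inclL) 0 := by
      have h3 : HasFDerivAt (fun w : Fin n → ℝ => glue (p, Z p + w)) inclL 0 := by
        have h4 : (fun w : Fin n → ℝ => glue (p, Z p + w)) = fun w => lift Z p + inclL w := by
          funext w
          rw [lift, inclL_apply, glue_apply, glue_apply, incl_add, add_assoc, add_assoc, add_assoc]
        rw [h4]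
        exact inclL.hasFDerivAt.const_add _
      have h5 : HasFDerivAt f (fderiv ℝ f (lift Z p)) (glue (p, Z p + 0)) := by
        rw [add_zero]; exact (hf.smooth.differentiable (by simp) _).hasFDerivAt
      exact h5.comp (f := fun w => glue (p, Z p + w)) 0 h3
    have h6 : fderiv ℝ F (p, 0) (0, w) = 0 := by
      have := congrArg (fun A : (Fin n → ℝ) →L[ℝ] ℝ => A w) (h1.unique h2)
      exact this.trans (hp w)
    rw [hH1, h6, add_zero]
    simp only [F, add_zero]
    rfl
  have hquad : ∀ w, 2 * H (0, 0) w w = symD f {incl w, incl w} 0 := fun w => by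
    rw [hH2 0 w]
    have h0 : (fun t : ℝ => t • incl w) 0 = (0 : Fin (n + 2) → ℝ) := zero_smul _ _
    have hγ : ContDiff ℝ ∞ fun t : ℝ => t • incl w := contDiff_id.smul contDiff_const
    have h1 : (fun t : ℝ => F (0, t • w)) = fun t => symD f 0 (t • incl w) := by
      funext t
      simp only [F, symD_zero, hZ0, zero_add]
      rw [show (0 : ℝ × ℝ) = ((0 : ℝ), (0 : ℝ)) from rfl, glue_apply, incl_smul]
      simp
    have h2 : jet (fun t : ℝ => t • incl w) 1 = incl w :=
      jet_one_eq (by simpa using (hasDerivAt_id (0 : ℝ)).smul_const (incl w))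
    rw [h1]
    change along f (fun t : ℝ => t • incl w) 2 0 = _
    rw [along_two hf.smooth hγ h0, h2, Multiset.cons_zero (jet _ 2), hf.symD_single,
      add_zero]
    rfl
  have hbil : ∀ u v, 2 * H (0, 0) u v = symD f {incl u, incl v} 0 := fun u v => by
    have h1 := hquad (u + v)
    have h2 : ∀ s, symD f ((incl u + incl v) ::ₘ s) 0 =
        symD f (incl u ::ₘ s) 0 + symD f (incl v ::ₘ s) 0 := fun s =>
      symD_cons_add hf.smooth _ _ s _
    have h3 := hquad u
    have h4 := hquad v
    have h5 := hHs (0, 0) u v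
    rw [incl_add] at h1
    simp only [Multiset.insert_eq_cons, ← Multiset.cons_zero] at h1 h3 h4 ⊢
    rw [h2, Multiset.cons_swap (incl u) (incl u + incl v), h2,
      Multiset.cons_swap (incl v) (incl u + incl v), h2, ← h3, ← h4,
      Multiset.cons_swap (incl v) (incl u)] at h1
    have h6 : ∀ A : (Fin n → ℝ) →L[ℝ] (Fin n → ℝ) →L[ℝ] ℝ,
        A (u + v) (u + v) = A u u + A u v + (A v u + A v v) := fun A => by
      rw [map_add, map_add, add_apply, add_apply]; ring
    rw [h6] at h1
    linarith
  have hinj : ∀ u, H (0, 0) u = 0 → u = 0 := fun u hu => hf.eq_zero_of_hess fun v => by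
    rw [← hbil, hu]; simp
  obtain ⟨S, hS, hS0, hS1⟩ := exists_smooth_diagonalization hH hHs (0, 0) hinj
  refine ⟨H (0, 0), S, hHs _, hinj, hS, hS0, ?_⟩
  have ht : Tendsto (fun q : (ℝ × ℝ) × (Fin n → ℝ) => q.1) (𝓝 0) (𝓝 0) := continuous_fst.tendsto 0
  filter_upwards [hS1, ht.eventually hsplit] with q h1 h2
  rw [← h1]
  exact h2 q.2

/-! ### The plane normal form -/

/-- The plane normal form, when the function on the critical curve `x = 0` is already a power.
With `Y = a + x² κ(x)` the function `c aᵐ + x² B(a, x)` differs from `c Yᵐ` by `x² N(Y, x)`; the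
function `κ` is chosen such that `N` vanishes for `Y = 0`, so that `N = Y V`, and `X = x √V`. -/
theorem exists_plane_normalForm_of_pow {m : ℕ} (hm : 3 ≤ m) (c : ℝ) {b : ℝ} (hb : 0 < b)
    {B : ℝ × ℝ → ℝ} (hB : ContDiff ℝ ∞ B) (hB0 : B 0 = 0)
    (hB1 : HasFDerivAt B (b • ContinuousLinearMap.fst ℝ ℝ ℝ) 0) :
    ∃ X Y : ℝ × ℝ → ℝ, ContDiff ℝ ∞ X ∧ ContDiff ℝ ∞ Y ∧ X 0 = 0 ∧ Y 0 = 0 ∧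
      HasFDerivAt X (√b • ContinuousLinearMap.snd ℝ ℝ ℝ) 0 ∧
      HasFDerivAt Y (ContinuousLinearMap.fst ℝ ℝ ℝ) 0 ∧
      ∀ᶠ q in 𝓝 (0 : ℝ × ℝ), c * q.1 ^ m + q.2 ^ 2 * B q = X q ^ 2 * Y q + c * Y q ^ m := by
  obtain ⟨m, rfl⟩ : ∃ k, m = k + 3 := ⟨m - 3, by omega⟩
  have hBx : HasDerivAt (fun x => B (0, x)) 0 0 := by
    have h1 : HasDerivAt (fun x : ℝ => ((0 : ℝ), x)) (0, 1) 0 :=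
      (hasDerivAt_const _ _).prodMk (hasDerivAt_id _)
    exact (HasFDerivAt.comp_hasDerivAt (f := fun x : ℝ => ((0 : ℝ), x)) (0 : ℝ) hB1 h1).congr_deriv
      (by simp)
  have hBa : HasDerivAt (fun a => B (a, 0)) b 0 := by
    have h1 : HasDerivAt (fun a : ℝ => (a, (0 : ℝ))) (1, 0) 0 :=
      (hasDerivAt_id _).prodMk (hasDerivAt_const _ _)
    exact (HasFDerivAt.comp_hasDerivAt (f := fun a : ℝ => (a, (0 : ℝ))) (0 : ℝ) hB1 h1).congr_deriv
      (by simp)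
  obtain ⟨b₃, hb₃, hb₃1, hb₃2⟩ := exists_hadamard_real (F := fun q : ℝ × ℝ => B (q.2, q.1))
    (hB.comp (by fun_prop))
  obtain ⟨b₂, hb₂, hb₂1, -⟩ := exists_eq_pow_mul 2 (φ := fun x => B (0, x)) (hB.comp (by fun_prop))
    fun j hj => by
      interval_cases j
      · exact hB0
      · rw [iteratedDeriv_one, hBx.deriv]
  have hb₃0 : b₃ (0, 0) = b := (hb₃2 0).trans hBa.deriv
  have hBsplit : ∀ a x, B (a, x) = x ^ 2 * b₂ x + a * b₃ (x, a) := fun a x => by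
    rw [← hb₂1]; exact hb₃1 x a
  -- `κ` solves `M(x, κ) = 0`, where `x² M(x, κ)` is the value of `N` for `Y = 0`
  let M : ℝ × ℝ → ℝ := fun q => b₂ q.1 - q.2 * b₃ (q.1, -(q.1 ^ 2 * q.2)) -
    c * q.2 * (-q.2) ^ (m + 2) * q.1 ^ (2 * (m + 1))
  have hM : ContDiff ℝ ∞ M := by
    refine ((hb₂.comp contDiff_fst).sub (contDiff_snd.mul (hb₃.comp (by fun_prop)))).sub ?_
    fun_prop
  have hM0 : ∀ κ, M (0, κ) = b₂ 0 - κ * b := fun κ => by simp [M, hb₃0]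
  obtain ⟨κ, hκ, -, hκ1⟩ := exists_smooth_implicit hM (p := 0) (w := b₂ 0 / b)
    (by rw [hM0, div_mul_cancel₀ _ hb.ne', sub_self])
    (ContinuousLinearEquiv.unitsEquivAut ℝ (Units.mk0 (-b) (neg_ne_zero.2 hb.ne'))) (by
      have h1 : HasDerivAt (fun κ => M (0, κ)) (fderiv ℝ M (0, b₂ 0 / b) (0, 1)) (b₂ 0 / b) :=
        (hM.differentiable (by simp) (0, b₂ 0 / b)).hasFDerivAt.comp_hasDerivAt _
          ((hasDerivAt_const _ _).prodMk (hasDerivAt_id _))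
      simp only [hM0] at h1
      have h2 := h1.unique ((hasDerivAt_mul_const b).const_sub (b₂ 0))
      ext
      simpa using h2)
  -- `R(Y, h) = (Yᵐ - (Y - h)ᵐ) / h`
  let R : ℝ → ℝ → ℝ := fun Y h => ∑ i ∈ Finset.range (m + 3), Y ^ i * (Y - h) ^ (m + 3 - 1 - i)
  have hR : ∀ Y h, R Y h * h = Y ^ (m + 3) - (Y - h) ^ (m + 3) := fun Y h => by
    have := (Commute.all Y (Y - h)).geom_sum₂_mul (m + 3)
    rwa [sub_sub_cancel] at this
  have hR0 : ∀ h, R 0 h = (-h) ^ (m + 2) := fun h => by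
    simp only [R]
    rw [Finset.sum_range_succ', Finset.sum_eq_zero fun i _ => by simp]
    simp
  have hR1 : ∀ Y, R Y 0 = (m + 3 : ℕ) * Y ^ (m + 2) := fun Y => by
    have : ∀ i ∈ Finset.range (m + 3), Y ^ i * (Y - 0) ^ (m + 3 - 1 - i) = Y ^ (m + 2) :=
      fun i hi => by
        rw [sub_zero, ← pow_add]
        congr 1
        have := Finset.mem_range.1 hi
        omega
    simp only [R]
    rw [Finset.sum_congr rfl this]
    simp
  let N : ℝ × ℝ → ℝ := fun q => B (q.2 - q.1 ^ 2 * κ q.1, q.1) - c * κ q.1 * R q.2 (q.1 ^ 2 * κ q.1)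
  have hN : ContDiff ℝ ∞ N := by
    refine (hB.comp (by fun_prop)).sub ((contDiff_const.mul (hκ.comp contDiff_fst)).mul ?_)
    exact ContDiff.sum fun i _ => by fun_prop
  obtain ⟨V, hV, hV1, hV2⟩ := exists_hadamard_real hN
  have hN0 : ∀ᶠ x in 𝓝 (0 : ℝ), N (x, 0) = 0 := by
    filter_upwards [hκ1] with x hx
    simp only [N, zero_sub, hR0, hBsplit]
    have : x ^ 2 * M (x, κ x) = 0 := by rw [hx, mul_zero]
    rw [← this]
    simp only [M]
    ring
  have hV0 : V (0, 0) = b := by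
    rw [hV2]
    have h1 : (fun s => N (0, s)) = fun s => B (s, 0) - c * κ 0 * ((m + 3 : ℕ) * s ^ (m + 2)) := by
      funext s
      simp only [N]
      norm_num
      exact Or.inl (by simpa using hR1 s)
    have h2 := hBa.sub (((hasDerivAt_pow (m + 2) (0 : ℝ)).const_mul ((m + 3 : ℕ) : ℝ)).const_mul
      (c * κ 0))
    rw [h1]
    refine h2.deriv.trans ?_
    simp
  let Y : ℝ × ℝ → ℝ := fun q => q.1 + q.2 ^ 2 * κ q.2
  have hY : ContDiff ℝ ∞ Y := by fun_prop
  have hVY : ContDiff ℝ ∞ fun q : ℝ × ℝ => V (q.2, Y q) := hV.comp (by fun_prop)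
  have hY0 : Y 0 = 0 := by simp [Y]
  have hVY0 : V ((0 : ℝ × ℝ).2, Y 0) = b := by rw [hY0]; exact hV0
  have hpos : ∀ᶠ q in 𝓝 (0 : ℝ × ℝ), 0 < V (q.2, Y q) :=
    hVY.continuous.continuousAt.eventually (lt_mem_nhds (hb.trans_eq hVY0.symm))
  obtain ⟨s, hs, hs'⟩ := exists_contDiff_eventuallyEq (F := fun q : ℝ × ℝ => √(V (q.2, Y q)))
    (a := 0) (hpos.mono fun q hq => hVY.contDiffAt.sqrt hq.ne')
  have hs0 : s 0 = √b := hs'.self_of_nhds.trans (congrArg Real.sqrt hVY0)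
  refine ⟨fun q => q.2 * s q, Y, contDiff_snd.mul hs, hY, by simp, hY0, ?_, ?_, ?_⟩
  · have h1 := (hasFDerivAt_snd (𝕜 := ℝ) (p := (0 : ℝ × ℝ))).mul
      (hs.differentiable (by simp) 0).hasFDerivAt
    refine h1.congr_fderiv ?_
    ext <;> simp [hs0]
  · have h1 := (hasFDerivAt_fst (𝕜 := ℝ) (p := (0 : ℝ × ℝ))).add
      (((hasFDerivAt_snd (𝕜 := ℝ) (p := (0 : ℝ × ℝ))).pow 2).mul
        (((hκ.differentiable (by simp) _).hasFDerivAt).comp (0 : ℝ × ℝ) hasFDerivAt_snd))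
    refine h1.congr_fderiv ?_
    ext <;> simp
  · have ht : Tendsto (fun q : ℝ × ℝ => q.2) (𝓝 0) (𝓝 0) := continuous_snd.tendsto 0
    filter_upwards [hpos, hs', ht.eventually hN0] with q h1 h2 h3
    obtain ⟨a, x⟩ := q
    have h4 := hV1 x (Y (a, x))
    rw [h3, zero_add] at h4
    have h5 := hR (Y (a, x)) (x ^ 2 * κ x)
    have h6 : Y (a, x) - x ^ 2 * κ x = a := by simp [Y]
    simp only [N, h6] at h4
    rw [h6] at h5
    rw [h2, mul_pow, Real.sq_sqrt h1.le]
    dsimp only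
    linear_combination x ^ 2 * h4 + c * h5

/-- The plane normal form: a function `yᵐ ψ(y) + x² B(y, x)` with `ψ(0) = c ≠ 0` and
`B = b y + …`, `b > 0`, is `X² Y + c Yᵐ` in suitable coordinates. -/
theorem exists_plane_normalForm {m : ℕ} (hm : 3 ≤ m) {c : ℝ} (hc : c ≠ 0) {ψ : ℝ → ℝ}
    (hψ : ContDiff ℝ ∞ ψ) (hψ0 : ψ 0 = c) {b : ℝ} (hb : 0 < b)
    {B : ℝ × ℝ → ℝ} (hB : ContDiff ℝ ∞ B) (hB0 : B 0 = 0)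
    (hB1 : HasFDerivAt B (b • ContinuousLinearMap.fst ℝ ℝ ℝ) 0) :
    ∃ X Y : ℝ × ℝ → ℝ, ContDiff ℝ ∞ X ∧ ContDiff ℝ ∞ Y ∧ X 0 = 0 ∧ Y 0 = 0 ∧
      HasFDerivAt X (√b • ContinuousLinearMap.snd ℝ ℝ ℝ) 0 ∧
      HasFDerivAt Y (ContinuousLinearMap.fst ℝ ℝ ℝ) 0 ∧
      ∀ᶠ q in 𝓝 (0 : ℝ × ℝ),
        q.1 ^ m * ψ q.1 + q.2 ^ 2 * B q = X q ^ 2 * Y q + c * Y q ^ m := by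
  -- the coordinate `α = y (ψ / c)^(1/m)` turns `yᵐ ψ(y)` into `c αᵐ`
  have hpos : ∀ᶠ y in 𝓝 (0 : ℝ), 0 < ψ y / c := by
    have h : Continuous fun y => ψ y / c := hψ.continuous.div_const c
    exact h.continuousAt.eventually (lt_mem_nhds (by
      dsimp only; rw [hψ0, div_self hc]; exact one_pos))
  obtain ⟨r, hr, hr'⟩ := exists_contDiff_eventuallyEq (F := fun y => (ψ y / c) ^ (1 / m : ℝ))
    (a := 0) (hpos.mono fun y hy => (hψ.contDiffAt.div_const c).rpow_const_of_ne hy.ne')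
  have hr0 : r 0 = 1 := by
    rw [hr'.self_of_nhds]; dsimp only; rw [hψ0, div_self hc, Real.one_rpow]
  let α : ℝ → ℝ := fun y => y * r y
  have hα : ContDiff ℝ ∞ α := contDiff_id.mul hr
  have hα0 : α 0 = 0 := by simp [α]
  have hα1 : HasDerivAt α 1 0 := by
    have := (hasDerivAt_id (0 : ℝ)).mul (hr.differentiable (by simp) 0).hasDerivAt
    simp only [hr0, id, mul_one, zero_mul, add_zero] at this
    exact this
  obtain ⟨β, hβ, hβ0, hβ1, hβ2⟩ := exists_smooth_localInverse
    (Eventually.of_forall fun y => hα.contDiffAt) (ContinuousLinearEquiv.refl ℝ ℝ)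
    (a := 0) (by
      refine hα1.hasFDerivAt.congr_fderiv ?_
      ext; simp)
  rw [hα0] at hβ hβ0 hβ1
  obtain ⟨β', hβ', hββ'⟩ := exists_contDiff_eventuallyEq hβ
  have hβ'0 : β' 0 = 0 := by rw [hββ'.self_of_nhds, hβ0]
  have htα : Tendsto α (𝓝 0) (𝓝 0) := by simpa only [hα0] using hα.continuous.tendsto 0
  have hβα : ∀ᶠ y in 𝓝 0, β' (α y) = y := by
    filter_upwards [htα.eventually hββ', hβ2] with y h1 h2
    rw [h1, h2]
  have hβ'1 : HasDerivAt β' 1 0 := by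
    have h1 : HasDerivAt β' (deriv β' 0) (α 0) := by
      rw [hα0]; exact (hβ'.differentiable (by simp) 0).hasDerivAt
    have h2 := h1.comp (0 : ℝ) hα1
    have h3 := h2.unique ((hasDerivAt_id (0 : ℝ)).congr_of_eventuallyEq hβα)
    have h4 := (hβ'.differentiable (by simp) 0).hasDerivAt
    rwa [← mul_one (deriv β' 0), h3] at h4
  have hg : HasFDerivAt (fun q : ℝ × ℝ => (β' q.1, q.2)) (ContinuousLinearMap.id ℝ (ℝ × ℝ)) 0 := by
    have h1 : HasFDerivAt (fun q : ℝ × ℝ => β' q.1) _ 0 :=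
      HasFDerivAt.comp (f := Prod.fst) (0 : ℝ × ℝ) hβ'1.hasFDerivAt hasFDerivAt_fst
    refine (h1.prodMk hasFDerivAt_snd).congr_fderiv ?_
    ext <;> simp
  have hg0 : ((β' (0 : ℝ × ℝ).1, (0 : ℝ × ℝ).2) : ℝ × ℝ) = 0 := by simp [hβ'0]
  obtain ⟨X, Y, hX, hY, hX0, hY0, hX1, hY1, h⟩ := exists_plane_normalForm_of_pow hm c hb
    (B := fun q => B (β' q.1, q.2)) (hB.comp (by fun_prop)) (by simpa only [hg0] using hB0) (by
      have h1 : HasFDerivAt B (b • ContinuousLinearMap.fst ℝ ℝ ℝ)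
        (β' (0 : ℝ × ℝ).1, (0 : ℝ × ℝ).2) := by rwa [hg0]
      exact h1.comp (f := fun q : ℝ × ℝ => (β' q.1, q.2)) 0 hg)
  have hk : HasFDerivAt (fun q : ℝ × ℝ => (α q.1, q.2)) (ContinuousLinearMap.id ℝ (ℝ × ℝ)) 0 := by
    have h1 : HasFDerivAt (fun q : ℝ × ℝ => α q.1) _ 0 :=
      HasFDerivAt.comp (f := Prod.fst) (0 : ℝ × ℝ) hα1.hasFDerivAt hasFDerivAt_fst
    refine (h1.prodMk hasFDerivAt_snd).congr_fderiv ?_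
    ext <;> simp
  have hk0 : ((α (0 : ℝ × ℝ).1, (0 : ℝ × ℝ).2) : ℝ × ℝ) = 0 := by simp [hα0]
  refine ⟨fun q => X (α q.1, q.2), fun q => Y (α q.1, q.2), hX.comp (by fun_prop),
    hY.comp (by fun_prop), by simpa only [hk0], by simpa only [hk0], ?_, ?_, ?_⟩
  · have h1 : HasFDerivAt X (√b • ContinuousLinearMap.snd ℝ ℝ ℝ)
      (α (0 : ℝ × ℝ).1, (0 : ℝ × ℝ).2) := by rwa [hk0]
    exact h1.comp (f := fun q : ℝ × ℝ => (α q.1, q.2)) 0 hk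
  · have h1 : HasFDerivAt Y (ContinuousLinearMap.fst ℝ ℝ ℝ)
      (α (0 : ℝ × ℝ).1, (0 : ℝ × ℝ).2) := by rwa [hk0]
    exact h1.comp (f := fun q : ℝ × ℝ => (α q.1, q.2)) 0 hk
  · have ht : Tendsto (fun q : ℝ × ℝ => q.1) (𝓝 0) (𝓝 0) := continuous_fst.tendsto 0
    have htk : Tendsto (fun q : ℝ × ℝ => (α q.1, q.2)) (𝓝 0) (𝓝 0) := by
      simpa only [hk0] using hk.continuousAt.tendsto
    filter_upwards [htk.eventually h, ht.eventually hβα, ht.eventually hr', ht.eventually hpos]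
      with q h1 h2 h3 h4
    rw [← h1, h2]
    simp only [α, mul_pow, h3]
    rw [← Real.rpow_natCast ((ψ q.1 / c) ^ (1 / m : ℝ)), ← Real.rpow_mul h4.le,
      one_div_mul_cancel (by positivity), Real.rpow_one]
    field_simp

/-! ### Reduction to the normal form -/

variable {n : ℕ} {f : (Fin (n + 2) → ℝ) → ℝ}

/-- The projection to the `(x, y)`-plane. -/
noncomputable def planeL : (Fin (n + 2) → ℝ) →L[ℝ] ℝ × ℝ :=
  (ContinuousLinearMap.proj 0).prod (ContinuousLinearMap.proj 1)

/-- The projection to the space of the variables `z`. -/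
noncomputable def zL : (Fin (n + 2) → ℝ) →L[ℝ] (Fin n → ℝ) :=
  ContinuousLinearMap.pi fun j => ContinuousLinearMap.proj (zi j)

theorem glue_planeL_zL (k : Fin (n + 2) → ℝ) : glue (planeL k, zL k) = k := glue_coords k

theorem nondegenerate_polarBilin {T : (Fin n → ℝ) →L[ℝ] (Fin n → ℝ) →L[ℝ] ℝ}
    (hs : ∀ u v, T u v = T v u) (hT : ∀ u, T u = 0 → u = 0) :
    ∃ Q : QuadraticForm ℝ (Fin n → ℝ), (QuadraticMap.polarBilin Q).Nondegenerate ∧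
      ∀ w, Q w = T w w := by
  let T' : LinearMap.BilinMap ℝ (Fin n → ℝ) ℝ :=
    ContinuousLinearMap.coeLM ℝ ∘ₗ (T : (Fin n → ℝ) →ₗ[ℝ] (Fin n → ℝ) →L[ℝ] ℝ)
  have hT' : ∀ u v, QuadraticMap.polarBilin T'.toQuadraticMap u v = 2 * T u v := fun u v => by
    have : QuadraticMap.polarBilin T'.toQuadraticMap u v = T u v + T v u := by
      rw [QuadraticMap.polarBilin_apply_apply, LinearMap.BilinMap.polar_toQuadraticMap]; rfl
    rw [this, hs v u]; ring
  have hinj : ∀ u, (∀ v, QuadraticMap.polarBilin T'.toQuadraticMap u v = 0) → u = 0 := by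
    intro u hu
    refine hT u (ContinuousLinearMap.ext fun v => ?_)
    have := hu v
    rw [hT'] at this
    simpa using this
  refine ⟨T'.toQuadraticMap, ⟨fun u hu => hinj u hu, fun u hu => hinj u fun v => ?_⟩, fun w => rfl⟩
  rw [hT', hs, ← hT']
  exact hu v

/-- There is a critical curve such that the order and the leading coefficient of the variation of
`f` along it determine the normal form. -/
theorem IsCubicNormalized.exists_isCritCurve_reducesTo (hN : IsCubicNormalized f)
    (hf : IsCorankTwo f) : ∃ γ : ℝ → Fin (n + 2) → ℝ, IsCritCurve f γ ∧
      ∀ (m : ℕ) (c : ℝ), 3 ≤ m → c ≠ 0 →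
        (∀ j, 0 < j → j < m → iteratedDeriv j (fun t => f (γ t)) 0 = 0) →
        iteratedDeriv m (fun t => f (γ t)) 0 = m.factorial * c → ReducesTo (m + 1) c f := by
  obtain ⟨Z, hZ, hZ0, hZ1, hZc⟩ := hf.exists_critical_graph
  obtain ⟨ξ, hξ, hξ1, hξ0, hγ⟩ := hN.exists_isCritCurve hf hZ hZ0 hZ1 hZc
  obtain ⟨B, hB, hB0, hB1, hB2⟩ :=
    hN.exists_quadratic_factor hf hZ hZ0 hZ1 hξ hξ1 hξ0 hZc hγ
  obtain ⟨T, S, hTs, hT, hS, hS0, hS1⟩ := hf.exists_splitting hZ hZ0 hZc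
  refine ⟨_, hγ, fun m c hm hc h0 h1 => ?_⟩
  obtain ⟨ψ, hψ, hψ1, hψ2⟩ := exists_eq_pow_mul m
    (φ := fun t => -f 0 + f (lift Z (ξ t, t)))
    (contDiff_const.add (hf.smooth.comp hγ.smooth)) fun j hj => by
      rcases Nat.eq_zero_or_pos j with rfl | hj0
      · rw [iteratedDeriv_zero, hξ0, lift_zero hZ0, neg_add_cancel]
      · rw [iteratedDeriv_const_add hj0, h0 j hj0 hj]
  rw [iteratedDeriv_const_add (by omega), h1] at hψ2
  have hψ0 : ψ 0 = c := (mul_left_cancel₀ (by positivity) hψ2).symm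
  obtain ⟨X, Y, hX, hY, hX0, hY0, hX1, hY1, hXY⟩ :=
    exists_plane_normalForm hm hc hψ hψ0 one_half_pos hB hB0 hB1
  obtain ⟨Q, hQ, hQT⟩ := nondegenerate_polarBilin hTs hT
  -- the new coordinates are `X`, `Y` at the point `r k` of the plane, measured from the critical
  -- curve, and `S (z - Z)`
  let r : (Fin (n + 2) → ℝ) → ℝ × ℝ := fun k => (k 1, k 0 - ξ (k 1))
  let w : (Fin (n + 2) → ℝ) → Fin n → ℝ := fun k => zL k - Z (planeL k)
  have hr : ContDiff ℝ ∞ r := by fun_prop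
  have hw : ContDiff ℝ ∞ w := zL.contDiff.sub (hZ.comp planeL.contDiff)
  have hr0 : r 0 = 0 := by simp [r, hξ0]
  have hw0 : w 0 = 0 := by simp [w, hZ0]
  let q : (Fin (n + 2) → ℝ) → (ℝ × ℝ) × (Fin n → ℝ) := fun k => (planeL k, w k)
  have hq : ContDiff ℝ ∞ q := planeL.contDiff.prodMk hw
  have hq0 : q 0 = 0 := by simp [q, hw0]
  let Φ : (Fin (n + 2) → ℝ) → Fin (n + 2) → ℝ := fun k =>
    glue ((X (r k), Y (r k)), S (q k) (w k))
  have hΦ : ContDiff ℝ ∞ Φ := glue.contDiff.comp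
    (((hX.comp hr).prodMk (hY.comp hr)).prodMk ((hS.comp hq).clm_apply hw))
  let pr : Fin (n + 2) → (Fin (n + 2) → ℝ) →L[ℝ] ℝ := fun i => ContinuousLinearMap.proj i
  have hr1 : HasFDerivAt r ((pr 1).prod (pr 0)) 0 := by
    have h1 : HasFDerivAt (fun k : Fin (n + 2) → ℝ => k 1) (pr 1) 0 := hasFDerivAt_apply 1 0
    have h2 : HasFDerivAt (fun k : Fin (n + 2) → ℝ => k 0) (pr 0) 0 := hasFDerivAt_apply 0 0
    have h3 : HasFDerivAt (fun k : Fin (n + 2) → ℝ => ξ (k 1)) _ 0 :=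
      HasFDerivAt.comp (f := fun k : Fin (n + 2) → ℝ => k 1) (0 : Fin (n + 2) → ℝ)
        hξ1.hasFDerivAt h1
    refine (h1.prodMk (h2.sub h3)).congr_fderiv ?_
    refine ContinuousLinearMap.ext fun v => ?_
    simp
  have hw1 : HasFDerivAt w zL 0 := by
    have h1 : HasFDerivAt Z (fderiv ℝ Z 0) (planeL (0 : Fin (n + 2) → ℝ)) := by
      rw [map_zero]; exact (hZ.differentiable (by simp) 0).hasFDerivAt
    refine (zL.hasFDerivAt.sub (h1.comp 0 planeL.hasFDerivAt)).congr_fderiv ?_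
    rw [hZ1]
    simp
  have hX1' : HasFDerivAt X (√(1 / 2) • ContinuousLinearMap.snd ℝ ℝ ℝ) (r 0) := by rwa [hr0]
  have hY1' : HasFDerivAt Y (ContinuousLinearMap.fst ℝ ℝ ℝ) (r 0) := by rwa [hr0]
  have hΦ1 : HasFDerivAt Φ _ 0 := glue.hasFDerivAt.comp 0
    (((hX1'.comp 0 hr1).prodMk (hY1'.comp 0 hr1)).prodMk
      (((hS.comp hq).differentiable (by simp) 0).hasFDerivAt.clm_apply hw1))
  have hΦ2 : ∀ v, fderiv ℝ Φ 0 v = glue ((√(1 / 2) * v 0, v 1), zL v) := fun v => by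
    rw [hΦ1.fderiv]
    refine congrArg glue (Prod.ext (Prod.ext rfl rfl) ?_)
    change S (q 0) (zL v) + (fderiv ℝ (S ∘ q) 0 v) (w 0) = zL v
    rw [hw0, map_zero, add_zero, hq0, hS0, one_apply_eq_self]
  have hinj : Function.Injective (fderiv ℝ Φ 0) := by
    refine (injective_iff_map_eq_zero _).2 fun v hv => ?_
    rw [hΦ2] at hv
    have e0 := congrFun hv 0
    have e1 := congrFun hv 1
    have e2 := fun j => congrFun hv (zi j)
    simp only [glue_zero, glue_one, glue_zi, Pi.zero_apply] at e0 e1 e2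
    have e0' : v 0 = 0 := (mul_eq_zero.1 e0).resolve_left (by positivity)
    funext i
    rcases eq_zero_or_one_or_zi i with rfl | rfl | ⟨j, rfl⟩
    exacts [e0', e1, e2 j]
  have htr : Tendsto r (𝓝 0) (𝓝 0) := by simpa only [hr0] using hr.continuous.tendsto 0
  have htq : Tendsto q (𝓝 0) (𝓝 0) := by simpa only [hq0] using hq.continuous.tendsto 0
  have ht1 : Tendsto (fun k : Fin (n + 2) → ℝ => k 1) (𝓝 0) (𝓝 0) :=
    (continuous_apply 1).tendsto 0
  refine ⟨Φ, ⟨?_, ⟨univ, univ_mem, hΦ.contDiffOn⟩, hinj,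
    LinearMap.injective_iff_surjective.1 hinj⟩, f 0, Q, hQ, ?_⟩
  · simp only [Φ, hr0, hX0, hY0, hw0, map_zero]
    exact map_zero glue
  · filter_upwards [htr.eventually hXY, htq.eventually hS1, ht1.eventually hB2] with k h1 h2 h3
    have e1 : f k = f (lift Z (planeL k)) + T (S (q k) (w k)) (S (q k) (w k)) := by
      rw [← h2]
      simp only [q, w, add_sub_cancel, glue_planeL_zL]
    have e2 := h3 (k 0 - ξ (k 1))
    rw [add_sub_cancel] at e2
    have e3 : planeL k = (k 0, k 1) := rfl
    have e4 := hψ1 (k 1)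
    have e5 : (fun j => Φ k (zi j)) = S (q k) (w k) := funext fun j => glue_zi _ j
    rw [e1, e3, e2, e5, hQT, show Φ k 0 = X (r k) from glue_zero _,
      show Φ k 1 = Y (r k) from glue_one _, Nat.add_sub_cancel]
    simp only [r] at h1 ⊢
    linarith

/-! ### Scaling of the normal form -/

variable {n : ℕ} {f : (Fin (n + 2) → ℝ) → ℝ}

theorem IsRegularChange.eventually_contDiffAt {m : ℕ} {φ : (Fin m → ℝ) → Fin m → ℝ}
    (hφ : IsRegularChange φ) : ∀ᶠ k in 𝓝 0, ContDiffAt ℝ ∞ φ k := by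
  obtain ⟨-, ⟨U, hU, h⟩, -⟩ := hφ
  filter_upwards [eventually_mem_nhds_iff.2 hU] with k hk
  exact h.contDiffAt hk

/-- The linear map multiplying `x` by `a` and `y` by `b`. -/
noncomputable def scaleL (a b : ℝ) : (Fin (n + 2) → ℝ) →L[ℝ] (Fin (n + 2) → ℝ) :=
  glue.comp ((((a • ContinuousLinearMap.fst ℝ ℝ ℝ).prod (b • ContinuousLinearMap.snd ℝ ℝ ℝ)).comp
    planeL).prod zL)

theorem scaleL_apply (a b : ℝ) (k : Fin (n + 2) → ℝ) :
    scaleL a b k = glue ((a * k 0, b * k 1), zL k) := rfl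

theorem scaleL_bijective {a b : ℝ} (ha : a ≠ 0) (hb : b ≠ 0) :
    Function.Bijective (scaleL (n := n) a b) := by
  have hinj : Function.Injective (scaleL (n := n) a b) := by
    refine (injective_iff_map_eq_zero _).2 fun v hv => ?_
    rw [scaleL_apply] at hv
    have e0 := congrFun hv 0
    have e1 := congrFun hv 1
    have e2 := fun j => congrFun hv (zi j)
    simp only [glue_zero, glue_one, glue_zi, Pi.zero_apply] at e0 e1 e2
    funext i
    rcases eq_zero_or_one_or_zi i with rfl | rfl | ⟨j, rfl⟩
    exacts [(mul_eq_zero.1 e0).resolve_left ha, (mul_eq_zero.1 e1).resolve_left hb, e2 j]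
  exact ⟨hinj, LinearMap.injective_iff_surjective.1 hinj⟩

/-- Scaling the variables changes the coefficient of the normal form, but not its sign. -/
theorem ReducesTo.of_mul_pos {μ : ℕ} (hμ : 2 ≤ μ) {c c' : ℝ} (hc : 0 < c * c')
    (h : ReducesTo μ c f) : ReducesTo μ c' f := by
  obtain ⟨φ, hφ, d, Q, hQ, h⟩ := h
  have hc' : c' ≠ 0 := fun h => by simp [h] at hc
  have hdiv : 0 < c / c' := by
    rcases mul_pos_iff.1 hc with ⟨h1, h2⟩ | ⟨h1, h2⟩
    exacts [div_pos h1 h2, div_pos_of_neg_of_neg h1 h2]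
  let l := (c / c') ^ (1 / (μ - 1 : ℕ) : ℝ)
  have hl : 0 < l := Real.rpow_pos_of_pos hdiv _
  have hlm : l ^ (μ - 1) = c / c' := by
    rw [← Real.rpow_natCast, ← Real.rpow_mul hdiv.le, one_div_mul_cancel, Real.rpow_one]
    exact_mod_cast (by omega : μ - 1 ≠ 0)
  have hs : √l ^ 2 = l := Real.sq_sqrt hl.le
  have hs0 : √l ≠ 0 := (Real.sqrt_pos.2 hl).ne'
  obtain ⟨h0, ⟨U, hU, hU'⟩, hb⟩ := hφ
  refine ⟨scaleL (√l)⁻¹ l ∘ φ, ⟨by simp [h0],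
    ⟨U, hU, (scaleL _ _).contDiff.comp_contDiffOn hU'⟩, ?_⟩,
    d, Q, hQ, ?_⟩
  · have hd := ((hU'.contDiffAt hU).differentiableAt (by simp)).hasFDerivAt
    rw [((scaleL (√l)⁻¹ l).hasFDerivAt.comp 0 hd).fderiv]
    exact (scaleL_bijective (inv_ne_zero hs0) hl.ne').comp hb
  · filter_upwards [h] with k hk
    have e : (fun j => (scaleL (√l)⁻¹ l ∘ φ) k (zi j)) = fun j => φ k (zi j) :=
      funext fun j => glue_zi _ j
    rw [hk, e, show (scaleL (√l)⁻¹ l ∘ φ) k 0 = (√l)⁻¹ * φ k 0 from glue_zero _,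
      show (scaleL (√l)⁻¹ l ∘ φ) k 1 = l * φ k 1 from glue_one _, mul_pow, mul_pow, hlm, inv_pow,
      hs]
    field_simp

/-! ### The order of vanishing of the gradient -/

variable {V : Type} [NormedAddCommGroup V] [NormedSpace ℝ V]

/-- The gradient of `f` is bounded below near the origin by the `r`-th power of the distance. -/
def GradLower (f : V → ℝ) (r : ℕ) : Prop :=
  ∃ ε > 0, ∀ᶠ k in 𝓝 (0 : V), ε * ‖k‖ ^ r ≤ ‖fderiv ℝ f k‖

/-- The gradient of `f` is bounded above by the `r`-th power of the distance to the origin at points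
arbitrarily close to the origin. -/
def GradUpper (f : V → ℝ) (r : ℕ) : Prop :=
  ∃ C : ℝ, ∃ᶠ k in 𝓝[≠] (0 : V), ‖fderiv ℝ f k‖ ≤ C * ‖k‖ ^ r

/-- A lower bound of order `r` and an upper bound of order `s` are compatible only for `s ≤ r`. -/
theorem GradLower.le_of_gradUpper {f : V → ℝ} {r s : ℕ} (hr : GradLower f r) (hs : GradUpper f s) :
    s ≤ r := by
  obtain ⟨ε, hε, h1⟩ := hr
  obtain ⟨C, h2⟩ := hs
  by_contra! hlt
  obtain ⟨j, rfl⟩ : ∃ j, s = r + (j + 1) := ⟨s - r - 1, by omega⟩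
  have h3 : ∀ᶠ k in 𝓝 (0 : V), C * ‖k‖ ^ (j + 1) < ε := by
    have h : Continuous fun k : V => C * ‖k‖ ^ (j + 1) := by fun_prop
    exact h.continuousAt.eventually (gt_mem_nhds (by simpa using hε))
  obtain ⟨k, hk, hk1, hk3, hk0⟩ := (h2.and_eventually ((h1.filter_mono nhdsWithin_le_nhds).and
    ((h3.filter_mono nhdsWithin_le_nhds).and self_mem_nhdsWithin))).exists
  have hpos : 0 < ‖k‖ := norm_pos_iff.2 hk0
  have := mul_lt_mul_of_pos_right hk3 (pow_pos hpos r)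
  rw [pow_add] at hk
  nlinarith

/-- A differentiable map at most multiplies the gradients by a constant. -/
theorem exists_norm_fderiv_le {f g : V → ℝ} {φ : V → V} (hφ0 : φ 0 = 0)
    (hφ : ContDiffAt ℝ ∞ φ 0) (hg : ∀ᶠ k in 𝓝 0, DifferentiableAt ℝ g k) (h : f =ᶠ[𝓝 0] g ∘ φ) :
    ∃ C > 0, ∀ᶠ k in 𝓝 0, ‖fderiv ℝ f k‖ ≤ C * ‖fderiv ℝ g (φ k)‖ := by
  have h1 : ContinuousAt (fderiv ℝ φ) 0 := hφ.continuousAt_fderiv (by simp)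
  have ht : Tendsto φ (𝓝 0) (𝓝 0) := by simpa only [hφ0] using hφ.continuousAt.tendsto
  have hd : ∀ᶠ k in 𝓝 0, ContDiffAt ℝ 1 φ k := (hφ.of_le (by simp)).eventually (by simp)
  refine ⟨‖fderiv ℝ φ 0‖ + 1, by positivity, ?_⟩
  filter_upwards [h1.norm.eventually (gt_mem_nhds (lt_add_one _)), ht.eventually hg, hd,
    h.eventuallyEq_nhds] with k h2 h3 h4 h5
  rw [h5.fderiv_eq, (h3.hasFDerivAt.comp k (h4.differentiableAt (by simp)).hasFDerivAt).fderiv,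
    mul_comm]
  exact (ContinuousLinearMap.opNorm_comp_le _ _).trans (by gcongr)

theorem exists_norm_le {φ : V → V} (hφ0 : φ 0 = 0) (hφ : ContDiffAt ℝ ∞ φ 0) :
    ∃ C > 0, ∀ᶠ k in 𝓝 0, ‖φ k‖ ≤ C * ‖k‖ := by
  obtain ⟨C, hC, h⟩ := ((hφ.differentiableAt (by simp)).isBigO_sub).exists_pos
  refine ⟨C, hC, ?_⟩
  filter_upwards [h.bound] with k hk
  simpa [hφ0] using hk

/-- The order of vanishing of the gradient does not depend on the choice of coordinates. -/
theorem gradLower_and_gradUpper_of_change {f g : V → ℝ} {φ Ψ : V → V} (hφ0 : φ 0 = 0)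
    (hφ : ContDiffAt ℝ ∞ φ 0) (hΨ0 : Ψ 0 = 0) (hΨ : ContDiffAt ℝ ∞ Ψ 0)
    (h1 : ∀ᶠ k in 𝓝 0, φ (Ψ k) = k) (h2 : ∀ᶠ k in 𝓝 0, Ψ (φ k) = k) (hf : Differentiable ℝ f)
    (hg : Differentiable ℝ g) (h : f =ᶠ[𝓝 0] g ∘ φ) (r : ℕ) :
    (GradLower g r → GradLower f r) ∧ (GradUpper g r → GradUpper f r) := by
  have htφ : Tendsto φ (𝓝 0) (𝓝 0) := by simpa only [hφ0] using hφ.continuousAt.tendsto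
  have htΨ : Tendsto Ψ (𝓝 0) (𝓝 0) := by simpa only [hΨ0] using hΨ.continuousAt.tendsto
  have h' : g =ᶠ[𝓝 0] f ∘ Ψ := by
    filter_upwards [htΨ.eventually h, h1] with k hk1 hk2
    rw [Function.comp_apply, hk1, Function.comp_apply, hk2]
  obtain ⟨C, hC, hC'⟩ := exists_norm_fderiv_le hφ0 hφ (Eventually.of_forall fun k => hg k) h
  obtain ⟨E, hE, hE'⟩ := exists_norm_fderiv_le hΨ0 hΨ (Eventually.of_forall fun k => hf k) h'
  obtain ⟨A, hA, hA'⟩ := exists_norm_le hφ0 hφ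
  obtain ⟨B, hB, hB'⟩ := exists_norm_le hΨ0 hΨ
  constructor
  · rintro ⟨ε, hε, hl⟩
    refine ⟨ε / (B ^ r * E), by positivity, ?_⟩
    filter_upwards [htφ.eventually hl, htφ.eventually hE', htφ.eventually hB', h2]
      with k k1 k2 k3 k4
    rw [k4] at k2 k3
    rw [div_mul_eq_mul_div, div_le_iff₀ (by positivity)]
    calc ε * ‖k‖ ^ r ≤ ε * (B * ‖φ k‖) ^ r := by gcongr
      _ = B ^ r * (ε * ‖φ k‖ ^ r) := by ring
      _ ≤ B ^ r * (E * ‖fderiv ℝ f k‖) :=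
        mul_le_mul_of_nonneg_left (k1.trans k2) (by positivity)
      _ = ‖fderiv ℝ f k‖ * (B ^ r * E) := by ring
  · rintro ⟨D, hu⟩
    refine ⟨C * (|D| * A ^ r), ?_⟩
    have htΨ' : Tendsto Ψ (𝓝[≠] 0) (𝓝[≠] 0) := by
      refine tendsto_nhdsWithin_iff.2 ⟨htΨ.mono_left nhdsWithin_le_nhds, ?_⟩
      filter_upwards [h1.filter_mono nhdsWithin_le_nhds, self_mem_nhdsWithin] with k k1 k2 k3
      exact k2 (by rw [mem_singleton_iff, ← k1, show Ψ k = 0 from k3, hφ0])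
    refine htΨ'.frequently ((hu.and_eventually (h1.and ((htΨ.eventually hC').and
      (htΨ.eventually hA')) |>.filter_mono nhdsWithin_le_nhds)).mono ?_)
    rintro k ⟨k1, k2, k3, k4⟩
    rw [k2] at k3 k4
    calc ‖fderiv ℝ f (Ψ k)‖ ≤ C * ‖fderiv ℝ g k‖ := k3
      _ ≤ C * (|D| * ‖k‖ ^ r) := by
        gcongr
        exact k1.trans (by gcongr; exact le_abs_self D)
      _ ≤ C * (|D| * (A * ‖Ψ k‖) ^ r) := by gcongr
      _ = C * (|D| * A ^ r) * ‖Ψ k‖ ^ r := by ring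

/-! ### The gradient of the normal form -/

variable {n : ℕ} {f : (Fin (n + 2) → ℝ) → ℝ}

/-- The normal form `x² y + c yᵐ + Q(z)`. -/
noncomputable def normalForm (m : ℕ) (c : ℝ) (Q : QuadraticForm ℝ (Fin n → ℝ))
    (k : Fin (n + 2) → ℝ) : ℝ :=
  k 0 ^ 2 * k 1 + c * k 1 ^ m + Q (zL k)

/-- The polar form of a quadratic form, as a continuous bilinear form. -/
noncomputable def polarL (Q : QuadraticForm ℝ (Fin n → ℝ)) :
    (Fin n → ℝ) →L[ℝ] (Fin n → ℝ) →L[ℝ] ℝ :=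
  LinearMap.toContinuousLinearMap
    ((LinearMap.toContinuousLinearMap (𝕜 := ℝ) (E := Fin n → ℝ) (F' := ℝ)).toLinearMap ∘ₗ
      QuadraticMap.polarBilin Q)

theorem polarL_apply (Q : QuadraticForm ℝ (Fin n → ℝ)) (u v : Fin n → ℝ) :
    polarL Q u v = QuadraticMap.polarBilin Q u v := rfl

theorem polarL_self (Q : QuadraticForm ℝ (Fin n → ℝ)) (u : Fin n → ℝ) :
    polarL Q u u = 2 * Q u := by
  rw [polarL_apply, QuadraticMap.polarBilin_apply_apply, QuadraticMap.polar_self, nsmul_eq_mul]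
  norm_num

theorem polarL_comm (Q : QuadraticForm ℝ (Fin n → ℝ)) (u v : Fin n → ℝ) :
    polarL Q u v = polarL Q v u := by
  rw [polarL_apply, polarL_apply, QuadraticMap.polarBilin_apply_apply,
    QuadraticMap.polarBilin_apply_apply, QuadraticMap.polar_comm]

theorem hasFDerivAt_quadraticForm (Q : QuadraticForm ℝ (Fin n → ℝ)) (w : Fin n → ℝ) :
    HasFDerivAt Q (polarL Q w) w := by
  have h := ((polarL Q).hasFDerivAt.clm_apply (hasFDerivAt_id w)).const_mul (1 / 2 : ℝ)
  have e : (fun w => 1 / 2 * (polarL Q w) (id w)) = Q := by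
    funext w
    rw [id, polarL_self]; ring
  rw [e] at h
  refine h.congr_fderiv (ContinuousLinearMap.ext fun v => ?_)
  change (1 / 2 : ℝ) * (polarL Q w v + polarL Q v w) = _
  rw [polarL_comm Q v w]; ring

theorem hasFDerivAt_normalForm (m : ℕ) (c : ℝ) (Q : QuadraticForm ℝ (Fin n → ℝ))
    (k : Fin (n + 2) → ℝ) : ∃ L : (Fin (n + 2) → ℝ) →L[ℝ] ℝ, HasFDerivAt (normalForm m c Q) L k ∧
      ∀ v, L v = 2 * k 0 * k 1 * v 0 + (k 0 ^ 2 + c * (m * k 1 ^ (m - 1))) * v 1 +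
        polarL Q (zL k) (zL v) := by
  let pr : Fin (n + 2) → (Fin (n + 2) → ℝ) →L[ℝ] ℝ := fun i => ContinuousLinearMap.proj i
  have h0 : HasFDerivAt (fun k : Fin (n + 2) → ℝ => k 0) (pr 0) k := hasFDerivAt_apply 0 k
  have h1 : HasFDerivAt (fun k : Fin (n + 2) → ℝ => k 1) (pr 1) k := hasFDerivAt_apply 1 k
  have hQ : HasFDerivAt (fun k : Fin (n + 2) → ℝ => Q (zL k)) _ k :=
    (hasFDerivAt_quadraticForm Q (zL k)).comp k zL.hasFDerivAt
  refine ⟨_, (((h0.pow 2).mul h1).add ((h1.pow m).const_mul c)).add hQ, fun v => ?_⟩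
  simp [pr]
  ring

theorem differentiable_normalForm (m : ℕ) (c : ℝ) (Q : QuadraticForm ℝ (Fin n → ℝ)) :
    Differentiable ℝ (normalForm m c Q) := fun k =>
  let ⟨_, h, _⟩ := hasFDerivAt_normalForm m c Q k
  h.differentiableAt

theorem fderiv_normalForm (m : ℕ) (c : ℝ) (Q : QuadraticForm ℝ (Fin n → ℝ))
    (k v : Fin (n + 2) → ℝ) : fderiv ℝ (normalForm m c Q) k v =
      2 * k 0 * k 1 * v 0 + (k 0 ^ 2 + c * (m * k 1 ^ (m - 1))) * v 1 +
        polarL Q (zL k) (zL v) := by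
  obtain ⟨L, h, hL⟩ := hasFDerivAt_normalForm m c Q k
  rw [h.fderiv, hL]

/-- On the `y`-axis the gradient of the normal form is `m c yᵐ⁻¹`. -/
theorem gradUpper_normalForm {m : ℕ} (hm : 2 ≤ m) (c : ℝ) (Q : QuadraticForm ℝ (Fin n → ℝ)) :
    GradUpper (normalForm m c Q) (m - 1) := by
  refine ⟨|c| * m, ?_⟩
  have ht : Tendsto (fun t : ℝ => t • (ev 1 : Fin (n + 2) → ℝ)) (𝓝[≠] 0) (𝓝[≠] 0) := by
    refine tendsto_nhdsWithin_iff.2 ⟨?_, ?_⟩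
    · have h : Continuous fun t : ℝ => t • (ev 1 : Fin (n + 2) → ℝ) := by fun_prop
      simpa using (h.tendsto 0).mono_left nhdsWithin_le_nhds
    · filter_upwards [self_mem_nhdsWithin] with t ht h
      have := congrFun (show t • (ev 1 : Fin (n + 2) → ℝ) = 0 from h) 1
      exact ht (by simpa using this)
  refine ht.frequently (Eventually.frequently (Eventually.of_forall fun t => ?_))
  refine ContinuousLinearMap.opNorm_le_bound _ (by positivity) fun v => ?_
  have hz : zL (t • (ev 1 : Fin (n + 2) → ℝ)) = 0 := by
    funext j
    simp [zL, zi_ne_one]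
  have hn : ‖t • (ev 1 : Fin (n + 2) → ℝ)‖ = |t| := by
    rw [norm_smul, Pi.norm_single, norm_one, mul_one, Real.norm_eq_abs]
  rw [fderiv_normalForm, hz, map_zero, hn]
  have h1 : |v 1| ≤ ‖v‖ := norm_le_pi_norm v 1
  have e0 : (t • (ev 1 : Fin (n + 2) → ℝ)) 0 = 0 := by simp
  have e1 : (t • (ev 1 : Fin (n + 2) → ℝ)) 1 = t := by simp
  rw [e0, e1, Real.norm_eq_abs]
  calc |2 * 0 * t * v 0 + (0 ^ 2 + c * (m * t ^ (m - 1))) * v 1 + (0 : (Fin n → ℝ) →L[ℝ] ℝ) (zL v)|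
      = |c| * m * |t| ^ (m - 1) * |v 1| := by
        rw [show (0 : (Fin n → ℝ) →L[ℝ] ℝ) (zL v) = 0 from rfl]
        rw [show 2 * 0 * t * v 0 + (0 ^ 2 + c * (m * t ^ (m - 1))) * v 1 + 0 =
          c * (m * t ^ (m - 1)) * v 1 by ring, abs_mul, abs_mul, abs_mul, abs_pow, Nat.abs_cast]
        ring
    _ ≤ _ := by gcongr

/-- The gradient bounds `x y`, `x² + m c yᵐ⁻¹` and `z`, and by them `x` or `y`, whichever is
greater. -/
theorem gradLower_normalForm {m : ℕ} (hm : 3 ≤ m) {c : ℝ} (hc : c ≠ 0)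
    {Q : QuadraticForm ℝ (Fin n → ℝ)} (hQ : (QuadraticMap.polarBilin Q).Nondegenerate) :
    GradLower (normalForm m c Q) (m - 1) := by
  obtain ⟨m, rfl⟩ : ∃ k, m = k + 3 := ⟨m - 3, by omega⟩
  have hinj : ∀ u, polarL Q u = 0 → u = 0 := fun u hu => hQ.1 u fun v => by
    rw [← polarL_apply, hu]; rfl
  let J := dualEquiv hinj
  -- each coordinate of `k` is estimated by the gradient
  let A := |c| * (m + 3 : ℕ)
  have hA : 0 < A := by positivity
  let C := 1 + A + 2 / A + ‖(J.symm : ((Fin n → ℝ) →L[ℝ] ℝ) →L[ℝ] (Fin n → ℝ))‖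
  have hC : 0 < C := by positivity
  have hC1 : 1 + A ≤ C := by
    have : 0 ≤ 2 / A + ‖(J.symm : ((Fin n → ℝ) →L[ℝ] ℝ) →L[ℝ] (Fin n → ℝ))‖ := by positivity
    simp only [C]; linarith
  have hC2 : 2 / A ≤ C := by
    have : 0 ≤ 1 + A + ‖(J.symm : ((Fin n → ℝ) →L[ℝ] ℝ) →L[ℝ] (Fin n → ℝ))‖ := by positivity
    simp only [C]; linarith
  have hC3 : ‖(J.symm : ((Fin n → ℝ) →L[ℝ] ℝ) →L[ℝ] (Fin n → ℝ))‖ ≤ C := by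
    have : 0 ≤ 1 + A + 2 / A := by positivity
    simp only [C]; linarith
  refine ⟨1 / C, by positivity, ?_⟩
  filter_upwards [Metric.ball_mem_nhds (0 : Fin (n + 2) → ℝ) one_pos] with k hk
  rw [mem_ball_zero_iff] at hk
  set N := ‖fderiv ℝ (normalForm (m + 3) c Q) k‖
  have hN : 0 ≤ N := norm_nonneg _
  have hdir : ∀ v : Fin (n + 2) → ℝ, |fderiv ℝ (normalForm (m + 3) c Q) k v| ≤ N * ‖v‖ :=
    fun v => (fderiv ℝ (normalForm (m + 3) c Q) k).le_opNorm v
  have hev : ∀ i : Fin (n + 2), ‖(ev i : Fin (n + 2) → ℝ)‖ = 1 := fun i => by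
    rw [Pi.norm_single, norm_one]
  have hz0 : ∀ i : Fin (n + 2), i = 0 ∨ i = 1 → zL (ev i : Fin (n + 2) → ℝ) = 0 := by
    rintro i (rfl | rfl)
    · funext j; simp [zL, zi_ne_zero]
    · funext j; simp [zL, zi_ne_one]
  have d0 : 2 * (|k 0| * |k 1|) ≤ N := by
    have := hdir (ev 0)
    rw [fderiv_normalForm, hev, hz0 0 (Or.inl rfl)] at this
    simp only [Pi.single_eq_same, map_zero, mul_one, add_zero] at this
    rw [show (ev 0 : Fin (n + 2) → ℝ) 1 = 0 by simp] at this
    simpa [abs_mul, mul_assoc] using this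
  have d1 : |k 0 ^ 2 + c * ((m + 3 : ℕ) * k 1 ^ (m + 2))| ≤ N := by
    have := hdir (ev 1)
    rw [fderiv_normalForm, hev, hz0 1 (Or.inr rfl)] at this
    simp only [Pi.single_eq_same, map_zero, mul_one, add_zero] at this
    rw [show (ev 1 : Fin (n + 2) → ℝ) 0 = 0 by simp] at this
    simpa using this
  have hAk : |c * ((m + 3 : ℕ) * k 1 ^ (m + 2))| = A * |k 1| ^ (m + 2) := by
    rw [abs_mul, abs_mul, abs_pow, Nat.abs_cast]; ring
  have d2 : ‖zL k‖ ≤ C * N := by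
    have h1 : ‖J (zL k)‖ ≤ N := by
      refine ContinuousLinearMap.opNorm_le_bound _ hN fun u => ?_
      have h2 := hdir (incl u)
      have h3 : zL (incl u) = u := funext fun j => incl_zi u j
      have h4 : ‖incl u‖ ≤ ‖u‖ := by
        refine (pi_norm_le_iff_of_nonneg (norm_nonneg _)).2 fun i => ?_
        rcases eq_zero_or_one_or_zi i with rfl | rfl | ⟨j, rfl⟩
        · rw [incl_zero, norm_zero]; exact norm_nonneg _
        · rw [incl_one, norm_zero]; exact norm_nonneg _
        · rw [incl_zi]; exact norm_le_pi_norm u j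
      rw [fderiv_normalForm, incl_zero, incl_one, h3, mul_zero, mul_zero, zero_add, zero_add] at h2
      exact h2.trans (by gcongr)
    calc ‖zL k‖ = ‖(J.symm : ((Fin n → ℝ) →L[ℝ] ℝ) →L[ℝ] (Fin n → ℝ)) (J (zL k))‖ := by simp
      _ ≤ ‖(J.symm : ((Fin n → ℝ) →L[ℝ] ℝ) →L[ℝ] (Fin n → ℝ))‖ * ‖J (zL k)‖ :=
        ContinuousLinearMap.le_opNorm _ _
      _ ≤ C * N := by gcongr
  have hk1 : ∀ i, |k i| ≤ 1 := fun i => (norm_le_pi_norm k i).trans hk.le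
  have hxy : |k 0| ^ (m + 2) ≤ C * N ∧ |k 1| ^ (m + 2) ≤ C * N := by
    have p0 : |k 0| ^ (m + 2) ≤ |k 0| ^ 2 := pow_le_pow_of_le_one (abs_nonneg _) (hk1 0) (by omega)
    have p1 : |k 1| ^ (m + 2) ≤ |k 1| ^ 2 := pow_le_pow_of_le_one (abs_nonneg _) (hk1 1) (by omega)
    have hCN : (1 + A) * N ≤ C * N := by gcongr
    have hCN' : 2 / A * N ≤ C * N := by gcongr
    have hAN : 0 ≤ A * N := by positivity
    rcases le_total |k 1| |k 0| with hle | hle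
    · have h2 : |k 1| ^ 2 ≤ |k 0| * |k 1| := by
        rw [sq]; gcongr
      have h3 : |k 0| ^ 2 ≤ N + A * |k 1| ^ (m + 2) := by
        rw [sq_abs, ← hAk]
        have := abs_le.1 d1
        have h4 := neg_abs_le (c * ((m + 3 : ℕ) * k 1 ^ (m + 2)))
        linarith
      have h5 : A * |k 1| ^ (m + 2) ≤ A * N := by
        gcongr
        linarith
      have h6 : |k 1| ^ 2 ≤ |k 0| ^ 2 := by gcongr
      constructor <;> linarith
    · have h2 : |k 0| ^ 2 ≤ |k 0| * |k 1| := by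
        rw [sq]; gcongr
      have h3 : A * |k 1| ^ (m + 2) ≤ 2 * N := by
        obtain ⟨h4, h5⟩ := abs_le.1 d1
        have h6 := sq_abs (k 0)
        have h7 := sq_nonneg (k 0)
        rw [← hAk, abs_le]
        constructor <;> linarith
      have h5 : |k 1| ^ (m + 2) ≤ 2 / A * N := by
        rw [div_mul_eq_mul_div, le_div_iff₀ hA]; linarith
      constructor <;> linarith
  obtain ⟨i, hi⟩ := Finite.exists_max fun i => ‖k i‖
  have hki : ‖k‖ ≤ ‖k i‖ := (pi_norm_le_iff_of_nonneg (norm_nonneg _)).2 hi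
  have hmain : ‖k i‖ ^ (m + 2) ≤ C * N := by
    rcases eq_zero_or_one_or_zi i with rfl | rfl | ⟨j, rfl⟩
    · exact hxy.1
    · exact hxy.2
    · calc ‖k (zi j)‖ ^ (m + 2) ≤ ‖k (zi j)‖ :=
          pow_le_of_le_one (norm_nonneg _) (hk1 _) (by omega)
        _ ≤ ‖zL k‖ := norm_le_pi_norm (zL k) j
        _ ≤ C * N := d2
  rw [one_div_mul_eq_div, div_le_iff₀ hC, mul_comm]
  exact (by gcongr : ‖k‖ ^ (m + 2) ≤ ‖k i‖ ^ (m + 2)).trans hmain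

/-- The number `μ` of the normal form is determined by the order of vanishing of the gradient. -/
theorem ReducesTo.gradLower_and_gradUpper {μ : ℕ} (hμ : 4 ≤ μ) {c : ℝ} (hc : c ≠ 0)
    (hf : Differentiable ℝ f) (h : ReducesTo μ c f) :
    GradLower f (μ - 2) ∧ GradUpper f (μ - 2) := by
  obtain ⟨φ, hφ, d, Q, hQ, h⟩ := h
  have hsm := hφ.eventually_contDiffAt
  let L : (Fin (n + 2) → ℝ) ≃L[ℝ] (Fin (n + 2) → ℝ) := (LinearEquiv.ofBijective
    (fderiv ℝ φ 0 : (Fin (n + 2) → ℝ) →ₗ[ℝ] (Fin (n + 2) → ℝ)) hφ.2.2).toContinuousLinearEquiv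
  obtain ⟨Ψ, hΨ, hΨ0, h1, h2⟩ := exists_smooth_localInverse hsm L
    ((hsm.self_of_nhds.differentiableAt (by simp)).hasFDerivAt.congr_fderiv (by ext1 v; rfl))
  rw [hφ.1] at hΨ hΨ0 h1
  have he : (fun k => f k - d) =ᶠ[𝓝 0] normalForm (μ - 1) c Q ∘ φ := by
    filter_upwards [h] with k hk
    rw [hk, Function.comp_apply, normalForm, show zL (φ k) = fun j => φ k (zi j) from rfl]
    ring
  obtain ⟨t1, t2⟩ := gradLower_and_gradUpper_of_change hφ.1 hsm.self_of_nhds hΨ0 hΨ.self_of_nhds h1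
    h2 (hf.sub_const d) (differentiable_normalForm _ _ _) he (μ - 2)
  have h3 := t1 (gradLower_normalForm (by omega) hc hQ)
  have h4 := t2 (gradUpper_normalForm (by omega) c Q)
  simp only [GradLower, GradUpper, fderiv_sub_const] at h3 h4
  exact ⟨h3, h4⟩

/-! ### The gradient on a critical curve -/

variable {n : ℕ} {f : (Fin (n + 2) → ℝ) → ℝ}

/-- On a critical curve the gradient of `f` reduces to the derivative of `f` along the curve, so
that it is small if the first derivatives along the curve vanish. -/
theorem IsCritCurve.gradUpper {γ : ℝ → Fin (n + 2) → ℝ} (hf : ContDiff ℝ ∞ f)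
    (hγ : IsCritCurve f γ) {m : ℕ}
    (h : ∀ j, 0 < j → j ≤ m → iteratedDeriv j (fun t => f (γ t)) 0 = 0) : GradUpper f m := by
  have hg : ContDiff ℝ ∞ fun t => f (γ t) := hf.comp hγ.smooth
  obtain ⟨χ, hχ, hχ1, -⟩ := exists_eq_pow_mul m (contDiff_infty_iff_deriv.1 hg).2 fun j hj => by
    rw [← iteratedDeriv_succ']
    exact h _ (by omega) (by omega)
  have hgrad : ∀ᶠ t in 𝓝 0, ‖fderiv ℝ f (γ t)‖ ≤ |t| ^ m * |χ t| := by
    filter_upwards [hγ.crit] with t ht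
    have hd := (hγ.smooth.differentiable (by simp) t).hasDerivAt
    have h1 : deriv γ t 1 = 1 := by
      have h2 := hasDerivAt_pi.1 hd 1
      simp only [hγ.apply_one] at h2
      exact h2.unique (hasDerivAt_id t)
    have h3 : ∀ v : Fin (n + 2) → ℝ, fderiv ℝ f (γ t) v = v 1 * (t ^ m * χ t) := fun v => by
      have h5 : HasDerivAt (fun t => f (γ t)) (fderiv ℝ f (γ t) (deriv γ t)) t :=
        (hf.differentiable (by simp) (γ t)).hasFDerivAt.comp_hasDerivAt t hd
      rw [← hχ1, h5.deriv]
      have h4 := ht (v - v 1 • deriv γ t) (by simp [h1])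
      rw [map_sub, map_smul, smul_eq_mul] at h4
      linarith
    refine ContinuousLinearMap.opNorm_le_bound _ (by positivity) fun v => ?_
    rw [h3, norm_mul, mul_comm, Real.norm_eq_abs (t ^ m * χ t), abs_mul, abs_pow]
    gcongr
    exact norm_le_pi_norm v 1
  have hbd : ∀ᶠ t in 𝓝 0, |χ t| ≤ |χ 0| + 1 :=
    (hχ.continuous.abs.continuousAt.eventually (gt_mem_nhds (lt_add_one _))).mono fun t ht => ht.le
  have ht : Tendsto γ (𝓝[≠] 0) (𝓝[≠] 0) := by
    refine tendsto_nhdsWithin_iff.2 ⟨?_, ?_⟩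
    · have := hγ.smooth.continuous.tendsto 0
      rw [hγ.zero] at this
      exact this.mono_left nhdsWithin_le_nhds
    · filter_upwards [self_mem_nhdsWithin] with t ht h0
      have := hγ.apply_one t
      rw [show γ t = 0 from h0] at this
      exact ht this.symm
  refine ⟨|χ 0| + 1, ht.frequently (Eventually.frequently ?_)⟩
  filter_upwards [hgrad.filter_mono nhdsWithin_le_nhds, hbd.filter_mono nhdsWithin_le_nhds]
    with t h1 h2
  have h3 : |t| ≤ ‖γ t‖ := by
    have := norm_le_pi_norm (γ t) 1
    rwa [hγ.apply_one] at this
  calc ‖fderiv ℝ f (γ t)‖ ≤ |t| ^ m * |χ t| := h1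
    _ ≤ ‖γ t‖ ^ m * (|χ 0| + 1) := by gcongr
    _ = (|χ 0| + 1) * ‖γ t‖ ^ m := mul_comm _ _

/-! ### The normalization of the cubic part -/

/-- A binary cubic form with a real linear factor, not a double one, becomes `x² y + const y³` (up
to the factor) in suitable coordinates: the square in the other factor is completed. -/
theorem exists_cubic_basis_of_root {p q r s a c b e : ℝ}
    (h0 : p * a ^ 3 + 3 * q * a ^ 2 * c + 3 * r * a * c ^ 2 + s * c ^ 3 = 0)
    (h1 : p * a ^ 2 * b + q * (a ^ 2 * e + 2 * a * b * c) + r * (2 * a * c * e + b * c ^ 2) +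
      s * c ^ 2 * e ≠ 0) :
    ∃ b e : ℝ, a * e - b * c ≠ 0 ∧
      p * a ^ 2 * b + q * (a ^ 2 * e + 2 * a * b * c) + r * (2 * a * c * e + b * c ^ 2) +
        s * c ^ 2 * e = 1 ∧
      p * a * b ^ 2 + q * (c * b ^ 2 + 2 * a * b * e) + r * (2 * b * c * e + a * e ^ 2) +
        s * c * e ^ 2 = 0 := by
  set A := p * a ^ 2 * b + q * (a ^ 2 * e + 2 * a * b * c) + r * (2 * a * c * e + b * c ^ 2) +
    s * c ^ 2 * e with hA
  set E := p * a * b ^ 2 + q * (c * b ^ 2 + 2 * a * b * e) + r * (2 * b * c * e + a * e ^ 2) +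
    s * c * e ^ 2 with hE
  obtain ⟨κ, hκ⟩ : ∃ κ, E + 2 * κ * A = 0 := ⟨-E / (2 * A), by field_simp; ring⟩
  obtain ⟨l, hl⟩ : ∃ l, l * A = 1 := ⟨1 / A, by field_simp⟩
  have e1 : p * a ^ 2 * (l * (b + κ * a)) + q * (a ^ 2 * (l * (e + κ * c)) +
      2 * a * (l * (b + κ * a)) * c) + r * (2 * a * c * (l * (e + κ * c)) +
        (l * (b + κ * a)) * c ^ 2) + s * c ^ 2 * (l * (e + κ * c)) = 1 := by
    linear_combination hl + l * κ * h0 + l * hA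
  refine ⟨l * (b + κ * a), l * (e + κ * c), fun hdet => ?_, e1, ?_⟩
  · -- if the vectors were proportional, the form would vanish on them
    generalize l * (b + κ * a) = b' at *
    generalize l * (e + κ * c) = e' at *
    have ha : a = 0 := by
      linear_combination (-a) * e1 + b' * h0 + (q * a ^ 2 + 2 * r * a * c + s * c ^ 2) * hdet
    have hc : c = 0 := by
      linear_combination (-c) * e1 + e' * h0 - (p * a ^ 2 + 2 * q * a * c + r * c ^ 2) * hdet
    rw [ha, hc] at e1
    simp at e1
  · linear_combination l ^ 2 * hκ + l ^ 2 * κ ^ 2 * h0 + l ^ 2 * hE + 2 * l ^ 2 * κ * hA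

theorem exists_cube_eq (x : ℝ) : ∃ g : ℝ, g ^ 3 = x := by
  have h := mem_range_of_exists_le_of_exists_ge (c := x) (f := fun g : ℝ => g ^ 3) (by fun_prop)
    ⟨-(|x| + 1), by nlinarith [neg_abs_le x, abs_nonneg x, pow_nonneg (abs_nonneg x) 3]⟩
    ⟨|x| + 1, by nlinarith [le_abs_self x, abs_nonneg x, pow_nonneg (abs_nonneg x) 3]⟩
  exact h

/-- A real binary cubic form that is not the cube of a linear form is `x² y + const y³`, up to
factors, in suitable coordinates. -/
theorem exists_cubic_basis {p q r s : ℝ}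
    (h : ¬ ∃ α β : ℝ, ∀ x y : ℝ,
      p / 6 * x ^ 3 + q / 2 * x ^ 2 * y + r / 2 * x * y ^ 2 + s / 6 * y ^ 3 = (α * x + β * y) ^ 3) :
    ∃ a b c e : ℝ, a * e - b * c ≠ 0 ∧
      p * a ^ 3 + 3 * q * a ^ 2 * c + 3 * r * a * c ^ 2 + s * c ^ 3 = 0 ∧
      p * a ^ 2 * b + q * (a ^ 2 * e + 2 * a * b * c) + r * (2 * a * c * e + b * c ^ 2) +
        s * c ^ 2 * e = 1 ∧
      p * a * b ^ 2 + q * (c * b ^ 2 + 2 * a * b * e) + r * (2 * b * c * e + a * e ^ 2) +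
        s * c * e ^ 2 = 0 := by
  -- a cubic form takes opposite values at opposite points of the circle, so it has a real zero
  obtain ⟨θ, hθ⟩ : (0 : ℝ) ∈ range fun θ : ℝ => p * Real.cos θ ^ 3 +
      3 * q * Real.cos θ ^ 2 * Real.sin θ + 3 * r * Real.cos θ * Real.sin θ ^ 2 +
        s * Real.sin θ ^ 3 := by
    have hc : Continuous fun θ : ℝ => p * Real.cos θ ^ 3 +
      3 * q * Real.cos θ ^ 2 * Real.sin θ + 3 * r * Real.cos θ * Real.sin θ ^ 2 +
        s * Real.sin θ ^ 3 := by fun_prop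
    rcases le_total p 0 with hp | hp
    · exact mem_range_of_exists_le_of_exists_ge hc ⟨0, by simpa using hp⟩
        ⟨Real.pi, by simp; linarith⟩
    · exact mem_range_of_exists_le_of_exists_ge hc ⟨Real.pi, by simp; linarith⟩
        ⟨0, by simpa using hp⟩
  have hcs := Real.cos_sq_add_sin_sq θ
  dsimp only at hθ
  generalize Real.cos θ = a at *
  generalize Real.sin θ = c at *
  by_cases hA : p * a ^ 2 * (-c) + q * (a ^ 2 * a + 2 * a * (-c) * c) +
      r * (2 * a * c * a + (-c) * c ^ 2) + s * c ^ 2 * a = 0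
  · by_cases hB : p * a * (-c) ^ 2 + q * (c * (-c) ^ 2 + 2 * a * (-c) * a) +
        r * (2 * (-c) * c * a + a * a ^ 2) + s * c * a ^ 2 = 0
    · -- the form is the cube of a linear form
      refine absurd ?_ h
      set G := p * (-c) ^ 3 + 3 * q * (-c) ^ 2 * a + 3 * r * (-c) * a ^ 2 + s * a ^ 3 with hG
      obtain ⟨g, hg⟩ : ∃ g : ℝ, g ^ 3 = G / 6 := exists_cube_eq _
      refine ⟨-(g * c), g * a, fun x y => ?_⟩
      have key : ∀ α β : ℝ,
          p * (a * α - c * β) ^ 3 + 3 * q * (a * α - c * β) ^ 2 * (c * α + a * β) +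
          3 * r * (a * α - c * β) * (c * α + a * β) ^ 2 + s * (c * α + a * β) ^ 3 = G * β ^ 3 :=
        fun α β => by
          linear_combination α ^ 3 * hθ + 3 * α ^ 2 * β * hA + 3 * α * β ^ 2 * hB - β ^ 3 * hG
      have hk := key (a * x + c * y) (a * y - c * x)
      have ex : a * (a * x + c * y) - c * (a * y - c * x) = x := by linear_combination x * hcs
      have ey : c * (a * x + c * y) + a * (a * y - c * x) = y := by linear_combination y * hcs
      rw [ex, ey] at hk
      linear_combination hk / 6 - (a * y - c * x) ^ 3 * hg
    · -- a double factor: the simple factor has to be chosen instead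
      set G := p * (-c) ^ 3 + 3 * q * (-c) ^ 2 * a + 3 * r * (-c) * a ^ 2 + s * a ^ 3 with hG
      set B := p * a * (-c) ^ 2 + q * (c * (-c) ^ 2 + 2 * a * (-c) * a) +
        r * (2 * (-c) * c * a + a * a ^ 2) + s * c * a ^ 2 with hB'
      have e0 : p * (G * a - 3 * B * -c) ^ 3 +
          3 * q * (G * a - 3 * B * -c) ^ 2 * (G * c - 3 * B * a) +
          3 * r * (G * a - 3 * B * -c) * (G * c - 3 * B * a) ^ 2 +
          s * (G * c - 3 * B * a) ^ 3 = 0 := by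
        linear_combination G ^ 3 * hθ - 9 * G ^ 2 * B * hA - 27 * G * B ^ 2 * hB' + 27 * B ^ 3 * hG
      obtain ⟨b, e, h1, h2, h3⟩ := exists_cubic_basis_of_root (b := a) (e := c) e0 (by
        have : p * (G * a - 3 * B * -c) ^ 2 * a + q * ((G * a - 3 * B * -c) ^ 2 * c +
            2 * (G * a - 3 * B * -c) * a * (G * c - 3 * B * a)) +
            r * (2 * (G * a - 3 * B * -c) * (G * c - 3 * B * a) * c + a * (G * c - 3 * B * a) ^ 2) +
            s * (G * c - 3 * B * a) ^ 2 * c = 9 * B ^ 3 := by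
          linear_combination G ^ 2 * hθ - 6 * G * B * hA - 9 * B ^ 2 * hB'
        rw [this]
        positivity)
      exact ⟨_, b, _, e, h1, e0, h2, h3⟩
  · obtain ⟨b, e, h1, h2, h3⟩ := exists_cubic_basis_of_root hθ hA
    exact ⟨a, b, c, e, h1, hθ, h2, h3⟩

/-! ### The linear change of `x` and `y` -/

variable {n : ℕ} {f : (Fin (n + 2) → ℝ) → ℝ}

/-- `planeMap` as a continuous linear map. -/
noncomputable def planeMapL (a b c e : ℝ) : (Fin (n + 2) → ℝ) →L[ℝ] (Fin (n + 2) → ℝ) :=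
  glue.comp ((((a • ContinuousLinearMap.fst ℝ ℝ ℝ + b • ContinuousLinearMap.snd ℝ ℝ ℝ).prod
    (c • ContinuousLinearMap.fst ℝ ℝ ℝ + e • ContinuousLinearMap.snd ℝ ℝ ℝ)).comp planeL).prod zL)

theorem planeMapL_apply (a b c e : ℝ) (k : Fin (n + 2) → ℝ) :
    planeMapL a b c e k = glue ((a * k 0 + b * k 1, c * k 0 + e * k 1), zL k) := rfl

theorem coe_planeMapL (a b c e : ℝ) : ⇑(planeMapL (n := n) a b c e) = planeMap a b c e := by
  funext k i
  rw [planeMapL_apply]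
  rcases eq_zero_or_one_or_zi i with rfl | rfl | ⟨j, rfl⟩
  · rw [glue_zero]; rfl
  · rw [glue_one]; rfl
  · rw [glue_zi]; rfl

theorem planeMapL_ev_zero (a b c e : ℝ) :
    planeMapL (n := n) a b c e (ev 0) = a • ev 0 + c • ev 1 := by
  have : zL (ev 0 : Fin (n + 2) → ℝ) = 0 := by funext j; simp [zL, zi_ne_zero]
  rw [planeMapL_apply, this, glue_apply]
  simp [incl]

theorem planeMapL_ev_one (a b c e : ℝ) :
    planeMapL (n := n) a b c e (ev 1) = b • ev 0 + e • ev 1 := by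
  have : zL (ev 1 : Fin (n + 2) → ℝ) = 0 := by funext j; simp [zL, zi_ne_one]
  rw [planeMapL_apply, this, glue_apply]
  simp [incl]

theorem planeMapL_surjective {a b c e : ℝ} (h : a * e - b * c ≠ 0) :
    Function.Surjective (planeMapL (n := n) a b c e) := by
  refine LinearMap.injective_iff_surjective.1 ((injective_iff_map_eq_zero _).2 fun v hv => ?_)
  have hv' : planeMapL a b c e v = 0 := hv
  rw [planeMapL_apply] at hv'
  have e0 := congrFun hv' 0
  have e1 := congrFun hv' 1
  have e2 := fun j => congrFun hv' (zi j)
  simp only [glue_zero, glue_one, glue_zi, Pi.zero_apply] at e0 e1 e2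
  have v0 : (a * e - b * c) * v 0 = 0 := by linear_combination e * e0 - b * e1
  have v1 : (a * e - b * c) * v 1 = 0 := by linear_combination a * e1 - c * e0
  funext i
  rcases eq_zero_or_one_or_zi i with rfl | rfl | ⟨j, rfl⟩
  exacts [(mul_eq_zero.1 v0).resolve_left h, (mul_eq_zero.1 v1).resolve_left h, e2 j]

theorem IsCorankTwo.comp_planeMap (hf : IsCorankTwo f) {a b c e : ℝ} (h : a * e - b * c ≠ 0) :
    IsCorankTwo (f ∘ planeMap a b c e) := by
  rw [← coe_planeMapL]
  set A := planeMapL (n := n) a b c e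
  have hA : ContDiff ℝ ∞ (f ∘ A) := hf.smooth.comp A.contDiff
  refine ⟨hA, ?_, fun v => ?_⟩
  · have h1 : HasFDerivAt f (fderiv ℝ f 0) (A 0) := by
      rw [map_zero]; exact (hf.smooth.differentiable (by simp) 0).hasFDerivAt
    rw [(h1.comp 0 A.hasFDerivAt).fderiv, hf.critical, ContinuousLinearMap.zero_comp]
  · have h2 : ∀ u, fderiv ℝ (fderiv ℝ (f ∘ A)) 0 v u = fderiv ℝ (fderiv ℝ f) 0 (A v) (A u) := by
      intro u
      rw [fderiv_fderiv_apply hA, fderiv_fderiv_apply hf.smooth]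
      change symD (f ∘ A) ([v, u] : List _) 0 = symD f ([A v, A u] : List _) 0
      rw [symD_coe hA, symD_coe hf.smooth, dirD_comp_clm hf.smooth, map_zero]
      rfl
    have h3 : fderiv ℝ (fderiv ℝ (f ∘ A)) 0 v = 0 ↔ fderiv ℝ (fderiv ℝ f) 0 (A v) = 0 := by
      constructor
      · intro h0
        refine ContinuousLinearMap.ext fun w => ?_
        obtain ⟨u, rfl⟩ := planeMapL_surjective h w
        rw [← h2, h0]; rfl
      · intro h0
        refine ContinuousLinearMap.ext fun u => ?_
        rw [h2, h0]; rfl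
    rw [h3, hf.kernel]
    refine forall_congr' fun j => ?_
    rw [show A v (zi j) = v (zi j) from glue_zi _ j]

theorem D_comp_planeMap (hf : ContDiff ℝ ∞ f) (a b c e : ℝ) (i j k : Fin (n + 2)) :
    D (f ∘ planeMap a b c e) [i, j, k] = symD f (planeMapL a b c e (ev i) ::ₘ
      planeMapL a b c e (ev j) ::ₘ planeMapL a b c e (ev k) ::ₘ 0) 0 := by
  rw [← coe_planeMapL, D_eq (hf.comp (planeMapL a b c e).contDiff),
    symD_coe (hf.comp (planeMapL a b c e).contDiff), dirD_comp_clm hf, map_zero, ← symD_coe hf]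
  rfl

/-- The cubic part is normalized by a linear change of `x` and `y`. -/
theorem IsCorankTwo.exists_isCubicNormalized (hf : IsCorankTwo f)
    (h : ¬ ∃ α β : ℝ, ∀ s t : ℝ, cubicPart f s t = (α * s + β * t) ^ 3) :
    ∃ a b c e : ℝ, a * e - b * c ≠ 0 ∧ IsCorankTwo (f ∘ planeMap a b c e) ∧
      IsCubicNormalized (f ∘ planeMap a b c e) := by
  obtain ⟨a, b, c, e, h0, h1, h2, h3⟩ := exists_cubic_basis h
  refine ⟨a, b, c, e, h0, hf.comp_planeMap h0, ⟨?_, ?_, ?_⟩⟩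
  · rw [D_comp_planeMap hf.smooth, planeMapL_ev_zero, symD_plane hf.smooth]
    linear_combination h1
  · rw [D_comp_planeMap hf.smooth, planeMapL_ev_zero, planeMapL_ev_one, symD_plane hf.smooth]
    linear_combination h3
  · rw [D_comp_planeMap hf.smooth, planeMapL_ev_zero, planeMapL_ev_one, symD_plane hf.smooth]
    linear_combination h2

/-! ### The numbers `d_μ` -/

/-- The derivatives of `f` along a critical curve decide the type of the singularity. -/
theorem IsCritCurve.reducesTo_iff {γ : ℝ → Fin (n + 2) → ℝ} (hf : IsCorankTwo f)
    (hN : IsCubicNormalized f) (hγ : IsCritCurve f γ)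
    (hred : ∀ (m : ℕ) (c : ℝ), 3 ≤ m → c ≠ 0 →
      (∀ j, 0 < j → j < m → iteratedDeriv j (fun t => f (γ t)) 0 = 0) →
      iteratedDeriv m (fun t => f (γ t)) 0 = m.factorial * c → ReducesTo (m + 1) c f)
    {d : ℕ → ℝ} (hd : ∀ μ, 4 ≤ μ → d μ = iteratedDeriv (μ - 1) (fun t => f (γ t)) 0)
    {μ : ℕ} (hμ : 4 ≤ μ) :
    ((∀ j, 4 ≤ j → j < μ → d j = 0) → ∀ c, 0 < d μ * c → ReducesTo μ c f) ∧
      ∀ c, c ≠ 0 → ReducesTo μ c f → (∀ j, 4 ≤ j → j < μ → d j = 0) ∧ d μ ≠ 0 := by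
  have hlow := hN.iteratedDeriv_curve hf hγ.smooth hγ.zero (a := 0) (b := 1) (by
    rw [hγ.tangent]; simp)
  have hder : ∀ μ, 4 ≤ μ → (∀ j, 4 ≤ j → j < μ → d j = 0) →
      ∀ j, 0 < j → j < μ - 1 → iteratedDeriv j (fun t => f (γ t)) 0 = 0 := by
    intro μ hμ h0 j hj hjμ
    rcases (by omega : j = 1 ∨ j = 2 ∨ 3 ≤ j) with rfl | rfl | h3
    · exact hlow.1
    · exact hlow.2.1
    · have := h0 (j + 1) (by omega) (by omega)
      rwa [hd _ (by omega), Nat.add_sub_cancel] at this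
  have hto : ∀ μ, 4 ≤ μ → (∀ j, 4 ≤ j → j < μ → d j = 0) → ∀ c, 0 < d μ * c →
      ReducesTo μ c f := by
    intro μ hμ h0 c hc
    have hdμ : d μ ≠ 0 := fun h => by simp [h] at hc
    have hfac : (0 : ℝ) < (μ - 1).factorial := by positivity
    have h1 := hred (μ - 1) (d μ / (μ - 1).factorial) (by omega) (div_ne_zero hdμ hfac.ne')
      (hder μ hμ h0) (by rw [← hd μ hμ, mul_div_cancel₀ _ hfac.ne'])
    rw [Nat.sub_add_cancel (by omega)] at h1
    exact h1.of_mul_pos (by omega) (by rw [div_mul_eq_mul_div]; positivity)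
  refine ⟨hto μ hμ, fun c hc h => ?_⟩
  have hdiff : Differentiable ℝ f := hf.smooth.differentiable (by simp)
  obtain ⟨hL, hU⟩ := h.gradLower_and_gradUpper hμ hc hdiff
  -- the first nonvanishing `d_j`, if `j < μ`, would give the germ two different types
  have hzero : ∀ j, 4 ≤ j → j < μ → d j = 0 := by
    intro j
    induction j using Nat.strong_induction_on with
    | _ j ih =>
      intro hj hjμ
      by_contra hne
      have h1 := hto j hj (fun i hi hij => ih i hij hi (hij.trans hjμ)) (d j)
        (mul_self_pos.2 hne)
      have := (h1.gradLower_and_gradUpper hj hne hdiff).1.le_of_gradUpper hU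
      omega
  refine ⟨hzero, fun h0 => ?_⟩
  -- if `d_μ` vanished as well, the gradient would be too small on the critical curve
  have h1 := hγ.gradUpper hf.smooth (m := μ - 1) fun j hj hjμ =>
    hder (μ + 1) (by omega) (fun i hi hiμ => by
      rcases (by omega : i < μ ∨ i = μ) with h | rfl
      exacts [hzero i hi h, h0]) j hj (by omega)
  have := hL.le_of_gradUpper h1
  omega

end DSing

theorem mainTheorem6 (n : ℕ) :
    -- the normalization of the cubic part can be achieved by a linear change of `k₁, k₂`
    (∀ f : (Fin (n + 2) → ℝ) → ℝ, DSing.IsCorankTwo f →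
      (∃ s t : ℝ, DSing.cubicPart f s t ≠ 0) →
      (¬ ∃ α β : ℝ, ∀ s t : ℝ, DSing.cubicPart f s t = (α * s + β * t) ^ 3) →
      ∃ a b c e : ℝ, a * e - b * c ≠ 0 ∧
        DSing.IsCorankTwo (f ∘ DSing.planeMap a b c e) ∧
        DSing.IsCubicNormalized (f ∘ DSing.planeMap a b c e)) ∧
    -- the numbers `d_μ`
    ∃ P : ℕ → MvPolynomial (DSing.Var n) ℚ,
      (∀ μ : ℕ, 4 ≤ μ → MvPolynomial.constantCoeff (P μ) = 0 ∧
        ∀ v ∈ (P μ).vars, DSing.Allowed μ v) ∧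
      ∀ f : (Fin (n + 2) → ℝ) → ℝ, DSing.IsCorankTwo f → DSing.IsCubicNormalized f →
        DSing.IsTable f (DSing.dNum P f) ∧
        ∀ μ : ℕ, 4 ≤ μ →
          ((DSing.IsDPlus μ f ∨ DSing.IsDMinus μ f) ↔
            (∀ j : ℕ, 4 ≤ j → j < μ → DSing.dNum P f j = 0) ∧ DSing.dNum P f μ ≠ 0) ∧
          ((∀ j : ℕ, 4 ≤ j → j < μ → DSing.dNum P f j = 0) → DSing.dNum P f μ ≠ 0 →
            DSing.ReducesTo μ (DSing.dNum P f μ) f ∧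
            (0 < DSing.dNum P f μ → DSing.IsDPlus μ f) ∧
            (DSing.dNum P f μ < 0 → DSing.IsDMinus μ f)) := by
  refine ⟨fun f hf _ h => hf.exists_isCubicNormalized h, ?_⟩
  -- a critical curve deciding the type is chosen for each `f`
  have hex : ∀ f : (Fin (n + 2) → ℝ) → ℝ, DSing.IsCorankTwo f → DSing.IsCubicNormalized f → _ :=
    fun f hf hN => hN.exists_isCritCurve_reducesTo hf
  choose! Γ hΓ hred using hex
  choose P hP1 hP2 hP3 using fun L => DSing.isPolyFun_wordAlong_y hΓ L
  refine ⟨fun μ => P (μ - 4), fun μ hμ => ⟨hP2 _, fun v hv => ?_⟩, fun f hf hN => ?_⟩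
  · have h := MvPolynomial.mem_supported.1 (hP1 (μ - 4)) hv
    rwa [Set.mem_ofPred_eq, show μ - 4 + 2 + 2 = μ by omega] at h
  · have hγ := hΓ f hf hN
    have hd : ∀ μ, 4 ≤ μ → DSing.dNum (fun μ => P (μ - 4)) f μ =
        DSing.along f (Γ f) (μ - 1) 0 := fun μ hμ => by
      obtain ⟨L, rfl⟩ : ∃ L, μ = L + 4 := ⟨μ - 4, by omega⟩
      have h := hP3 L f hf hN
      rw [DSing.dNum, Nat.add_sub_cancel, ← h, show L + 4 - 1 = L + 2 + 1 by omega,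
        hγ.along_succ hf.smooth]
      simp
    have hd' : ∀ μ, 4 ≤ μ → DSing.dNum (fun μ => P (μ - 4)) f μ =
        iteratedDeriv (μ - 1) (fun t => f (Γ f t)) 0 := fun μ hμ => by
      rw [hd μ hμ, DSing.along, DSing.symD_zero]
    have htab := hγ.isTable hf hN
    refine ⟨⟨(hd 4 (by omega)).trans htab.d4, (hd 5 (by omega)).trans htab.d5,
      (hd 6 (by omega)).trans htab.d6, (hd 7 (by omega)).trans htab.d7,
      (hd 8 (by omega)).trans htab.d8⟩, fun μ hμ => ?_⟩
    obtain ⟨hto, hfrom⟩ := hγ.reducesTo_iff hf hN (hred f hf hN) hd' hμ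
    have hplus : (∀ j, 4 ≤ j → j < μ → DSing.dNum (fun μ => P (μ - 4)) f j = 0) →
        0 < DSing.dNum (fun μ => P (μ - 4)) f μ → DSing.IsDPlus μ f := fun h0 h =>
      hto h0 1 (by rwa [mul_one])
    have hminus : (∀ j, 4 ≤ j → j < μ → DSing.dNum (fun μ => P (μ - 4)) f j = 0) →
        DSing.dNum (fun μ => P (μ - 4)) f μ < 0 → DSing.IsDMinus μ f := fun h0 h =>
      hto h0 (-1) (by linarith)
    refine ⟨⟨?_, fun ⟨h0, h⟩ => ?_⟩, fun h0 h =>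
      ⟨hto h0 _ (mul_self_pos.2 h), hplus h0, hminus h0⟩⟩
    · rintro (h | h)
      exacts [hfrom 1 one_ne_zero h, hfrom (-1) (by norm_num) h]
    · rcases lt_or_gt_of_ne h with h' | h'
      exacts [Or.inr (hminus h0 h'), Or.inl (hplus h0 h')]
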